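/- Let $p$ be an odd prime and $k$ a finite field of characteristic $p$. Let $B\subset \mathrm{GL}_2(\mathbf Q_p)$ be the group of upper triangular matrices, $P\subset B$ the subgroup of matrices with lower right entry $1$, $Z\cong\mathbf Q_p^\times$ the group of scalar matrices, $S\subset\mathbf Q_p^\times$ the group of squares and $B_S\subset B$ the subgroup of matrices whose lower right entry lies in $S$. Let $v$ be the $p$-adic valuation and $\omega\colon \mathbf Q_p^\times\to\mathbf F_p^\times$ the character that sends $x$ to the residue class of $x p^{-v(x)}$; identify $\mu_2=\{\pm1\}\subset \mathbf F_p^\times\subset k^\times$, and let $\iota\colon\mu_2\to k^\times$ be the inclusion. Let $(a,b)=\omega\big((-1)^{v(a)v(b)}b^{v(a)}a^{-v(b)}\big)^{(p-1)/2}$ be the quadratic Hilbert symbol. Let $\widetilde G=\mathrm{GL}_2(\mathbf Q_p)\times\mu_2$ be the metaplectic group, with multiplication $(g,\zeta)(g',\zeta')=(gg',\zeta\zeta'\sigma(g,g'))$, where $$\sigma(g,g')=\Big(\frac{\mathfrak c(gg')}{\mathfrak c(g)},\frac{\mathfrak c(gg')}{\mathfrak c(g')}\det g\Big)$$ and $\mathfrak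 c(g)$ is the lower left entry of $g$ if this is non-zero and the lower right entry otherwise. Write $\widetilde C\subset\widetilde G$ for the preimage of $C\subset\mathrm{GL}_2(\mathbf Q_p)$, put $\widetilde{\mathbf Q_p^\times}=\widetilde Z$, and let $\widetilde S$ be the preimage of $S\subset \mathbf Q_p^\times\cong Z$. Then $\widetilde B=B\times\mu_2$ as a topological space; $\widetilde B_S=B_S\times\mu_2$ and $\widetilde S=S\times\mu_2$ as groups; and $g\mapsto(g,1)$ is a splitting $P\to\widetilde B$. A representation is genuine if $\mu_2$ acts through $\iota$. For $\tilde z\in\widetilde Z$ with image $z$ let $\chi_{\tilde z}\colon\mathbf Q_p^\times\to\mu_2$, $\chi_{\tilde z}(x)=\big((-1)^{v(z)v(x)}\omega(x)^{v(z)}\omega(z)^{v(x)}\big)^{(p-1)/2}$; this character is trivial for $\tilde z\in\widetilde S$. *$(\varphi,\Gamma)$-modules.* Let $\Gamma=\mathbf Z_p^\times$, and let $\varphi(f)(X)=f(X^p)$ and $\gamma(f)(X)=f((1+X)^\gamma-1)$ on $k((X))$. An étale $(\varphi,\Gamma)$-module $D$ is a finite dimensional $k((X))$-vector space with commuting semilinear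 actions of $\varphi$, whose image spans $D$, and of $\Gamma$, which is continuous. For $\chi\colon\mathbf Q_p^\times\to k^\times$ smooth, $D\otimes\chi$ has $\varphi$ multiplied by $\chi(p)$ and $\gamma\in\Gamma$ by $\chi(\gamma)$. A metaplectic $(\varphi,\Gamma)$-module is such a $D$ with a smooth genuine $k((X))$-linear action $\theta$ of $\widetilde{\mathbf Q_p^\times}$ such that $\theta(\tilde z)\colon D\to D\otimes\chi_{\tilde z}$ is a morphism for all $\tilde z$. An ind-metaplectic $(\varphi,\Gamma)$-module is an ind-object of the category of these. For $D$ with a smooth genuine action $\theta$ of $\widetilde S$ by automorphisms of $(\varphi,\Gamma)$-modules, $\mathrm{Ind}_{\widetilde S}^{\widetilde{\mathbf Q_p^\times}}(D)$ is the metaplectic $(\varphi,\Gamma)$-module of all functions $f\colon\widetilde{\mathbf Q_p^\times}\to D$ with $f(hx)=\theta(h)f(x)$ for $h\in\widetilde S$, with action by right translation and $(\varphi f)(x)=\chi_x(p)\varphi(f(x))$, $(\gamma f)(x)=\chi_x(\gamma)\gamma(f(x))$. For $d\in D$ let $\delta_{1,d}$ be the function with support in $\widetilde S$ and value $d$ at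 $1$. *The functors $\mathbf D$ and $\widetilde{\mathbf D}$.* A smooth $k$-representation $\pi$ of $P$ is a $k[[X]][F,\Gamma]$-module, where $1+X$, $F$ and $\gamma\in\Gamma$ act as $\begin{pmatrix}1&1\\0&1\end{pmatrix}$, $\begin{pmatrix}p&0\\0&1\end{pmatrix}$ and $\begin{pmatrix}\gamma&0\\0&1\end{pmatrix}$. Let $\mathcal M(\pi)$ be the directed set of its finitely generated $k[[X]][F,\Gamma]$-submodules $\tau$ with finite dimensional $X$-torsion $\tau[X]$. For $\tau\in\mathcal M(\pi)$ let $\mathbf D(\tau)=(\tau^\vee[1/X])'$, where $\tau^\vee=\mathrm{Hom}_k(\tau,k)$ and $(-)'$ is the $k((X))$-linear dual; it is an étale $(\varphi,\Gamma)$-module, covariant in $\tau$, whose operator $\varphi$ is given by $(\varphi u)(f)=\sum_{i=0}^{p-1}(1+X)^i\varphi\big(u(((1+X)^{-i}f)\circ F)\big)$ for $f\in\tau^\vee$, and $(\gamma u)(f)=\gamma(u(f\circ\gamma))$. Let $\mathbf D(\pi)$ be the ind-object $\varinjlim_{\tau\in\mathcal M(\pi)}\mathbf D(\tau)$; a representation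 of $B$ is first restricted to $P$. For a smooth genuine representation $\Pi$ of $\widetilde B$, restricted to $P$ along $g\mapsto(g,1)$, the group $\widetilde{\mathbf Q_p^\times}$ acts on $\mathbf D(\tau')$ for each $\widetilde{\mathbf Q_p^\times}$-stable $\tau'\in\mathcal M(\Pi)$ and makes it a metaplectic $(\varphi,\Gamma)$-module $\widetilde{\mathbf D}(\tau')$; if the $\widetilde{\mathbf Q_p^\times}$-stable elements are cofinal in $\mathcal M(\Pi)$, as is the case for the induced representation below, then $\widetilde{\mathbf D}(\Pi)$ is the ind-metaplectic $(\varphi,\Gamma)$-module $\varinjlim_{\tau'}\widetilde{\mathbf D}(\tau')$ over these $\tau'$. **Proposition.** Let $\pi$ be a smooth $k$-representation of $B$ with (smooth) central character $\chi\colon\mathbf Q_p^\times\to k^\times$, let $\Pi=\mathrm{Ind}_{\widetilde B_S}^{\widetilde B}(\pi|_{B_S}\boxtimes\iota)$ be the smooth induction, and let $\mathrm{incl}\colon\pi\to\Pi$ be the $P$-equivariant inclusion that sends $w$ to the function with support in $\widetilde B_S$ and value $w$ at $1$. Let $$\mathrm{Ind}_{\widetilde S}^{\widetilde{\mathbf Q_p^\times}}(\chi|_S\boxtimes\mathbf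 D(\pi)\boxtimes\iota)=\varinjlim_{\tau\in\mathcal M(\pi)}\mathrm{Ind}_{\widetilde S}^{\widetilde{\mathbf Q_p^\times}}(\chi|_S\boxtimes\mathbf D(\tau)\boxtimes\iota)$$ be the extension of the induction functor to ind-objects, where $\widetilde S=S\times\mu_2$ acts on $\chi|_S\boxtimes\mathbf D(\tau)\boxtimes\iota$ through the character $\chi|_S\boxtimes\iota$. 1. For all $\tau\in\mathcal M(\pi)$ and all $\widetilde{\mathbf Q_p^\times}$-stable $\tau'\in\mathcal M(\Pi)$ with $\mathrm{incl}(\tau)\subseteq\tau'$ there is exactly one morphism of metaplectic $(\varphi,\Gamma)$-modules $$g_{\tau,\tau'}\colon\mathrm{Ind}_{\widetilde S}^{\widetilde{\mathbf Q_p^\times}}(\chi|_S\boxtimes\mathbf D(\tau)\boxtimes\iota)\to\widetilde{\mathbf D}(\tau')$$ that corresponds under Frobenius reciprocity to the map $\mathbf D(\mathrm{incl})\colon\mathbf D(\tau)\to\mathbf D(\tau')$, i.e. with $g_{\tau,\tau'}(\delta_{1,d})=\mathbf D(\mathrm{incl})(d)$ for all $d\in\mathbf D(\tau)$. 2. There is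 exactly one isomorphism of ind-metaplectic $(\varphi,\Gamma)$-modules $$\widetilde{\mathbf D}\big(\mathrm{Ind}_{\widetilde B_S}^{\widetilde B}(\pi|_{B_S}\boxtimes\iota)\big)\cong\mathrm{Ind}_{\widetilde S}^{\widetilde{\mathbf Q_p^\times}}(\chi|_S\boxtimes\mathbf D(\pi)\boxtimes\iota)$$ whose inverse is induced by the morphisms $g_{\tau,\tau'}$, i.e. for all $\tau$, $\tau'$ as in 1, the restriction of the inverse to the term of index $\tau$ is the composition of $g_{\tau,\tau'}$ with the canonical morphism $\widetilde{\mathbf D}(\tau')\to\widetilde{\mathbf D}(\Pi)$. -/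

import Mathlib

universe u
namespace Metaplectic
open PowerSeries

section Coeff
set_option linter.unusedSectionVars false
variable (p : ℕ) [Fact p.Prime] (k : Type u) [Field k] [CharP k p]

/-- Reduction `ℤ_p → 𝔽_p ⊆ k`. -/
noncomputable def padicToField : ℤ_[p] →+* k :=
  (ZMod.castHom (dvd_refl p) k).comp PadicInt.toZMod

/-- The power series `(1 + X) ^ a = ∑ n, (a choose n) X ^ n` for `a ∈ ℤ_p`, with coefficients
reduced to `k`. -/
noncomputable def onePlusX (a : ℤ_[p]) : k⟦X⟧ :=
  PowerSeries.map (padicToField p k) (binomialSeries ℤ_[p] a)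

lemma onePlusX_zero : onePlusX p k 0 = 1 := by simp [onePlusX]

lemma onePlusX_add (a b : ℤ_[p]) : onePlusX p k (a + b) = onePlusX p k a * onePlusX p k b := by
  simp [onePlusX, binomialSeries_add]

lemma onePlusX_nat (n : ℕ) : onePlusX p k (n : ℤ_[p]) = (1 + X) ^ n := by
  have := binomialSeries_nat (R := ℤ_[p]) (A := ℤ_[p]) n
  simp [onePlusX, this]

lemma constantCoeff_onePlusX (a : ℤ_[p]) : constantCoeff (onePlusX p k a) = 1 := by
  rw [onePlusX, ← coeff_zero_eq_constantCoeff_apply, coeff_map, coeff_zero_eq_constantCoeff_apply,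
    binomialSeries_constantCoeff, map_one]

lemma onePlusX_nsmul (n : ℕ) (a : ℤ_[p]) : onePlusX p k (n * a) = onePlusX p k a ^ n := by
  induction n with
  | zero => simp [onePlusX_zero]
  | succ n ih => rw [Nat.cast_succ, add_mul, one_mul, onePlusX_add, ih, pow_succ]

lemma X_pow_dvd_onePlusX_sub (m : ℕ) (a b : ℤ_[p]) (h : (p : ℤ_[p]) ^ m ∣ a - b) :
    (X : k⟦X⟧) ^ p ^ m ∣ onePlusX p k a - onePlusX p k b := by
  obtain ⟨c, hc⟩ := h
  have hab : a = b + ((p ^ m : ℕ) : ℤ_[p]) * c := by push_cast; linear_combination hc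
  have : CharP k⟦X⟧ p := charP_of_injective_ringHom (C_injective (R := k)) p
  have h1 : X ∣ onePlusX p k c - 1 := by
    rw [X_dvd_iff, map_sub, constantCoeff_onePlusX, map_one, sub_self]
  rw [hab, onePlusX_add, onePlusX_nsmul, show onePlusX p k b * onePlusX p k c ^ p ^ m
    - onePlusX p k b = onePlusX p k b * (onePlusX p k c ^ p ^ m - 1 ^ p ^ m) by ring,
    ← sub_pow_char_pow]
  exact Dvd.dvd.mul_left (pow_dvd_pow_of_dvd h1 _) _

lemma eq_of_X_pow_dvd {a b : k⟦X⟧} (h : ∀ n : ℕ, (X : k⟦X⟧) ^ n ∣ a - b) : a = b := by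
  ext n
  have := X_pow_dvd_iff.1 (h (n + 1)) n (Nat.lt_succ_self n)
  rwa [map_sub, sub_eq_zero] at this

/-- The `k`-linear endomorphism `φ` of `k⟦X⟧` with `φ(X) = X ^ p`. -/
noncomputable def phiA : k⟦X⟧ →ₐ[k] k⟦X⟧ := expand p (Fact.out : p.Prime).ne_zero

lemma hasSubst_onePlusX (a : ℤ_[p]) : HasSubst (onePlusX p k a - 1) :=
  HasSubst.of_constantCoeff_zero' (by rw [map_sub, constantCoeff_onePlusX, map_one, sub_self])

/-- The `k`-linear endomorphism of `k⟦X⟧` with `f(X) ↦ f((1 + X) ^ a - 1)`, for `a ∈ ℤ_p`. -/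
noncomputable def gamA (a : ℤ_[p]) : k⟦X⟧ →ₐ[k] k⟦X⟧ := substAlgHom (hasSubst_onePlusX p k a)

lemma phiA_X : phiA p k X = X ^ p := by simp [phiA]

lemma gamA_X (a : ℤ_[p]) : gamA p k a X = onePlusX p k a - 1 := by
  rw [gamA, substAlgHom_X]

lemma algHom_coe (e : k⟦X⟧ →ₐ[k] k⟦X⟧) (q : Polynomial k) :
    e (q : k⟦X⟧) = Polynomial.aeval (e X) q := by
  have : e.comp (Polynomial.coeToPowerSeries.algHom k) = Polynomial.aeval (e X) := by
    ext; simp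
  simpa using DFunLike.congr_fun this q

lemma algHom_congr {f g : k⟦X⟧ →ₐ[k] k⟦X⟧} (n : ℕ) (hf : X ∣ f X) (hg : X ∣ g X)
    (h : X ^ n ∣ f X - g X) (a : k⟦X⟧) : X ^ n ∣ f a - g a := by
  rw [eq_X_pow_mul_shift_add_trunc n a, map_add, map_add, map_mul, map_mul, map_pow, map_pow,
    algHom_coe, algHom_coe, add_sub_add_comm]
  refine dvd_add ?_ (h.trans ?_)
  swap
  · rw [Polynomial.aeval_def, Polynomial.aeval_def, Polynomial.eval₂_eq_eval_map,
      Polynomial.eval₂_eq_eval_map]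
    exact Polynomial.sub_dvd_eval_sub _ _ _
  refine dvd_sub ?_ ?_
  · exact Dvd.dvd.mul_right (pow_dvd_pow_of_dvd hf n) _
  · exact Dvd.dvd.mul_right (pow_dvd_pow_of_dvd hg n) _

lemma algHom_ext {f g : k⟦X⟧ →ₐ[k] k⟦X⟧} (hf : X ∣ f X) (h : f X = g X) : f = g := by
  ext1 a
  exact eq_of_X_pow_dvd k fun n => algHom_congr k n hf (h ▸ hf) (by simp [h]) a

lemma X_dvd_gamA_X (a : ℤ_[p]) : X ∣ gamA p k a X := by
  rw [gamA_X, X_dvd_iff, map_sub, constantCoeff_onePlusX, map_one, sub_self]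

lemma X_dvd_phiA_X : X ∣ phiA p k X := by
  rw [phiA_X]; exact dvd_pow_self _ (Fact.out : p.Prime).ne_zero

lemma X_pow_dvd_map (f : k⟦X⟧ →ₐ[k] k⟦X⟧) (hf : X ∣ f X) {n : ℕ} {a : k⟦X⟧} (h : X ^ n ∣ a) :
    X ^ n ∣ f a := by
  obtain ⟨b, rfl⟩ := h
  rw [map_mul, map_pow]
  exact Dvd.dvd.mul_right (pow_dvd_pow_of_dvd hf n) _

lemma map_onePlusX (f : k⟦X⟧ →ₐ[k] k⟦X⟧) (hf : X ∣ f X) (c : ℤ_[p])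
    (h : f X = onePlusX p k c - 1) (a : ℤ_[p]) : f (onePlusX p k a) = onePlusX p k (a * c) := by
  refine eq_of_X_pow_dvd k fun m => ?_
  refine (pow_dvd_pow X (Nat.lt_pow_self (Fact.out : p.Prime).one_lt (n := m)).le).trans ?_
  obtain ⟨n, hn⟩ : ∃ n : ℕ, (p : ℤ_[p]) ^ m ∣ a - n :=
    ⟨a.appr m, Ideal.mem_span_singleton.1 (PadicInt.appr_spec m a)⟩
  have h1 := X_pow_dvd_map k f hf (X_pow_dvd_onePlusX_sub p k m a n hn)
  have h2 := X_pow_dvd_onePlusX_sub p k m (a * c) (n * c) (by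
    rw [← sub_mul]; exact Dvd.dvd.mul_right hn c)
  rw [onePlusX_nat, map_sub, map_pow, map_add, map_one, h, add_sub_cancel, ← onePlusX_nsmul] at h1
  have := dvd_sub h1 h2
  rwa [show ∀ x y z : k⟦X⟧, x - y - (z - y) = x - z from fun x y z => by ring] at this

lemma gamA_onePlusX (a b : ℤ_[p]) : gamA p k a (onePlusX p k b) = onePlusX p k (b * a) :=
  map_onePlusX p k _ (X_dvd_gamA_X p k a) a (gamA_X p k a) b

lemma phiA_onePlusX (b : ℤ_[p]) : phiA p k (onePlusX p k b) = onePlusX p k (b * p) := by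
  refine map_onePlusX p k _ (X_dvd_phiA_X p k) p ?_ b
  have : CharP k⟦X⟧ p := charP_of_injective_ringHom (C_injective (R := k)) p
  rw [phiA_X, onePlusX_nat, add_pow_char, one_pow, add_sub_cancel_left]

lemma gamA_mul (a b : ℤ_[p]) (f : k⟦X⟧) : gamA p k (a * b) f = gamA p k a (gamA p k b f) := by
  have : gamA p k (a * b) = (gamA p k a).comp (gamA p k b) := by
    refine algHom_ext k (X_dvd_gamA_X p k _) ?_
    rw [AlgHom.comp_apply, gamA_X, gamA_X, map_sub, map_one, gamA_onePlusX, mul_comm a b]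
  rw [this]; rfl

lemma gamA_one (f : k⟦X⟧) : gamA p k 1 f = f := by
  have : gamA p k 1 = AlgHom.id k _ := by
    refine algHom_ext k (X_dvd_gamA_X p k _) ?_
    have := onePlusX_nat p k 1
    rw [Nat.cast_one, pow_one] at this
    rw [gamA_X, this, add_sub_cancel_left, AlgHom.id_apply]
  rw [this]; rfl

lemma gamA_phiA (a : ℤ_[p]) (f : k⟦X⟧) : gamA p k a (phiA p k f) = phiA p k (gamA p k a f) := by
  have : (gamA p k a).comp (phiA p k) = (phiA p k).comp (gamA p k a) := by
    refine algHom_ext k ?_ ?_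
    · rw [AlgHom.comp_apply, phiA_X, map_pow]
      exact (X_dvd_gamA_X p k a).trans (dvd_pow_self _ (Fact.out : p.Prime).ne_zero)
    · have : CharP k⟦X⟧ p := charP_of_injective_ringHom (C_injective (R := k)) p
      rw [AlgHom.comp_apply, AlgHom.comp_apply, gamA_X, map_sub, map_one, phiA_onePlusX, phiA_X,
        map_pow, gamA_X, sub_pow_char, one_pow, mul_comm, onePlusX_nsmul]
  exact DFunLike.congr_fun this f

lemma gamA_congr (m : ℕ) (a : ℤ_[p]) (h : (p : ℤ_[p]) ^ m ∣ a - 1) (f : k⟦X⟧) :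
    X ^ p ^ m ∣ gamA p k a f - f := by
  have := algHom_congr k (p ^ m) (X_dvd_gamA_X p k a) (X_dvd_gamA_X p k 1)
    (by simpa [gamA_X] using X_pow_dvd_onePlusX_sub p k m a 1 h) f
  rwa [gamA_one] at this

lemma phiA_injective : Function.Injective (phiA p k) := by
  intro a b h
  ext n
  have := congrArg (coeff (p * n)) h
  simpa [phiA, coeff_expand_mul] using this

lemma gamA_injective (a : ℤ_[p]ˣ) : Function.Injective (gamA p k a) := by
  refine Function.LeftInverse.injective (g := gamA p k ↑a⁻¹) fun f => ?_
  rw [← gamA_mul, Units.inv_mul, gamA_one]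

/-- Frobenius `φ` on `k((X))`. -/
noncomputable def phiK : LaurentSeries k →+* LaurentSeries k :=
  IsFractionRing.map (A := k⟦X⟧) (B := k⟦X⟧) (j := (phiA p k).toRingHom) (phiA_injective p k)

/-- The automorphism `f(X) ↦ f((1 + X) ^ γ - 1)` of `k((X))`, for `γ ∈ Γ = ℤ_pˣ`. -/
noncomputable def gamK (γ : ℤ_[p]ˣ) : LaurentSeries k →+* LaurentSeries k :=
  IsFractionRing.map (A := k⟦X⟧) (B := k⟦X⟧) (j := (gamA p k γ).toRingHom) (gamA_injective p k γ)

lemma phiK_coe (a : k⟦X⟧) : phiK p k (algebraMap _ _ a) = algebraMap _ _ (phiA p k a) := by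
  rw [phiK, IsFractionRing.map, IsLocalization.map_eq]; rfl

lemma gamK_coe (γ : ℤ_[p]ˣ) (a : k⟦X⟧) :
    gamK p k γ (algebraMap _ _ a) = algebraMap _ _ (gamA p k γ a) := by
  rw [gamK, IsFractionRing.map, IsLocalization.map_eq]; rfl

lemma ringHom_ext {f g : LaurentSeries k →+* LaurentSeries k}
    (h : ∀ a : k⟦X⟧, f (algebraMap _ _ a) = g (algebraMap _ _ a)) : f = g :=
  IsLocalization.ringHom_ext (nonZeroDivisors k⟦X⟧) (RingHom.ext h)

lemma gamK_mul (γ δ : ℤ_[p]ˣ) (c : LaurentSeries k) :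
    gamK p k (γ * δ) c = gamK p k γ (gamK p k δ c) := by
  have : gamK p k (γ * δ) = (gamK p k γ).comp (gamK p k δ) :=
    ringHom_ext k fun a => by
      rw [RingHom.comp_apply, gamK_coe, gamK_coe, gamK_coe, Units.val_mul, gamA_mul]
  rw [this]; rfl

lemma gamK_one (c : LaurentSeries k) : gamK p k 1 c = c := by
  have : gamK p k 1 = RingHom.id _ := ringHom_ext k fun a => by
      rw [RingHom.id_apply, gamK_coe, Units.val_one, gamA_one]
  rw [this]; rfl

lemma gamK_phiK (γ : ℤ_[p]ˣ) (c : LaurentSeries k) :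
    gamK p k γ (phiK p k c) = phiK p k (gamK p k γ c) := by
  have : (gamK p k γ).comp (phiK p k) = (phiK p k).comp (gamK p k γ) :=
    ringHom_ext k fun a => by
      rw [RingHom.comp_apply, RingHom.comp_apply, gamK_coe, phiK_coe, phiK_coe, gamK_coe, gamA_phiA]
  exact DFunLike.congr_fun this c

lemma phiA_decomp (a : k⟦X⟧) :
    a = ∑ j ∈ Finset.range p, X ^ j * phiA p k (mk fun n => coeff (p * n + j) a) := by
  have hp := (Fact.out : p.Prime).pos
  ext n
  rw [map_sum, Finset.sum_eq_single (n % p)]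
  · rw [coeff_X_pow_mul', if_pos (Nat.mod_le n p), phiA]
    have h1 : n - n % p = p * (n / p) := by have := Nat.mod_add_div n p; omega
    rw [h1, coeff_expand_mul, coeff_mk, Nat.div_add_mod]
  · intro j hj hne
    rw [coeff_X_pow_mul']
    split_ifs with hle
    · refine coeff_expand_of_not_dvd _ _ _ fun ⟨c, hc⟩ => hne ?_
      have : n = j + p * c := by omega
      rw [this, Nat.add_mul_mod_self_left, Nat.mod_eq_of_lt (Finset.mem_range.1 hj)]
    · rfl
  · intro h; exact absurd (Finset.mem_range.2 (Nat.mod_lt n hp)) h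

lemma phiA_indep (b : ℕ → k⟦X⟧) (h : ∑ j ∈ Finset.range p, X ^ j * phiA p k (b j) = 0)
    (j : ℕ) (hj : j < p) : b j = 0 := by
  have hp := (Fact.out : p.Prime).pos
  ext n
  have h1 := congrArg (coeff (p * n + j)) h
  rw [map_sum, Finset.sum_eq_single j, coeff_X_pow_mul', if_pos (Nat.le_add_left _ _),
    Nat.add_sub_cancel, phiA, coeff_expand_mul] at h1
  · simpa using h1
  · intro i hi hne
    rw [coeff_X_pow_mul']
    split_ifs with hle
    · refine coeff_expand_of_not_dvd _ _ _ fun ⟨c, hc⟩ => hne ?_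
      have h2 : p * n + j = i + p * c := by omega
      have := congrArg (· % p) h2
      simp only [Nat.mul_add_mod, Nat.add_mul_mod_self_left] at this
      rw [Nat.mod_eq_of_lt hj, Nat.mod_eq_of_lt (Finset.mem_range.1 hi)] at this
      exact this.symm
    · rfl
  · intro h'; exact absurd (Finset.mem_range.2 hj) h'

lemma exists_X_pow_mul (c : LaurentSeries k) :
    ∃ (n : ℕ) (a : k⟦X⟧), algebraMap k⟦X⟧ (LaurentSeries k) (X ^ n) * c = algebraMap _ _ a := by
  obtain ⟨⟨a, s⟩, h⟩ := IsLocalization.surj (Submonoid.powers (X : k⟦X⟧)) c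
  obtain ⟨n, hn⟩ := s.2
  exact ⟨n, a, by rw [show X ^ n = (s : k⟦X⟧) from hn, mul_comm]; exact h⟩

/-- The elements `(1 + X) ^ i`, `0 ≤ i < p`, are linearly independent over `φ(k((X)))`. -/
lemma phiK_indep (c : ℕ → LaurentSeries k)
    (h : ∑ i ∈ Finset.range p, algebraMap k⟦X⟧ _ ((1 + X) ^ i) * phiK p k (c i) = 0)
    (i : ℕ) (hi : i < p) : c i = 0 := by
  have hn : ∃ (n : ℕ) (b : ℕ → k⟦X⟧), ∀ i < p,
      algebraMap k⟦X⟧ (LaurentSeries k) (X ^ n) * c i = algebraMap _ _ (b i) := by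
    choose n a ha using fun i => exists_X_pow_mul k (c i)
    refine ⟨∑ i ∈ Finset.range p, n i, fun i => X ^ (∑ i ∈ Finset.range p, n i - n i) * a i,
      fun i hi => ?_⟩
    have hle : n i ≤ ∑ i ∈ Finset.range p, n i :=
      Finset.single_le_sum (f := n) (fun _ _ => Nat.zero_le _) (Finset.mem_range.2 hi)
    rw [map_mul, ← ha, ← mul_assoc, ← map_mul, ← pow_add, Nat.sub_add_cancel hle]
  obtain ⟨n, b, hb⟩ := hn
  set P : Polynomial k⟦X⟧ := ∑ i ∈ Finset.range p, Polynomial.monomial i (b i) with hP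
  have hPd : P.degree < p := (Polynomial.degree_sum_le _ _).trans_lt <|
    (Finset.sup_lt_iff (WithBot.bot_lt_coe p)).2 fun i hi =>
      (Polynomial.degree_monomial_le _ _).trans_lt (Nat.cast_lt.2 (Finset.mem_range.1 hi))
  have h0 : P.eval₂ (phiA p k).toRingHom (X + 1) = 0 := by
    apply IsFractionRing.injective k⟦X⟧ (LaurentSeries k)
    rw [hP, Polynomial.eval₂_finsetSum, map_sum, map_zero,
      ← mul_zero (phiK p k (algebraMap k⟦X⟧ (LaurentSeries k) (X ^ n))), ← h, Finset.mul_sum]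
    refine Finset.sum_congr rfl fun i hi => ?_
    have := congrArg (phiK p k) (hb i (Finset.mem_range.1 hi))
    rw [map_mul, phiK_coe p k (b i)] at this
    rw [Polynomial.eval₂_monomial, map_mul, add_comm X]
    change algebraMap _ _ (phiA p k (b i)) * _ = _
    rw [← this]; ring
  set Q := Polynomial.taylor 1 P with hQ
  have hQd : Q.degree < p := by rw [hQ, Polynomial.degree_taylor]; exact hPd
  have h1 : Q.eval₂ (phiA p k).toRingHom X = 0 := by
    rw [hQ, Polynomial.taylor_apply, Polynomial.eval₂_comp, ← h0]
    simp
  have hQ0 : Q = 0 := by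
    rw [Polynomial.eval₂_eq_sum_range' _ (n := p)] at h1
    · refine Polynomial.ext fun j => ?_
      by_cases hj : j < p
      · exact phiA_indep p k Q.coeff (by
          rw [← h1]; exact Finset.sum_congr rfl fun _ _ => mul_comm _ _) j hj
      · rw [Polynomial.coeff_zero]
        exact Polynomial.coeff_eq_zero_of_degree_lt
          (hQd.trans_le (by exact_mod_cast not_lt.1 hj))
    · by_cases hz : Q = 0
      · rw [hz]; simpa using (Fact.out : p.Prime).pos
      · exact (Polynomial.natDegree_lt_iff_degree_lt hz).2 hQd
  have hP0 : P = 0 := Polynomial.taylor_injective 1 (by rw [← hQ, hQ0, map_zero])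
  have hbi : b i = 0 := by
    have := congrArg (fun q => Polynomial.coeff q i) hP0
    simpa [hP, Polynomial.coeff_monomial, hi] using this
  have := hb i hi
  rw [hbi, map_zero] at this
  refine (mul_eq_zero.1 this).resolve_left ?_
  refine (map_ne_zero_iff _ (IsFractionRing.injective k⟦X⟧ (LaurentSeries k))).2 ?_
  exact pow_ne_zero _ X_ne_zero

lemma mem_nhds_iff_X_pow {s : Set (LaurentSeries k)} {c : LaurentSeries k} :
    s ∈ nhds c ↔ ∃ n : ℕ, ∀ a : k⟦X⟧, c + algebraMap _ _ (X ^ n * a) ∈ s := by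
  have hX : ∀ n : ℕ, Valued.v (algebraMap k⟦X⟧ (LaurentSeries k) (X ^ n)) =
      WithZero.exp (-(n : ℤ)) := fun n => by
    rw [← LaurentSeries.valuation_X_pow k, map_pow]; rfl
  have hle : ∀ a : k⟦X⟧, Valued.v (algebraMap k⟦X⟧ (LaurentSeries k) a) ≤ (1 : WithZero (Multiplicative ℤ)) :=
    fun a => (LaurentSeries.val_le_one_iff_eq_coe k _).2 ⟨a, rfl⟩
  rw [Valued.mem_nhds]
  constructor
  · rintro ⟨γ, hγ⟩
    have h0 : MonoidWithZeroHom.ValueGroup₀.embedding γ.1 ≠ 0 := by simp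
    obtain ⟨n, hn⟩ : ∃ n : ℕ, WithZero.exp (-(n : ℤ)) <
        MonoidWithZeroHom.ValueGroup₀.embedding γ.1 := by
      obtain ⟨m, hm⟩ : ∃ m : ℤ, WithZero.exp m = MonoidWithZeroHom.ValueGroup₀.embedding γ.1 :=
        ⟨WithZero.log _, WithZero.exp_log h0⟩
      refine ⟨(1 - m).toNat, ?_⟩
      rw [← hm, WithZero.exp_lt_exp]
      omega
    refine ⟨n, fun a => hγ ?_⟩
    rw [Set.mem_ofPred_eq, add_sub_cancel_left, Valuation.restrict_lt_iff_lt_embedding]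
    refine lt_of_le_of_lt ?_ hn
    rw [map_mul, map_mul, hX]
    exact mul_le_of_le_one_right' (hle a)
  · rintro ⟨n, hn⟩
    have h0 : algebraMap k⟦X⟧ (LaurentSeries k) (X ^ n) ≠ 0 :=
      (map_ne_zero_iff _ (IsFractionRing.injective k⟦X⟧ (LaurentSeries k))).2
        (pow_ne_zero _ X_ne_zero)
    refine ⟨Units.mk0 (Valued.v.restrict (algebraMap k⟦X⟧ (LaurentSeries k) (X ^ n))) (by simp),
      fun y hy => ?_⟩
    have hy' : Valued.v (y - c) ≤ Valued.v (algebraMap k⟦X⟧ (LaurentSeries k) (X ^ n)) :=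
      ((Valuation.restrict_lt_iff _).1 hy).le
    have h1 : Valued.v ((y - c) / algebraMap k⟦X⟧ (LaurentSeries k) (X ^ n)) ≤
        (1 : WithZero (Multiplicative ℤ)) := by
      rw [map_div₀]
      exact div_le_one_of_le₀ hy' zero_le
    obtain ⟨a, ha⟩ := (LaurentSeries.val_le_one_iff_eq_coe k _).1 h1
    have := hn a
    rw [map_mul, show algebraMap k⟦X⟧ (LaurentSeries k) a = _ from ha, mul_div_cancel₀ _ h0] at this
    simpa using this

lemma nhds_one_units (m : ℕ) : ∀ᶠ γ : ℤ_[p]ˣ in nhds 1, (p : ℤ_[p]) ^ m ∣ (γ : ℤ_[p]) - 1 := by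
  have h : ∀ᶠ x : ℤ_[p] in nhds 1, (p : ℤ_[p]) ^ m ∣ x - 1 := by
    have hp : (0 : ℝ) < (p : ℝ) ^ (-m : ℤ) := zpow_pos (by exact_mod_cast (Fact.out : p.Prime).pos) _
    filter_upwards [Metric.ball_mem_nhds (1 : ℤ_[p]) hp] with x hx
    rw [← Ideal.mem_span_singleton, ← PadicInt.norm_le_pow_iff_mem_span_pow]
    exact (mem_ball_iff_norm.1 hx).le
  exact (Units.continuous_val.tendsto' (1 : ℤ_[p]ˣ) 1 rfl).eventually h

lemma X_dvd_gamA_unit (γ : ℤ_[p]ˣ) : gamA p k γ X ∣ X := by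
  have := map_dvd (gamA p k γ) (X_dvd_gamA_X p k ↑γ⁻¹)
  rwa [← gamA_mul, Units.mul_inv, gamA_one] at this

lemma algebraMap_X_ne_zero (n : ℕ) : algebraMap k⟦X⟧ (LaurentSeries k) (X ^ n) ≠ 0 :=
  (map_ne_zero_iff _ (IsFractionRing.injective k⟦X⟧ (LaurentSeries k))).2
    (pow_ne_zero _ X_ne_zero)

lemma continuous_gamK_one (c : LaurentSeries k) (n : ℕ) :
    ∀ᶠ γ : ℤ_[p]ˣ in nhds 1, ∃ a : k⟦X⟧, gamK p k γ c - c = algebraMap _ _ (X ^ n * a) := by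
  obtain ⟨m, a, ha⟩ := exists_X_pow_mul k c
  filter_upwards [nhds_one_units p (n + 2 * m)] with γ hγ
  have hN := (Nat.lt_pow_self (Fact.out : p.Prime).one_lt (n := n + 2 * m)).le
  obtain ⟨b, hb⟩ := (pow_dvd_pow X hN).trans (gamA_congr p k _ _ hγ a)
  obtain ⟨d, hd⟩ := (pow_dvd_pow X hN).trans (gamA_congr p k _ _ hγ (X ^ m))
  obtain ⟨w, hw⟩ := pow_dvd_pow_of_dvd (X_dvd_gamA_unit p k γ) m
  rw [← map_pow] at hw
  refine ⟨w * (X ^ m * b - d * a), mul_left_cancel₀ (algebraMap_X_ne_zero k (2 * m)) ?_⟩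
  have h1 := congrArg (gamK p k γ) ha
  rw [map_mul, gamK_coe, gamK_coe] at h1
  have hb' := congrArg (algebraMap k⟦X⟧ (LaurentSeries k)) hb
  have hd' := congrArg (algebraMap k⟦X⟧ (LaurentSeries k)) hd
  have hw' := congrArg (algebraMap k⟦X⟧ (LaurentSeries k)) hw
  have h2 : algebraMap k⟦X⟧ (LaurentSeries k) (X ^ (2 * m)) =
    algebraMap k⟦X⟧ _ (X ^ m) * algebraMap k⟦X⟧ _ (X ^ m) := by
    rw [two_mul, pow_add, map_mul]
  have h3 : algebraMap k⟦X⟧ (LaurentSeries k) (X ^ (n + 2 * m)) =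
    algebraMap k⟦X⟧ _ (X ^ n) * (algebraMap k⟦X⟧ _ (X ^ m) * algebraMap k⟦X⟧ _ (X ^ m)) := by
    rw [pow_add, map_mul, h2]
  rw [map_sub, map_mul, h3] at hb' hd'
  rw [map_mul] at hw'
  rw [h2, map_mul, map_mul, map_sub, map_mul, map_mul]
  generalize algebraMap k⟦X⟧ (LaurentSeries k) (X ^ m) = Y at *
  generalize algebraMap k⟦X⟧ (LaurentSeries k) (gamA p k γ (X ^ m)) = Y' at *
  generalize algebraMap k⟦X⟧ (LaurentSeries k) a = A at *
  generalize algebraMap k⟦X⟧ (LaurentSeries k) (gamA p k γ a) = A' at *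
  generalize algebraMap k⟦X⟧ (LaurentSeries k) w = W at *
  linear_combination (exp := 1) Y * W * h1 - Y * ha + Y * W * hb' - W * A * hd' +
    (Y * gamK p k γ c - A) * hw'

lemma continuous_gamK (c : LaurentSeries k) (γ₀ : ℤ_[p]ˣ) (n : ℕ) :
    ∀ᶠ γ : ℤ_[p]ˣ in nhds γ₀, ∃ a : k⟦X⟧,
      gamK p k γ c - gamK p k γ₀ c = algebraMap _ _ (X ^ n * a) := by
  have h : Filter.Tendsto (fun γ : ℤ_[p]ˣ => γ * γ₀⁻¹) (nhds γ₀) (nhds 1) :=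
    (continuous_mul_const γ₀⁻¹).tendsto' _ _ (mul_inv_cancel γ₀)
  filter_upwards [h.eventually (continuous_gamK_one p k (gamK p k γ₀ c) n)] with γ hγ
  rwa [← gamK_mul, inv_mul_cancel_right] at hγ

lemma continuous_gamK_uncurry :
    Continuous fun x : ℤ_[p]ˣ × LaurentSeries k => gamK p k x.1 x.2 := by
  rw [continuous_iff_continuousAt]
  rintro ⟨γ₀, c₀⟩
  refine Filter.tendsto_def.2 fun s hs => ?_
  obtain ⟨n, hn⟩ := (mem_nhds_iff_X_pow k).1 hs
  have h2 : {c : LaurentSeries k | ∃ a : k⟦X⟧, c - c₀ = algebraMap _ _ (X ^ n * a)} ∈ nhds c₀ :=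
    (mem_nhds_iff_X_pow k).2 ⟨n, fun a => ⟨a, by simp⟩⟩
  refine Filter.mem_of_superset (prod_mem_nhds (continuous_gamK p k c₀ γ₀ n) h2) ?_
  rintro ⟨γ, c⟩ ⟨⟨a, ha⟩, ⟨b, hb⟩⟩
  obtain ⟨d, hd⟩ := X_pow_dvd_map k (gamA p k γ) (X_dvd_gamA_X p k γ) (Dvd.intro b rfl : X ^ n ∣ X ^ n * b)
  have h3 : gamK p k γ c = gamK p k γ₀ c₀ + algebraMap _ _ (X ^ n * (a + d)) := by
    have h4 := congrArg (gamK p k γ) hb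
    rw [map_sub, gamK_coe, hd] at h4
    dsimp only at ha
    rw [mul_add, map_add, ← h4, ← ha]; ring
  change gamK p k γ c ∈ s
  rw [h3]
  exact hn _
end Coeff
end Metaplectic

namespace Metaplectic
open PowerSeries CategoryTheory
section PG
set_option linter.unusedSectionVars false
variable (p : ℕ) [Fact p.Prime] (k : Type u) [Field k] [CharP k p]

/-- An étale `(φ, Γ)`-module over `k((X))`, with `Γ = ℤ_pˣ`. -/
structure PGMod where
  carrier : Type u
  [addCommGroup : AddCommGroup carrier]
  [module : Module (LaurentSeries k) carrier]
  [finite : Module.Finite (LaurentSeries k) carrier]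
  phi : carrier →ₛₗ[phiK p k] carrier
  gam : ∀ γ : ℤ_[p]ˣ, carrier →ₛₗ[gamK p k γ] carrier
  gam_one : ∀ x, gam 1 x = x
  gam_mul : ∀ γ δ x, gam (γ * δ) x = gam γ (gam δ x)
  phi_gam : ∀ γ x, phi (gam γ x) = gam γ (phi x)
  /-- The linearization `φ^* D → D` is surjective; as both sides have the same finite dimension,
  it is then an isomorphism. -/
  etale : Submodule.span (LaurentSeries k) (Set.range phi) = ⊤
  /-- The action `Γ × D → D` is continuous for the canonical topology of the finite dimensional
  `k((X))`-vector space `D`. -/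
  continuous_gam : ∀ [TopologicalSpace carrier] [IsModuleTopology (LaurentSeries k) carrier],
    Continuous fun x : ℤ_[p]ˣ × carrier => gam x.1 x.2

attribute [instance] PGMod.addCommGroup PGMod.module PGMod.finite

variable {p k}

/-- A morphism of `(φ, Γ)`-modules. -/
@[ext]
structure PGMod.Hom (D E : PGMod p k) where
  toLin : D.carrier →ₗ[LaurentSeries k] E.carrier
  map_phi : ∀ x, toLin (D.phi x) = E.phi (toLin x)
  map_gam : ∀ γ x, toLin (D.gam γ x) = E.gam γ (toLin x)

noncomputable instance : Category.{u} (PGMod p k) where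
  Hom := PGMod.Hom
  id D := ⟨LinearMap.id, fun _ => rfl, fun _ _ => rfl⟩
  comp f g := ⟨g.toLin ∘ₗ f.toLin, fun x => by simp [f.map_phi, g.map_phi],
    fun γ x => by simp [f.map_gam, g.map_gam]⟩

lemma continuous_gamK_comp {D : Type u} [TopologicalSpace D] {f : D → LaurentSeries k}
    (hf : Continuous f) : Continuous fun x : ℤ_[p]ˣ × D => gamK p k x.1 (f x.2) := by
  have h4 : Continuous fun x : ℤ_[p]ˣ × D => (x.1, f x.2) :=
    continuous_fst.prodMk (hf.comp continuous_snd)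
  have h5 := (continuous_gamK_uncurry p k).comp h4
  exact h5

lemma map_sum_smul {D : Type u} [AddCommGroup D] [Module (LaurentSeries k) D]
    {σ : LaurentSeries k →+* LaurentSeries k} (g : D →ₛₗ[σ] D) {ι : Type*} (s : Finset ι)
    (c : ι → LaurentSeries k) (x : ι → D) :
    g (∑ i ∈ s, c i • x i) = ∑ i ∈ s, σ (c i) • g (x i) := by
  rw [map_sum]
  exact Finset.sum_congr rfl fun i _ => g.map_smulₛₗ _ _

lemma continuous_of_orbits {D : Type u} [AddCommGroup D] [Module (LaurentSeries k) D]
    [Module.Finite (LaurentSeries k) D] [TopologicalSpace D] [IsModuleTopology (LaurentSeries k) D]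
    (gam : ∀ γ : ℤ_[p]ˣ, D →ₛₗ[gamK p k γ] D) (h : ∀ v, Continuous fun γ => gam γ v) :
    Continuous fun x : ℤ_[p]ˣ × D => gam x.1 x.2 := by
  have hadd : ContinuousAdd D := IsModuleTopology.toContinuousAdd (LaurentSeries k) D
  have hs : ContinuousSMul (LaurentSeries k) D := inferInstance
  obtain ⟨ι, hι, ⟨b⟩⟩ : ∃ (ι : Type u) (_ : Fintype ι), Nonempty (Module.Basis ι (LaurentSeries k) D) :=
    ⟨_, inferInstance, ⟨Module.Free.chooseBasis (LaurentSeries k) D⟩⟩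
  have h1 : ∀ x : ℤ_[p]ˣ × D, gam x.1 x.2 =
      ∑ i, gamK p k x.1 (b.coord i x.2) • gam x.1 (b i) := by
    intro x
    rw [← map_sum_smul]
    exact congrArg _ (b.sum_repr x.2).symm
  have h2 : ∀ i, Continuous (b.coord i) := fun i =>
    IsModuleTopology.continuous_of_linearMap (b.coord i)
  simp_rw [h1]
  exact continuous_finsetSum _ fun i _ =>
    (continuous_gamK_comp (h2 i)).smul ((h (b i)).comp continuous_fst)

end PG
end Metaplectic

namespace Metaplectic
open PowerSeries CategoryTheory
noncomputable section Dual
set_option linter.unusedSectionVars false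
variable (k : Type u) [Field k] (M : Type u) [AddCommGroup M] [Module k M] [Module k⟦X⟧ M]
  [IsScalarTower k k⟦X⟧ M]

/-- The dual `M^∨ = Hom_k(M, k)` of a `k⟦X⟧`-module. -/
def PDual : Type u := M →ₗ[k] k

instance : AddCommGroup (PDual k M) := inferInstanceAs (AddCommGroup (M →ₗ[k] k))
instance : Module k (PDual k M) := inferInstanceAs (Module k (M →ₗ[k] k))
instance : FunLike (PDual k M) M k := inferInstanceAs (FunLike (M →ₗ[k] k) M k)

variable {k M}
/-- A functional, as an element of `PDual`. -/
def PDual.of (f : M →ₗ[k] k) : PDual k M := f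
/-- An element of `PDual`, as a functional. -/
def PDual.lin (f : PDual k M) : M →ₗ[k] k := f

@[ext] lemma PDual.ext {f g : PDual k M} (h : ∀ w, f w = g w) : f = g := DFunLike.ext f g h

/-- The module structure `(a f)(w) = f(a w)`. -/
instance : Module k⟦X⟧ (PDual k M) where
  smul a f := LinearMap.comp (PDual.lin f) (Algebra.lsmul k k M a)
  one_smul f := PDual.ext fun w => congrArg f (one_smul _ w)
  mul_smul a b f := PDual.ext fun w => congrArg f (by
    change (a * b) • w = b • a • w
    rw [mul_comm, mul_smul])
  smul_zero a := rfl
  smul_add a f g := rfl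
  add_smul a b f := PDual.ext fun w => by
    change f ((a + b) • w) = f (a • w) + f (b • w)
    rw [add_smul]; exact map_add (PDual.lin f) _ _
  zero_smul f := PDual.ext fun w => by
    change f ((0 : k⟦X⟧) • w) = 0
    rw [zero_smul]; exact map_zero (PDual.lin f)

lemma PDual.smul_apply (a : k⟦X⟧) (f : PDual k M) (w : M) : (a • f) w = f (a • w) := rfl
lemma PDual.add_apply (f g : PDual k M) (w : M) : (f + g) w = f w + g w := rfl

variable {M' : Type u} [AddCommGroup M'] [Module k M'] [Module k⟦X⟧ M'] [IsScalarTower k k⟦X⟧ M']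

/-- The transpose `f ↦ f ∘ j` of a `k`-linear map. -/
def PDual.transpose (j : M →ₗ[k] M') : PDual k M' →+ PDual k M where
  toFun f := LinearMap.comp (PDual.lin f) j
  map_zero' := rfl
  map_add' _ _ := rfl

@[simp] lemma PDual.transpose_apply (j : M →ₗ[k] M') (f : PDual k M') (w : M) :
    PDual.transpose j f w = f (j w) := rfl

/-- The transpose of a `k⟦X⟧`-linear map. -/
def PDual.map (j : M →ₗ[k⟦X⟧] M') : PDual k M' →ₗ[k⟦X⟧] PDual k M where
  toFun := PDual.transpose (j.restrictScalars k)
  map_add' _ _ := rfl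
  map_smul' a f := PDual.ext fun w => congrArg f (j.map_smul a w).symm

@[simp] lemma PDual.map_apply (j : M →ₗ[k⟦X⟧] M') (f : PDual k M') (w : M) :
    PDual.map j f w = f (j w) := rfl

lemma PDual.exists_X_smul {f : PDual k M} (h : ∀ w : M, (X : k⟦X⟧) • w = 0 → f w = 0) :
    ∃ g : PDual k M, f = (X : k⟦X⟧) • g := by
  have h1 : (PDual.lin f) ∈ (Algebra.lsmul k k M (X : k⟦X⟧)).dualMap.range := by
    rw [LinearMap.range_dualMap_eq_dualAnnihilator_ker, Submodule.mem_dualAnnihilator]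
    exact fun w hw => h w hw
  obtain ⟨g, hg⟩ := h1
  exact ⟨g, hg.symm⟩

lemma PDual.exists_extend (N : Submodule k⟦X⟧ M) (f : PDual k N) :
    ∃ g : PDual k M, ∀ w : N, g w = f w := by
  obtain ⟨g, hg⟩ := LinearMap.exists_extend (p := N.restrictScalars k) (PDual.lin f)
  exact ⟨g, fun w => DFunLike.congr_fun hg w⟩

lemma isPrecomplete_pi (ι : Type u) [Finite ι] :
    IsPrecomplete (Ideal.span {(X : k⟦X⟧)}) (ι → k⟦X⟧) := by
  refine ⟨fun f hf => ?_⟩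
  simp only [SModEq.sub_mem, Ideal.span_singleton_pow, Submodule.ideal_span_singleton_smul,
    Submodule.mem_smul_pointwise_iff_exists, Submodule.mem_top, true_and] at hf ⊢
  have h1 : ∀ i, ∃ L : k⟦X⟧, ∀ n, ∃ b, (X : k⟦X⟧) ^ n • b = f n i - L := by
    intro i
    obtain ⟨L, hL⟩ := IsPrecomplete.prec (I := Ideal.span {(X : k⟦X⟧)}) inferInstance
      (f := fun n => f n i) (by
        intro m n hmn
        obtain ⟨b, hb⟩ := hf hmn
        rw [SModEq.sub_mem, Ideal.span_singleton_pow, Submodule.ideal_span_singleton_smul]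
        exact ⟨b i, trivial, congrFun hb i⟩)
    refine ⟨L, fun n => ?_⟩
    have := hL n
    rw [SModEq.sub_mem, Ideal.span_singleton_pow, Submodule.ideal_span_singleton_smul] at this
    obtain ⟨b, -, hb⟩ := this
    exact ⟨b, hb⟩
  choose L hL using h1
  choose b hb using hL
  exact ⟨L, fun n => ⟨fun i => b i n, funext fun i => hb i n⟩⟩

/-- The dual of a torsion module with finite dimensional `X`-torsion is finitely generated. -/
lemma PDual.finite (htor : ∀ w : M, ∃ n : ℕ, (X : k⟦X⟧) ^ n • w = 0)
    (hfin : Module.Finite k (Submodule.torsionBy k⟦X⟧ M X)) : Module.Finite k⟦X⟧ (PDual k M) := by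
  let N := Submodule.torsionBy k⟦X⟧ M X
  let b := Module.Free.chooseBasis k N
  choose t ht using fun i => PDual.exists_extend N (PDual.of (b.coord i))
  let π : (Module.Free.ChooseBasisIndex k N → k⟦X⟧) →ₗ[k⟦X⟧] PDual k M :=
    Fintype.linearCombination k⟦X⟧ t
  suffices h : Function.Surjective π from Module.Finite.of_surjective π h
  have haus : IsHausdorff (Ideal.span {(X : k⟦X⟧)}) (PDual k M) := by
    refine ⟨fun f hf => PDual.ext fun w => ?_⟩
    obtain ⟨n, hn⟩ := htor w
    have := hf n
    rw [SModEq.zero, Ideal.span_singleton_pow, Submodule.ideal_span_singleton_smul] at this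
    obtain ⟨g, -, rfl⟩ := this
    change g ((X : k⟦X⟧) ^ n • w) = 0
    rw [hn]; exact map_zero (PDual.lin g)
  have hprec := isPrecomplete_pi (k := k) (Module.Free.ChooseBasisIndex k N)
  refine surjective_of_mkQ_comp_surjective (I := Ideal.span {(X : k⟦X⟧)}) fun y => ?_
  obtain ⟨f, rfl⟩ := Submodule.mkQ_surjective _ y
  have hπ : ∀ (c : Module.Free.ChooseBasisIndex k N → k) (w : N),
      π (fun i => C (c i)) w = ∑ i, c i * b.coord i w := by
    intro c w
    have h1 : ∀ i, (C (c i) • t i : PDual k M) w = c i * b.coord i w := fun i => by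
      rw [PDual.smul_apply, show b.coord i w = t i w from (ht i w).symm]
      have : (C (c i) : k⟦X⟧) • (w : M) = c i • (w : M) := algebraMap_smul k⟦X⟧ (c i) (w : M)
      rw [this]; exact map_smul (PDual.lin (t i)) _ _
    rw [← Finset.sum_congr rfl fun i _ => h1 i, Fintype.linearCombination_apply]
    exact LinearMap.sum_apply Finset.univ (fun i => (PDual.lin (C (c i) • t i))) _
  refine ⟨fun i => C (f (b i)), ?_⟩
  rw [LinearMap.comp_apply, Submodule.mkQ_apply, Submodule.mkQ_apply, Submodule.Quotient.eq,
    Submodule.ideal_span_singleton_smul, Submodule.mem_smul_pointwise_iff_exists]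
  obtain ⟨g, hg⟩ := PDual.exists_X_smul (f := π (fun i => C (f (b i))) - f) (by
    intro w hw
    change π _ w - f w = 0
    have h2 := hπ (fun i => f (b i)) ⟨w, (Submodule.mem_torsionBy_iff _ _).2 hw⟩
    rw [sub_eq_zero]
    refine h2.trans ?_
    have h3 := congrArg (fun v : N => f v) (b.sum_repr ⟨w, (Submodule.mem_torsionBy_iff _ _).2 hw⟩)
    refine Eq.trans ?_ h3
    rw [Submodule.coe_sum]
    refine Eq.trans ?_ (map_sum (PDual.lin f) _ _).symm
    refine Finset.sum_congr rfl fun i _ => ?_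
    rw [mul_comm]
    exact (map_smul (PDual.lin f) _ _).symm)
  exact ⟨g, trivial, hg.symm⟩

lemma PDual.finite_torsion (h : Module.Finite k⟦X⟧ (PDual k M)) :
    Module.Finite k (Submodule.torsionBy k⟦X⟧ M X) := by
  let N := Submodule.torsionBy k⟦X⟧ M X
  have h1 : Function.Surjective (PDual.map (k := k) N.subtype) := fun f => by
    obtain ⟨g, hg⟩ := PDual.exists_extend N f
    exact ⟨g, PDual.ext hg⟩
  obtain ⟨s, hs⟩ := (Module.Finite.of_surjective _ h1).fg_top
  rw [← Module.finite_dual_iff k]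
  refine ⟨⟨s, ?_⟩⟩
  rw [eq_top_iff]
  rintro f -
  change PDual k N at f
  have hf : f ∈ Submodule.span k⟦X⟧ (s : Set (PDual k N)) := hs ▸ trivial
  change f ∈ Submodule.span k (s : Set (PDual k N))
  induction hf using Submodule.span_induction with
  | mem x h => exact Submodule.subset_span h
  | zero => exact Submodule.zero_mem _
  | add x y _ _ hx hy => exact Submodule.add_mem _ hx hy
  | smul a x _ hx =>
    have : (a • x : PDual k N) = (constantCoeff a • (PDual.lin x) : N →ₗ[k] k) := by
      refine PDual.ext fun w => ?_
      rw [PDual.smul_apply]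
      have h2 : a • w = constantCoeff a • w := by
        have hw : (X : k⟦X⟧) • w = 0 := Subtype.ext ((Submodule.mem_torsionBy_iff _ _).1 w.2)
        conv_lhs => rw [eq_shift_mul_X_add_const a, add_smul, mul_smul, hw, smul_zero, zero_add]
        exact algebraMap_smul k⟦X⟧ _ w
      rw [h2]; exact map_smul (PDual.lin x) _ _
    rw [this]
    exact Submodule.smul_mem _ _ hx
end Dual
end Metaplectic

namespace Metaplectic
open PowerSeries CategoryTheory
noncomputable section Colmez
set_option linter.unusedSectionVars false
variable (p : ℕ) [Fact p.Prime] (k : Type u) [Field k] [CharP k p]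

/-- A smooth module over the noncommutative ring `k⟦X⟧[F, Γ]`: a `k⟦X⟧`-module on which `X` is
locally nilpotent, with commuting semilinear actions of `F` and of `Γ = ℤ_pˣ`, the latter
being smooth. -/
structure XFGMod where
  carrier : Type u
  [addCommGroup : AddCommGroup carrier]
  [moduleField : Module k carrier]
  [module : Module k⟦X⟧ carrier]
  [isScalarTower : IsScalarTower k k⟦X⟧ carrier]
  F : carrier →ₗ[k] carrier
  gam : ℤ_[p]ˣ → carrier →ₗ[k] carrier
  F_smul : ∀ (a : k⟦X⟧) (w : carrier), F (a • w) = phiA p k a • F w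
  gam_smul : ∀ (γ : ℤ_[p]ˣ) (a : k⟦X⟧) (w : carrier), gam γ (a • w) = gamA p k γ a • gam γ w
  gam_one : ∀ w, gam 1 w = w
  gam_mul : ∀ γ δ w, gam (γ * δ) w = gam γ (gam δ w)
  F_gam : ∀ γ w, F (gam γ w) = gam γ (F w)
  torsion : ∀ w : carrier, ∃ n : ℕ, (X : k⟦X⟧) ^ n • w = 0
  smooth : ∀ w : carrier, ∀ᶠ γ in nhds (1 : ℤ_[p]ˣ), gam γ w = w

attribute [instance] XFGMod.addCommGroup XFGMod.moduleField XFGMod.module XFGMod.isScalarTower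

variable {p k}
namespace XFGMod

section D
variable (T : XFGMod p k)

/-- `Hom_{k((X))}(T^∨[1/X], k((X)))`, i.e. the `k⟦X⟧`-linear maps `T^∨ → k((X))`. -/
abbrev DSpace : Type u := PDual k T.carrier →ₗ[k⟦X⟧] LaurentSeries k

variable {T}

/-- The term `(1 + X) ^ a φ(u(((1 + X) ^ (-a) f) ∘ F))`. -/
def phiTerm (u : T.DSpace) (f : PDual k T.carrier) (a : ℤ_[p]) : LaurentSeries k :=
  algebraMap k⟦X⟧ _ (onePlusX p k a) *
    phiK p k (u (PDual.transpose T.F (onePlusX p k (-a) • f)))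

lemma transpose_F_phiA (a : k⟦X⟧) (f : PDual k T.carrier) :
    PDual.transpose T.F (phiA p k a • f) = a • PDual.transpose T.F f :=
  PDual.ext fun w => congrArg f (T.F_smul a w).symm

lemma phiTerm_add_p (u : T.DSpace) (f : PDual k T.carrier) (a b : ℤ_[p]) :
    phiTerm u f (a + b * p) = phiTerm u f a := by
  have h1 : onePlusX p k (-(a + b * p)) = phiA p k (onePlusX p k (-b)) * onePlusX p k (-a) := by
    rw [phiA_onePlusX, ← onePlusX_add]; ring_nf
  have h2 : phiA p k (onePlusX p k b) * phiA p k (onePlusX p k (-b)) = 1 := by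
    rw [← map_mul, ← onePlusX_add, add_neg_cancel, onePlusX_zero, map_one]
  rw [phiTerm, h1, mul_smul, transpose_F_phiA, map_smul, Algebra.smul_def, map_mul, phiK_coe,
    onePlusX_add, ← phiA_onePlusX, map_mul, phiTerm, mul_assoc, ← mul_assoc _ _ (phiK p k _),
    ← map_mul, h2, map_one, one_mul]

lemma phiTerm_congr (u : T.DSpace) (f : PDual k T.carrier) {a b : ℤ_[p]}
    (h : PadicInt.toZMod a = PadicInt.toZMod b) : phiTerm u f a = phiTerm u f b := by
  have h1 : a - b ∈ RingHom.ker (PadicInt.toZMod (p := p)) := by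
    rw [RingHom.mem_ker, map_sub, h, sub_self]
  rw [PadicInt.ker_toZMod, PadicInt.maximalIdeal_eq_span_p, Ideal.mem_span_singleton'] at h1
  obtain ⟨c, hc⟩ := h1
  rw [← phiTerm_add_p u f b c, hc, add_sub_cancel]

/-- The value `(φ u)(f) = ∑_{0 ≤ i < p} (1 + X) ^ i φ(u(((1 + X) ^ (-i) f) ∘ F))`. -/
def phiVal (u : T.DSpace) (f : PDual k T.carrier) : LaurentSeries k :=
  ∑ i ∈ Finset.range p, phiTerm u f i

lemma phiVal_eq (u : T.DSpace) (f : PDual k T.carrier) (e : ZMod p ≃ ZMod p) (a : ZMod p → ℤ_[p])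
    (ha : ∀ z, PadicInt.toZMod (a z) = e z) :
    phiVal u f = ∑ z : ZMod p, phiTerm u f (a z) := by
  have h1 : ∀ z, phiTerm u f (a z) = phiTerm u f ((e z).val : ℤ_[p]) := fun z =>
    phiTerm_congr u f (by rw [ha, map_natCast, ZMod.natCast_zmod_val])
  simp_rw [h1]
  rw [Equiv.sum_comp e fun z => phiTerm u f (z.val : ℤ_[p]), phiVal]
  refine Finset.sum_nbij' (fun i => (i : ZMod p)) (fun z => z.val) (fun _ _ => Finset.mem_univ _)
    (fun z _ => Finset.mem_range.2 (ZMod.val_lt z)) (fun i hi => ?_) (fun z _ => ?_) (fun i hi => ?_)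
  · exact ZMod.val_cast_of_lt (Finset.mem_range.1 hi)
  · exact ZMod.natCast_zmod_val z
  · rw [ZMod.val_cast_of_lt (Finset.mem_range.1 hi)]

lemma phiVal_add (u : T.DSpace) (f g : PDual k T.carrier) :
    phiVal u (f + g) = phiVal u f + phiVal u g := by
  simp only [phiVal, phiTerm, smul_add, map_add, mul_add, Finset.sum_add_distrib]

lemma phiVal_smul (u : T.DSpace) (a : k⟦X⟧) (f : PDual k T.carrier) :
    phiVal u (a • f) = a • phiVal u f := by
  let R : Subring k⟦X⟧ :=
    { carrier := {a | ∀ f, phiVal u (a • f) = algebraMap k⟦X⟧ (LaurentSeries k) a * phiVal u f}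
      mul_mem' := fun {a b} ha hb f => by rw [mul_smul, ha, hb, map_mul, mul_assoc]
      one_mem' := fun f => by rw [one_smul, map_one, one_mul]
      add_mem' := fun {a b} ha hb f => by rw [add_smul, phiVal_add, ha, hb, map_add, add_mul]
      zero_mem' := fun f => by
        have := phiVal_add u 0 0
        rw [add_zero, left_eq_add] at this
        rw [zero_smul, this, map_zero, zero_mul]
      neg_mem' := fun {a} ha f => by
        have := phiVal_add u (a • f) (-a • f)
        rw [← add_smul, add_neg_cancel, ha, zero_smul] at this
        have h0 := phiVal_add u 0 0
        rw [add_zero, left_eq_add] at h0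
        rw [h0] at this
        rw [map_neg, neg_mul]
        exact (neg_eq_of_add_eq_zero_right this.symm).symm }
  have hphi : ∀ b, phiA p k b ∈ R := fun b f => by
    rw [phiVal, phiVal, Finset.mul_sum]
    refine Finset.sum_congr rfl fun i _ => ?_
    rw [phiTerm, smul_smul, mul_comm (onePlusX _ _ _), mul_smul, transpose_F_phiA, map_smul,
      Algebra.smul_def, map_mul, phiK_coe, phiTerm, mul_left_comm]
  have hX : (X : k⟦X⟧) ∈ R := by
    suffices h : onePlusX p k 1 ∈ R by
      have h1 := onePlusX_nat p k 1
      rw [Nat.cast_one, pow_one] at h1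
      rw [h1] at h
      simpa using R.sub_mem h R.one_mem
    intro f
    have h1 : ∀ z : ZMod p, phiTerm u (onePlusX p k 1 • f) (z.val : ℤ_[p]) =
        algebraMap k⟦X⟧ _ (onePlusX p k 1) * phiTerm u f ((z.val : ℤ_[p]) - 1) := fun z => by
      rw [phiTerm, smul_smul, ← onePlusX_add, phiTerm, ← mul_assoc, ← map_mul, ← onePlusX_add,
        add_sub_cancel, neg_sub, sub_eq_add_neg, add_comm 1]
    rw [phiVal_eq u _ (Equiv.refl _) (fun z => (z.val : ℤ_[p])) (fun z => by simp),
      phiVal_eq u f (Equiv.subRight 1) (fun z => (z.val : ℤ_[p]) - 1) (fun z => by simp),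
      Finset.mul_sum]
    exact Finset.sum_congr rfl fun z _ => h1 z
  have h : a ∈ R := by
    rw [phiA_decomp p k a]
    exact R.sum_mem fun j _ => R.mul_mem (R.pow_mem hX j) (hphi _)
  rw [h f, Algebra.smul_def]

/-- Frobenius on `(T^∨[1/X])'`. -/
def phiD : T.DSpace →ₛₗ[phiK p k] T.DSpace where
  toFun u := 
    { toFun := phiVal u
      map_add' := phiVal_add u
      map_smul' := phiVal_smul u }
  map_add' u v := LinearMap.ext fun f => by
    change phiVal (u + v) f = phiVal u f + phiVal v f
    simp only [phiVal, phiTerm, LinearMap.add_apply, map_add, mul_add, Finset.sum_add_distrib]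
  map_smul' c u := LinearMap.ext fun f => by
    change phiVal (c • u) f = phiK p k c * phiVal u f
    rw [phiVal, phiVal, Finset.mul_sum]
    refine Finset.sum_congr rfl fun i _ => ?_
    rw [phiTerm, phiTerm, LinearMap.smul_apply, smul_eq_mul, map_mul]; ring

lemma transpose_gam_smul (γ : ℤ_[p]ˣ) (a : k⟦X⟧) (f : PDual k T.carrier) :
    PDual.transpose (T.gam γ) (gamA p k γ a • f) = a • PDual.transpose (T.gam γ) f :=
  PDual.ext fun w => congrArg f (T.gam_smul γ a w).symm

/-- The action of `Γ` on `(T^∨[1/X])'`: `(γ u)(f) = γ(u(f ∘ γ))`. -/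
def gamD (γ : ℤ_[p]ˣ) : T.DSpace →ₛₗ[gamK p k γ] T.DSpace where
  toFun u := 
    { toFun := fun f => gamK p k γ (u (PDual.transpose (T.gam γ) f))
      map_add' := fun f g => by rw [map_add, map_add, map_add]
      map_smul' := fun a f => by
        have h : a = gamA p k γ (gamA p k ↑γ⁻¹ a) := by
          rw [← gamA_mul, Units.mul_inv, gamA_one]
        conv_lhs => rw [h]
        rw [transpose_gam_smul, map_smul, Algebra.smul_def, map_mul, gamK_coe, ← h,
          RingHom.id_apply, Algebra.smul_def] }
  map_add' u v := LinearMap.ext fun f => by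
    change gamK p k γ (u _ + v _) = gamK p k γ (u _) + gamK p k γ (v _)
    rw [map_add]
  map_smul' c u := LinearMap.ext fun f => by
    change gamK p k γ (c * u _) = gamK p k γ c * gamK p k γ (u _)
    rw [map_mul]

lemma phiD_apply (u : T.DSpace) (f : PDual k T.carrier) : phiD u f = phiVal u f := rfl

lemma gamD_apply (γ : ℤ_[p]ˣ) (u : T.DSpace) (f : PDual k T.carrier) :
    gamD γ u f = gamK p k γ (u (PDual.transpose (T.gam γ) f)) := rfl

lemma phiD_gamD (γ : ℤ_[p]ˣ) (u : T.DSpace) : phiD (gamD γ u) = gamD γ (phiD u) := by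
  refine LinearMap.ext fun f => ?_
  rw [phiD_apply, gamD_apply, phiD_apply]
  have h1 : ∀ b : ℤ_[p], gamK p k γ (phiTerm u (PDual.transpose (T.gam γ) f) b) =
      phiTerm (gamD γ u) f (b * γ) := fun b => by
    rw [phiTerm, ← transpose_gam_smul, map_mul, gamK_coe, gamA_onePlusX, gamA_onePlusX, gamK_phiK,
      phiTerm, neg_mul, gamD_apply]
    have h : PDual.transpose T.F (PDual.transpose (T.gam γ) (onePlusX p k (-(b * γ)) • f)) =
        PDual.transpose (T.gam γ) (PDual.transpose T.F (onePlusX p k (-(b * γ)) • f)) :=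
      PDual.ext fun w => congrArg (onePlusX p k (-(b * γ)) • f) (T.F_gam γ w).symm
    rw [h]
  rw [phiVal_eq u _ (Equiv.refl _) (fun z => (z.val : ℤ_[p])) (fun z => by simp), map_sum,
    phiVal_eq (gamD γ u) f (Units.mulRight (Units.map (PadicInt.toZMod (p := p)).toMonoidHom γ))
    (fun z => (z.val : ℤ_[p]) * γ) (fun z => by simp)]
  exact Finset.sum_congr rfl fun i _ => (h1 _).symm

end D
end XFGMod
end Colmez
end Metaplectic

namespace Metaplectic
open PowerSeries CategoryTheory
noncomputable section ColmezD
set_option linter.unusedSectionVars false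
variable {p : ℕ} [Fact p.Prime] {k : Type u} [Field k] [CharP k p]

section
variable {M : Type u} [AddCommGroup M] [Module k M] [Module k⟦X⟧ M] [IsScalarTower k k⟦X⟧ M]

lemma PDual.exists_smul {a : k⟦X⟧} {f : PDual k M} (h : ∀ w : M, a • w = 0 → f w = 0) :
    ∃ g : PDual k M, f = a • g := by
  have h1 : (PDual.lin f) ∈ (Algebra.lsmul k k M a).dualMap.range := by
    rw [LinearMap.range_dualMap_eq_dualAnnihilator_ker, Submodule.mem_dualAnnihilator]
    exact fun w hw => h w hw
  obtain ⟨g, hg⟩ := h1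
  exact ⟨g, hg.symm⟩

lemma fg_torsionBy_pow (hfin : Module.Finite k (Submodule.torsionBy k⟦X⟧ M X)) (n : ℕ) :
    ((Submodule.torsionBy k⟦X⟧ M (X ^ n)).restrictScalars k).FG := by
  induction n with
  | zero =>
    convert Submodule.fg_bot
    rw [eq_bot_iff]
    intro w hw
    simpa using hw
  | succ n ih =>
    refine Submodule.fg_of_fg_map_of_fg_inf_ker (Algebra.lsmul k k M (X : k⟦X⟧)) ?_ ?_
    · have : IsNoetherian k ((Submodule.torsionBy k⟦X⟧ M (X ^ n)).restrictScalars k) :=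
        have := Module.Finite.iff_fg.2 ih
        inferInstance
      refine Submodule.FG.of_le ih ?_
      rintro _ ⟨w, hw, rfl⟩
      change (X : k⟦X⟧) ^ n • (X : k⟦X⟧) • w = 0
      rw [smul_smul, ← pow_succ]
      exact hw
    · have h1 : ((Submodule.torsionBy k⟦X⟧ M X).restrictScalars k).FG := Module.Finite.iff_fg.1 hfin
      exact Submodule.FG.of_le h1 inf_le_right

lemma exists_smul_eq_zero {N : Type u} [AddCommGroup N] [Module k⟦X⟧ N] [Module.Finite k⟦X⟧ N]
    (g : N) (h : ∀ u : N →ₗ[k⟦X⟧] LaurentSeries k, u g = 0) :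
    ∃ a : k⟦X⟧, a ≠ 0 ∧ a • g = 0 := by
  have hfree : Module.Free k⟦X⟧ (N ⧸ Submodule.torsion k⟦X⟧ N) :=
    Module.free_of_finite_type_torsion_free'
  let b := Module.Free.chooseBasis k⟦X⟧ (N ⧸ Submodule.torsion k⟦X⟧ N)
  have hg : Submodule.Quotient.mk (p := Submodule.torsion k⟦X⟧ N) g = 0 := by
    refine b.ext_elem fun i => ?_
    have h1 := h ((Algebra.linearMap k⟦X⟧ (LaurentSeries k)) ∘ₗ b.coord i ∘ₗ Submodule.mkQ _)
    have h2 : algebraMap k⟦X⟧ (LaurentSeries k) (b.repr (Submodule.Quotient.mk g) i) =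
      algebraMap k⟦X⟧ (LaurentSeries k) 0 := by rw [map_zero]; exact h1
    rw [IsFractionRing.injective k⟦X⟧ (LaurentSeries k) h2]; simp
  rw [Submodule.Quotient.mk_eq_zero] at hg
  obtain ⟨a, ha⟩ := hg
  exact ⟨a, nonZeroDivisors.coe_ne_zero a, ha⟩
end

namespace XFGMod
variable (T : XFGMod p k) [hN : Module.Finite k⟦X⟧ (PDual k T.carrier)]

/-- Evaluation at a finite generating set of `T^∨`. -/
def ev (s : Finset (PDual k T.carrier)) : T.DSpace →ₗ[LaurentSeries k] (s → LaurentSeries k) where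
  toFun u i := u i
  map_add' _ _ := rfl
  map_smul' _ _ := rfl

variable {T}
lemma ev_injective {s : Finset (PDual k T.carrier)}
    (hs : Submodule.span k⟦X⟧ (s : Set (PDual k T.carrier)) = ⊤) : Function.Injective (T.ev s) :=
  fun _ _ h => LinearMap.ext_on (s := (s : Set _)) hs fun i hi => congrFun h ⟨i, hi⟩

variable (T) in
lemma exists_ev : ∃ (s : Finset (PDual k T.carrier)) (r : (s → LaurentSeries k) →ₗ[LaurentSeries k] T.DSpace),
    ∀ u, r (T.ev s u) = u := by
  obtain ⟨s, hs⟩ := hN.fg_top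
  obtain ⟨r, hr⟩ := LinearMap.exists_leftInverse_of_injective (T.ev s)
    (LinearMap.ker_eq_bot.2 (ev_injective hs))
  exact ⟨s, r, fun u => LinearMap.congr_fun hr u⟩

instance : Module.Finite (LaurentSeries k) T.DSpace := by
  obtain ⟨s, r, hr⟩ := T.exists_ev
  exact Module.Finite.of_surjective r fun u => ⟨_, hr u⟩

lemma etaleD (hcok : ∃ m : ℕ, ∀ w : T.carrier, (X : k⟦X⟧) ^ m • w ∈
    Submodule.span k⟦X⟧ (Set.range T.F)) :
    Submodule.span (LaurentSeries k) (Set.range (phiD (T := T))) = ⊤ := by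
  classical
  by_contra hne
  obtain ⟨l, hl0, hl⟩ := Submodule.exists_le_ker_of_lt_top _ (lt_top_iff_ne_top.2 hne)
  obtain ⟨s, r, hr⟩ := T.exists_ev
  obtain ⟨b, hb⟩ := IsLocalization.exist_integer_multiples_of_finset (nonZeroDivisors k⟦X⟧)
    (Finset.univ.image fun i : s => l (r (Pi.single i 1)))
  choose a ha using fun i : s => hb _ (Finset.mem_image_of_mem _ (Finset.mem_univ i))
  set f : PDual k T.carrier := ∑ i, a i • (i : PDual k T.carrier) with hf
  have hlf : ∀ u : T.DSpace, algebraMap k⟦X⟧ (LaurentSeries k) b * l u = u f := fun u => by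
    have h1 : l u = ∑ i : s, u i * l (r (Pi.single i 1)) := by
      conv_lhs => rw [← hr u, pi_eq_sum_univ' (T.ev s u), map_sum, map_sum]
      refine Finset.sum_congr rfl fun i _ => ?_
      rw [map_smul, map_smul]
      rfl
    rw [h1, hf, map_sum, Finset.mul_sum]
    refine Finset.sum_congr rfl fun i _ => ?_
    rw [map_smul, Algebra.smul_def, ha, Algebra.smul_def]; ring
  have hphi : ∀ u, phiVal u f = 0 := fun u => by
    rw [← phiD_apply, ← hlf, show l (phiD u) = 0 from hl (Submodule.subset_span ⟨u, rfl⟩), mul_zero]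
  have h0 : ∀ (c : k⟦X⟧) (u : T.DSpace), u (PDual.transpose T.F (c • f)) = 0 := fun c u => by
    have h1 : phiVal u (c • f) = 0 := by rw [phiVal_smul, hphi, smul_zero]
    have h2 := phiK_indep p k
      (fun i => u (PDual.transpose T.F (onePlusX p k (-(i : ℤ_[p])) • c • f)))
      (by rw [← h1]; exact Finset.sum_congr rfl fun i _ => by rw [phiTerm, onePlusX_nat]) 0
      (Fact.out : p.Prime).pos
    simpa [onePlusX_zero] using h2
  choose d hd0 hd using fun j : ℕ => exists_smul_eq_zero _ (h0 (X ^ j))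
  set D := ∏ j ∈ Finset.range p, d j with hD
  have hD0 : D ≠ 0 := Finset.prod_ne_zero_iff.2 fun j _ => hd0 j
  have hkill : ∀ w ∈ Submodule.span k⟦X⟧ (Set.range T.F), ∀ b : k⟦X⟧,
      (phiA p k D • f) (b • w) = 0 := by
    intro w hw
    induction hw using Submodule.span_induction with
    | mem x h =>
      obtain ⟨w, rfl⟩ := h
      intro b
      have h1 : phiA p k D • b • T.F w = ∑ j ∈ Finset.range p, (X : k⟦X⟧) ^ j •
          T.F (D • (PowerSeries.mk fun n => coeff (p * n + j) b : k⟦X⟧) • w) := by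
        conv_lhs => rw [phiA_decomp p k b]
        rw [Finset.sum_smul, Finset.smul_sum]
        refine Finset.sum_congr rfl fun j _ => ?_
        rw [T.F_smul, T.F_smul, smul_smul, smul_smul, smul_smul]
        congr 1
        ring
      rw [PDual.smul_apply, h1]
      refine (map_sum (PDual.lin f) _ _).trans (Finset.sum_eq_zero fun j hj => ?_)
      obtain ⟨e, he⟩ := Finset.dvd_prod_of_mem d hj
      have h2 : D • PDual.transpose T.F ((X : k⟦X⟧) ^ j • f) = 0 := by
        rw [hD, he, mul_comm, mul_smul, hd, smul_zero]
      exact DFunLike.congr_fun h2 _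
    | zero => intro b; rw [smul_zero]; exact map_zero (PDual.lin _)
    | add x y _ _ hx hy =>
      intro b
      rw [smul_add]
      refine (map_add (PDual.lin _) _ _).trans ?_
      have h1 := hx b
      have h2 := hy b
      change PDual.lin _ _ = 0 at h1
      change PDual.lin _ _ = 0 at h2
      rw [h1, h2, add_zero]
    | smul a x _ hx => intro b; rw [smul_smul]; exact hx _
  obtain ⟨m, hm⟩ := hcok
  have h1 : ((X : k⟦X⟧) ^ m * phiA p k D) • f = 0 := PDual.ext fun w => by
    have := hkill _ (hm w) 1
    rw [one_smul] at this
    rw [mul_smul]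
    exact this
  refine hl0 (LinearMap.ext fun u => ?_)
  have h2 : algebraMap k⟦X⟧ (LaurentSeries k) (X ^ m * phiA p k D) * u f = 0 := by
    rw [← Algebra.smul_def, ← map_smul, h1, map_zero]
  have h3 : (X : k⟦X⟧) ^ m * phiA p k D ≠ 0 :=
    mul_ne_zero (pow_ne_zero _ X_ne_zero) ((map_ne_zero_iff _ (phiA_injective p k)).2 hD0)
  have hinj := IsFractionRing.injective k⟦X⟧ (LaurentSeries k)
  have h4 := (mul_eq_zero.1 h2).resolve_left ((map_ne_zero_iff _ hinj).2 h3)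
  rw [← hlf] at h4
  exact (mul_eq_zero.1 h4).resolve_left
    ((map_ne_zero_iff _ hinj).2 (nonZeroDivisors.coe_ne_zero b))

/-- Elements of `Γ` close to `γ₀` act on the finite dimensional space `T[X ^ n]` as `γ₀`. -/
lemma eventually_gam (γ₀ : ℤ_[p]ˣ) (n : ℕ) :
    ∀ᶠ γ in nhds γ₀, ∀ w : T.carrier, (X : k⟦X⟧) ^ n • w = 0 → T.gam γ w = T.gam γ₀ w := by
  obtain ⟨s, hs⟩ := fg_torsionBy_pow (PDual.finite_torsion hN) n
  have h : Filter.Tendsto (fun γ : ℤ_[p]ˣ => γ₀⁻¹ * γ) (nhds γ₀) (nhds 1) :=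
    (continuous_const_mul γ₀⁻¹).tendsto' _ _ (inv_mul_cancel γ₀)
  filter_upwards [h.eventually ((Filter.eventually_all_finset s).2 fun w _ => T.smooth w)]
    with γ hγ w hw
  have h1 : w ∈ Submodule.span k (s : Set T.carrier) := by rw [hs]; exact hw
  clear hw
  induction h1 using Submodule.span_induction with
  | mem x hx =>
    have := congrArg (T.gam γ₀) (hγ x hx)
    rwa [← T.gam_mul, mul_inv_cancel_left] at this
  | zero => rw [map_zero, map_zero]
  | add x y _ _ h2 h3 => rw [map_add, map_add, h2, h3]
  | smul a x _ h2 => rw [map_smul, map_smul, h2]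

lemma exists_X_pow_range (v : T.DSpace) : ∃ m : ℕ, ∀ g, ∃ a : k⟦X⟧,
    algebraMap k⟦X⟧ (LaurentSeries k) (X ^ m) * v g = algebraMap _ _ a := by
  obtain ⟨s, hs⟩ := hN.fg_top
  choose n a ha using fun g => exists_X_pow_mul k (v g)
  refine ⟨∑ g ∈ s, n g, fun g => ?_⟩
  have hg : g ∈ Submodule.span k⟦X⟧ (s : Set (PDual k T.carrier)) := by rw [hs]; trivial
  induction hg using Submodule.span_induction with
  | mem x hx =>
    have hle : n x ≤ ∑ g ∈ s, n g := Finset.single_le_sum (f := n) (fun _ _ => Nat.zero_le _) hx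
    refine ⟨X ^ (∑ g ∈ s, n g - n x) * a x, ?_⟩
    rw [map_mul, ← ha, ← mul_assoc, ← map_mul, ← pow_add, Nat.sub_add_cancel hle]
  | zero => exact ⟨0, by rw [map_zero, mul_zero, map_zero]⟩
  | add x y _ _ hx hy =>
    obtain ⟨b, hb⟩ := hx
    obtain ⟨c, hc⟩ := hy
    exact ⟨b + c, by rw [map_add, mul_add, hb, hc, map_add]⟩
  | smul b x _ hx =>
    obtain ⟨c, hc⟩ := hx
    exact ⟨b * c, by rw [map_smul, Algebra.smul_def, mul_left_comm, hc, map_mul]⟩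

lemma continuousD [TopologicalSpace T.DSpace] [IsModuleTopology (LaurentSeries k) T.DSpace] :
    Continuous fun x : ℤ_[p]ˣ × T.DSpace => gamD x.1 x.2 := by
  refine continuous_of_orbits _ fun v => ?_
  obtain ⟨s, r, hr⟩ := T.exists_ev
  have h1 : (fun γ => gamD γ v) = fun γ => r (T.ev s (gamD γ v)) := funext fun γ => (hr _).symm
  rw [h1]
  have hadd : ContinuousAdd T.DSpace := IsModuleTopology.toContinuousAdd (LaurentSeries k) _
  have h2 : Continuous r := IsModuleTopology.continuous_of_linearMap r
  refine h2.comp (continuous_pi fun i => ?_)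
  have h3 : Continuous fun γ : ℤ_[p]ˣ => (γ, v (PDual.transpose (T.gam γ) i)) := by
    refine continuous_id.prodMk (continuous_iff_continuousAt.2 fun γ₀ => ?_)
    refine Filter.tendsto_def.2 fun W hW => ?_
    obtain ⟨n, hn⟩ := (mem_nhds_iff_X_pow k).1 hW
    obtain ⟨m, hm⟩ := exists_X_pow_range v
    filter_upwards [eventually_gam (T := T) γ₀ (n + m)] with γ hγ
    obtain ⟨g, hg⟩ := PDual.exists_smul (a := (X : k⟦X⟧) ^ (n + m))
      (f := PDual.transpose (T.gam γ) i - PDual.transpose (T.gam γ₀) i) (fun w hw => by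
        change (i : PDual k T.carrier) (T.gam γ w) - (i : PDual k T.carrier) (T.gam γ₀ w) = 0
        rw [hγ w hw, sub_self])
    obtain ⟨a, ha⟩ := hm g
    have h5 := congrArg v hg
    rw [map_sub, map_smul, pow_add, Algebra.smul_def, map_mul, mul_assoc, ha, ← map_mul,
      sub_eq_iff_eq_add'] at h5
    change v _ ∈ W
    rw [h5]
    exact hn a
  have h4 := (continuous_gamK_uncurry p k).comp h3
  exact h4

variable (T) in
/-- The étale `(φ, Γ)`-module `(T^∨[1/X])'`, for a smooth `k⟦X⟧[F, Γ]`-module `T` whose `X`-torsion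
is finite dimensional, and such that the cokernel of the linearization of `F` is killed by a power
of `X`. -/
def D (hcok : ∃ m : ℕ, ∀ w : T.carrier, (X : k⟦X⟧) ^ m • w ∈
    Submodule.span k⟦X⟧ (Set.range T.F)) : PGMod p k where
  carrier := T.DSpace
  phi := phiD
  gam := gamD
  gam_one u := LinearMap.ext fun f => by
    have : PDual.transpose (T.gam 1) f = f := PDual.ext fun w => congrArg f (T.gam_one w)
    rw [gamD_apply, gamK_one, this]
  gam_mul γ δ u := LinearMap.ext fun f => by
    have : PDual.transpose (T.gam (γ * δ)) f =
      PDual.transpose (T.gam δ) (PDual.transpose (T.gam γ) f) := PDual.ext fun w =>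
        congrArg f (T.gam_mul γ δ w)
    rw [gamD_apply, gamK_mul, this]; rfl
  phi_gam := phiD_gamD
  etale := etaleD hcok
  continuous_gam := continuousD

end XFGMod
end ColmezD
end Metaplectic

namespace Metaplectic
open PowerSeries CategoryTheory
noncomputable section Twist
set_option linter.unusedSectionVars false
variable (p : ℕ) [Fact p.Prime] (k : Type u) [Field k] [CharP k p]

/-- The element `p` of `ℚ_pˣ`. -/
def pUnit : ℚ_[p]ˣ := Units.mk0 (p : ℚ_[p]) (Nat.cast_ne_zero.2 (Fact.out : p.Prime).ne_zero)

/-- The inclusion `Γ = ℤ_pˣ → ℚ_pˣ`. -/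
def unitIncl : ℤ_[p]ˣ →* ℚ_[p]ˣ := Units.map (PadicInt.Coe.ringHom (p := p)).toMonoidHom

/-- The group `μ₂ = {±1}`, realized in `𝔽_p`. -/
abbrev Mu2 : Type := rootsOfUnity 2 (ZMod p)

/-- The character `ι : μ₂ → kˣ`, `-1 ↦ -1`. -/
def iota : Mu2 p →* kˣ :=
  (Units.map (ZMod.castHom (dvd_refl p) k).toMonoidHom).comp (rootsOfUnity 2 (ZMod p)).subtype

/-- The inclusion of the constants `k → k((X))`. -/
def constK : k →+* LaurentSeries k := (algebraMap k⟦X⟧ (LaurentSeries k)).comp C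

lemma phiK_constK (a : k) : phiK p k (constK k a) = constK k a := by
  change phiK p k (algebraMap _ _ (C a)) = algebraMap _ _ (C a)
  rw [phiK_coe]
  exact congrArg _ ((phiA p k).commutes a)

lemma gamK_constK (γ : ℤ_[p]ˣ) (a : k) : gamK p k γ (constK k a) = constK k a := by
  change gamK p k γ (algebraMap _ _ (C a)) = algebraMap _ _ (C a)
  rw [gamK_coe]
  exact congrArg _ ((gamA p k γ).commutes a)

/-- A topological group `Ω` acting on `(φ, Γ)`-modules by twists `D ↦ D ⊗ χ_g` with smooth
characters `χ_g` of `ℚ_pˣ`, together with a central homomorphism `μ₂ → Ω`. -/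
structure TwistDatum (Ω : Type) [Group Ω] [TopologicalSpace Ω] where
  char : Ω →* ℚ_[p]ˣ →* kˣ
  char_smooth : ∀ g, ∀ᶠ γ in nhds (1 : ℤ_[p]ˣ), char g (unitIncl p γ) = 1
  smooth : ∀ᶠ g in nhds (1 : Ω), char g = 1
  mu : Mu2 p →* Ω
  mu_central : ∀ ζ g, mu ζ * g = g * mu ζ

variable {p k} {Ω : Type} [Group Ω] [TopologicalSpace Ω] (t : TwistDatum p k Ω)

namespace TwistDatum

/-- Restriction to a subgroup containing the image of `μ₂`. -/
def restrict (Δ : Subgroup Ω) (h : ∀ ζ, t.mu ζ ∈ Δ) : TwistDatum p k Δ where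
  char := t.char.comp Δ.subtype
  char_smooth g := t.char_smooth g
  smooth := (continuous_subtype_val.tendsto' (1 : Δ) (1 : Ω) rfl).eventually t.smooth
  mu := t.mu.codRestrict Δ h
  mu_central ζ g := Subtype.ext (t.mu_central ζ g)

/-- The constant `χ_g(x)` in `k((X))`. -/
def cst (g : Ω) (x : ℚ_[p]ˣ) : LaurentSeries k := constK k (t.char g x)

lemma cst_mul (g h : Ω) (x : ℚ_[p]ˣ) : t.cst (g * h) x = t.cst g x * t.cst h x := by
  rw [cst, map_mul, MonoidHom.mul_apply, Units.val_mul, map_mul]; rfl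

lemma cst_mul_right (g : Ω) (x y : ℚ_[p]ˣ) : t.cst g (x * y) = t.cst g x * t.cst g y := by
  rw [cst, map_mul, Units.val_mul, map_mul]; rfl

lemma cst_inv (g : Ω) (x : ℚ_[p]ˣ) : t.cst g⁻¹ x * t.cst g x = 1 := by
  rw [← cst_mul, inv_mul_cancel, cst, map_one, MonoidHom.one_apply, Units.val_one, map_one]

lemma cst_one_right (g : Ω) : t.cst g 1 = 1 := by
  rw [cst, map_one, Units.val_one, map_one]

lemma phiK_cst (g : Ω) (x : ℚ_[p]ˣ) : phiK p k (t.cst g x) = t.cst g x := phiK_constK _ _ _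
lemma gamK_cst (γ : ℤ_[p]ˣ) (g : Ω) (x : ℚ_[p]ˣ) : gamK p k γ (t.cst g x) = t.cst g x :=
  gamK_constK _ _ _ _

end TwistDatum

/-- A smooth genuine `Ω`-equivariant étale `(φ, Γ)`-module: an action `θ` of `Ω` on the underlying
`k((X))`-vector space of `D` such that `θ(g) : D → D ⊗ χ_g` is a morphism of `(φ, Γ)`-modules,
which is smooth (the stabilizers are open) and such that `μ₂` acts through `ι`. -/
structure EqMod where
  toPG : PGMod p k
  theta : Ω →* Module.End (LaurentSeries k) toPG.carrier
  theta_phi : ∀ g x, theta g (toPG.phi x) = t.cst g (pUnit p) • toPG.phi (theta g x)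
  theta_gam : ∀ g γ x, theta g (toPG.gam γ x) = t.cst g (unitIncl p γ) • toPG.gam γ (theta g x)
  smooth : ∀ x : toPG.carrier, ∀ᶠ g in nhds (1 : Ω), theta g x = x
  genuine : ∀ ζ x, theta (t.mu ζ) x = constK k (iota p k ζ) • x

variable {t}

/-- A morphism of `Ω`-equivariant `(φ, Γ)`-modules. -/
@[ext]
structure EqMod.Hom (D E : EqMod t) where
  toHom : D.toPG ⟶ E.toPG
  map_theta : ∀ g x, toHom.toLin (D.theta g x) = E.theta g (toHom.toLin x)

instance : Category.{u} (EqMod t) where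
  Hom := EqMod.Hom
  id D := ⟨𝟙 _, fun _ _ => rfl⟩
  comp {D _ E} f g := ⟨f.toHom ≫ g.toHom, fun a x => by
    change g.toHom.toLin (f.toHom.toLin (D.theta a x)) = E.theta a (g.toHom.toLin (f.toHom.toLin x))
    rw [f.map_theta, g.map_theta]⟩

section Ind
variable [IsTopologicalGroup Ω] (t) (Δ : Subgroup Ω) [Δ.FiniteIndex] (hmu : ∀ ζ, t.mu ζ ∈ Δ)

variable {t Δ hmu} (D : EqMod (t.restrict Δ hmu))

/-- The space of functions `f : Ω → D` with `f(h g) = θ(h) f(g)` for `h ∈ Δ`. -/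
def IndSpace : Submodule (LaurentSeries k) (Ω → D.toPG.carrier) where
  carrier := {f | ∀ (h : Δ) (g : Ω), f (h * g) = D.theta h (f g)}
  add_mem' {f f'} hf hf' h g := by
    change f _ + f' _ = D.theta h (f g + f' g)
    rw [hf, hf', map_add]
  zero_mem' h g := (map_zero (D.theta h)).symm
  smul_mem' a f hf h g := by
    change a • f _ = D.theta h (a • f g)
    rw [hf, map_smul]

namespace IndSpace
variable {D}

@[ext] lemma ext {f f' : IndSpace D} (h : ∀ g, f.1 g = f'.1 g) : f = f' := Subtype.ext (funext h)

/-- `(φ f)(g) = χ_g(p) φ(f(g))`. -/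
def phi : IndSpace D →ₛₗ[phiK p k] IndSpace D where
  toFun f := ⟨fun g => t.cst g (pUnit p) • D.toPG.phi (f.1 g), fun h g => by
    change t.cst (h * g) _ • _ = D.theta h (t.cst g _ • _)
    rw [f.2, map_smul, D.theta_phi, t.cst_mul, mul_comm, mul_smul]; rfl⟩
  map_add' f f' := IndSpace.ext fun g => by
    change t.cst g _ • D.toPG.phi (f.1 g + f'.1 g) = t.cst g _ • _ + t.cst g _ • _
    rw [map_add, smul_add]
  map_smul' a f := IndSpace.ext fun g => by
    change t.cst g _ • D.toPG.phi (a • f.1 g) = phiK p k a • t.cst g _ • D.toPG.phi (f.1 g)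
    rw [D.toPG.phi.map_smulₛₗ, smul_comm]

/-- `(γ f)(g) = χ_g(γ) γ(f(g))`. -/
def gam (γ : ℤ_[p]ˣ) : IndSpace D →ₛₗ[gamK p k γ] IndSpace D where
  toFun f := ⟨fun g => t.cst g (unitIncl p γ) • D.toPG.gam γ (f.1 g), fun h g => by
    change t.cst (h * g) _ • _ = D.theta h (t.cst g _ • _)
    rw [f.2, map_smul, D.theta_gam, t.cst_mul, mul_comm, mul_smul]; rfl⟩
  map_add' f f' := IndSpace.ext fun g => by
    change t.cst g _ • D.toPG.gam γ (f.1 g + f'.1 g) = t.cst g _ • _ + t.cst g _ • _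
    rw [map_add, smul_add]
  map_smul' a f := IndSpace.ext fun g => by
    change t.cst g _ • D.toPG.gam γ (a • f.1 g) = gamK p k γ a • t.cst g _ • D.toPG.gam γ (f.1 g)
    rw [(D.toPG.gam γ).map_smulₛₗ, smul_comm]

/-- `(g f)(g') = f(g' g)`. -/
def theta : Ω →* Module.End (LaurentSeries k) (IndSpace D) where
  toFun g :=
    { toFun := fun f => ⟨fun g' => f.1 (g' * g), fun h g' => by
        change f.1 (h * g' * g) = D.theta h (f.1 (g' * g))
        rw [mul_assoc, f.2]⟩
      map_add' := fun _ _ => rfl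
      map_smul' := fun _ _ => rfl }
  map_one' := LinearMap.ext fun f => IndSpace.ext fun g => congrArg f.1 (mul_one g)
  map_mul' a b := LinearMap.ext fun f => IndSpace.ext fun g => congrArg f.1 (mul_assoc g a b).symm

open Classical in
/-- The function `δ_{g, y}` with support `Δ g` and value `y` at `g`. -/
def deltaFun (g : Ω) (y : D.toPG.carrier) : IndSpace D :=
  ⟨fun g' => if h : g' * g⁻¹ ∈ Δ then D.theta ⟨_, h⟩ y else 0, fun h g' => by
    have h1 : (h : Ω) * g' * g⁻¹ ∈ Δ ↔ g' * g⁻¹ ∈ Δ := by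
      rw [mul_assoc]; exact Δ.mul_mem_cancel_left h.2
    beta_reduce
    by_cases h2 : g' * g⁻¹ ∈ Δ
    · rw [dif_pos h2, dif_pos (h1.2 h2), ← Module.End.mul_apply, ← map_mul]
      exact congrArg (fun x : Δ => D.theta x y) (Subtype.ext (mul_assoc _ _ _))
    · rw [dif_neg h2, dif_neg (mt h1.1 h2), map_zero]⟩

lemma deltaFun_pos {g g' : Ω} (h : g' * g⁻¹ ∈ Δ) (y : D.toPG.carrier) :
    (deltaFun g y).1 g' = D.theta ⟨_, h⟩ y := dif_pos h
lemma deltaFun_neg {g g' : Ω} (h : g' * g⁻¹ ∉ Δ) (y : D.toPG.carrier) :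
    (deltaFun g y).1 g' = 0 := dif_neg h

/-- The linear map `y ↦ δ_{g, y}`. -/
def delta (g : Ω) : D.toPG.carrier →ₗ[LaurentSeries k] IndSpace D where
  toFun := deltaFun g
  map_add' x y := IndSpace.ext fun g' => by
    change _ = (deltaFun g x).1 g' + (deltaFun g y).1 g'
    by_cases h : g' * g⁻¹ ∈ Δ
    · rw [deltaFun_pos h, deltaFun_pos h, deltaFun_pos h, map_add]
    · rw [deltaFun_neg h, deltaFun_neg h, deltaFun_neg h, add_zero]
  map_smul' a y := IndSpace.ext fun g' => by
    change _ = a • (deltaFun g y).1 g'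
    by_cases h : g' * g⁻¹ ∈ Δ
    · rw [deltaFun_pos h, deltaFun_pos h, map_smul]
    · rw [deltaFun_neg h, deltaFun_neg h, smul_zero]

lemma delta_pos {g g' : Ω} (h : g' * g⁻¹ ∈ Δ) (y : D.toPG.carrier) :
    (delta g y).1 g' = D.theta ⟨_, h⟩ y := deltaFun_pos h y
lemma delta_neg {g g' : Ω} (h : g' * g⁻¹ ∉ Δ) (y : D.toPG.carrier) :
    (delta g y).1 g' = 0 := deltaFun_neg h y

variable (Δ) in
/-- Representatives for the right cosets of `Δ`. -/
def rep (q : Ω ⧸ Δ) : Ω := (Quotient.out q)⁻¹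

lemma mul_inv_rep (g : Ω) (q : Ω ⧸ Δ) : g * (rep Δ q)⁻¹ ∈ Δ ↔ QuotientGroup.mk g⁻¹ = q := by
  rw [rep, inv_inv]
  conv_rhs => rw [← QuotientGroup.out_eq' q]
  rw [QuotientGroup.eq, inv_inv]

lemma sum_delta (f : IndSpace D) [Fintype (Ω ⧸ Δ)] :
    f = ∑ q : Ω ⧸ Δ, delta (rep Δ q) (f.1 (rep Δ q)) := by
  refine IndSpace.ext fun g => ?_
  rw [show (∑ q : Ω ⧸ Δ, delta (rep Δ q) (f.1 (rep Δ q))).1 g =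
    ∑ q : Ω ⧸ Δ, (delta (rep Δ q) (f.1 (rep Δ q))).1 g by
      rw [Submodule.coe_sum, Finset.sum_apply],
    Finset.sum_eq_single (QuotientGroup.mk g⁻¹)]
  · have h := (mul_inv_rep g (QuotientGroup.mk (s := Δ) g⁻¹)).2 rfl
    rw [delta_pos h, ← f.2, inv_mul_cancel_right]
  · intro q _ hq
    exact delta_neg (fun h => hq ((mul_inv_rep g q).1 h).symm) _
  · intro h; exact absurd (Finset.mem_univ _) h

lemma phi_delta (g : Ω) (y : D.toPG.carrier) :
    phi (delta g y) = t.cst g (pUnit p) • delta g (D.toPG.phi y) := by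
  refine IndSpace.ext fun g' => ?_
  change t.cst g' _ • D.toPG.phi ((delta g y).1 g') = t.cst g _ • (delta g (D.toPG.phi y)).1 g'
  by_cases h : g' * g⁻¹ ∈ Δ
  · rw [delta_pos h, delta_pos h, D.theta_phi, smul_smul]
    congr 1
    change _ = t.cst g _ * t.cst (g' * g⁻¹) _
    rw [mul_comm, ← t.cst_mul, inv_mul_cancel_right]
  · rw [delta_neg h, delta_neg h, map_zero, smul_zero, smul_zero]

lemma gam_delta (γ : ℤ_[p]ˣ) (g : Ω) (y : D.toPG.carrier) :
    gam γ (delta g y) = t.cst g (unitIncl p γ) • delta g (D.toPG.gam γ y) := by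
  refine IndSpace.ext fun g' => ?_
  change t.cst g' _ • D.toPG.gam γ ((delta g y).1 g') = t.cst g _ • (delta g (D.toPG.gam γ y)).1 g'
  by_cases h : g' * g⁻¹ ∈ Δ
  · rw [delta_pos h, delta_pos h, D.theta_gam, smul_smul]
    congr 1
    change _ = t.cst g _ * t.cst (g' * g⁻¹) _
    rw [mul_comm, ← t.cst_mul, inv_mul_cancel_right]
  · rw [delta_neg h, delta_neg h, map_zero, smul_zero, smul_zero]

lemma etale : Submodule.span (LaurentSeries k) (Set.range (phi (D := D))) = ⊤ := by
  have := Δ.fintypeQuotientOfFiniteIndex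
  refine eq_top_iff.2 fun f _ => ?_
  rw [sum_delta f]
  refine Submodule.sum_mem _ fun q _ => ?_
  have h1 : f.1 (rep Δ q) ∈ Submodule.span (LaurentSeries k) (Set.range D.toPG.phi) := by
    rw [D.toPG.etale]; trivial
  generalize f.1 (rep Δ q) = y at h1
  generalize rep Δ q = g
  induction h1 using Submodule.span_induction with
  | mem x hx =>
    obtain ⟨y, rfl⟩ := hx
    have h2 := Submodule.smul_mem _ (t.cst g⁻¹ (pUnit p))
      (Submodule.subset_span (R := LaurentSeries k) (Set.mem_range_self (f := phi (D := D)) (delta g y)))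
    rwa [phi_delta, smul_smul, t.cst_inv, one_smul] at h2
  | zero => rw [map_zero]; exact Submodule.zero_mem _
  | add x y _ _ hx hy => rw [map_add]; exact Submodule.add_mem _ hx hy
  | smul a x _ hx => rw [map_smul]; exact Submodule.smul_mem _ _ hx

instance : Module.Finite (LaurentSeries k) (IndSpace D) := by
  have := Δ.fintypeQuotientOfFiniteIndex
  refine Module.Finite.of_surjective
    (∑ q : Ω ⧸ Δ, (delta (D := D) (rep Δ q)) ∘ₗ LinearMap.proj (φ := fun _ => D.toPG.carrier) q)
    fun f => ⟨fun q => f.1 (rep Δ q), ?_⟩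
  rw [LinearMap.sum_apply]
  exact (sum_delta f).symm

lemma continuous_char (g : Ω) : Continuous fun γ : ℤ_[p]ˣ => t.cst g (unitIncl p γ) := by
  refine continuous_iff_continuousAt.2 fun γ₀ => ?_
  have h : Filter.Tendsto (fun γ : ℤ_[p]ˣ => γ₀⁻¹ * γ) (nhds γ₀) (nhds 1) :=
    (continuous_const_mul γ₀⁻¹).tendsto' _ _ (inv_mul_cancel γ₀)
  refine Filter.EventuallyEq.continuousAt (y := t.cst g (unitIncl p γ₀)) ?_
  filter_upwards [h.eventually (t.char_smooth g)] with γ hγ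
  rw [map_mul, map_mul, map_inv, map_inv, inv_mul_eq_one] at hγ
  rw [TwistDatum.cst, TwistDatum.cst, hγ]

lemma continuous_gam [TopologicalSpace (IndSpace D)]
    [IsModuleTopology (LaurentSeries k) (IndSpace D)] :
    Continuous fun x : ℤ_[p]ˣ × IndSpace D => gam x.1 x.2 := by
  have := Δ.fintypeQuotientOfFiniteIndex
  refine continuous_of_orbits _ fun f => ?_
  have hadd : ContinuousAdd (IndSpace D) := IsModuleTopology.toContinuousAdd (LaurentSeries k) _
  have hs : ContinuousSMul (LaurentSeries k) (IndSpace D) := inferInstance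
  have h1 : (fun γ => gam γ f) = fun γ => ∑ q : Ω ⧸ Δ, t.cst (rep Δ q) (unitIncl p γ) •
      delta (rep Δ q) (D.toPG.gam γ (f.1 (rep Δ q))) := funext fun γ => by
    conv_lhs => rw [sum_delta f]
    rw [map_sum]
    exact Finset.sum_congr rfl fun q _ => gam_delta _ _ _
  rw [h1]
  let _ : TopologicalSpace D.toPG.carrier := moduleTopology (LaurentSeries k) _
  have : IsModuleTopology (LaurentSeries k) D.toPG.carrier := ⟨rfl⟩
  refine continuous_finsetSum _ fun q _ => ?_
  have h2 : Continuous (delta (D := D) (rep Δ q)) := IsModuleTopology.continuous_of_linearMap _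
  have h3 := h2.comp (D.toPG.continuous_gam.comp
    (continuous_id.prodMk (continuous_const (y := f.1 (rep Δ q)))))
  have h4 := (continuous_char (t := t) (rep Δ q)).smul h3
  exact h4

end IndSpace

/-- The induction of an equivariant `(φ, Γ)`-module. -/
def IndObj (hΔ : IsOpen (Δ : Set Ω)) : EqMod t where
  toPG :=
    { carrier := IndSpace D
      phi := IndSpace.phi
      gam := IndSpace.gam
      gam_one := fun f => IndSpace.ext fun g => by
        change t.cst g (unitIncl p 1) • D.toPG.gam 1 (f.1 g) = f.1 g
        rw [D.toPG.gam_one, map_one, t.cst_one_right, one_smul]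
      gam_mul := fun γ δ f => IndSpace.ext fun g => by
        change t.cst g (unitIncl p (γ * δ)) • D.toPG.gam (γ * δ) (f.1 g) =
          t.cst g (unitIncl p γ) • D.toPG.gam γ (t.cst g (unitIncl p δ) • D.toPG.gam δ (f.1 g))
        rw [D.toPG.gam_mul, map_mul, t.cst_mul_right, (D.toPG.gam γ).map_smulₛₗ, t.gamK_cst,
          mul_smul]
      phi_gam := fun γ f => IndSpace.ext fun g => by
        change t.cst g _ • D.toPG.phi (t.cst g (unitIncl p γ) • D.toPG.gam γ (f.1 g)) =
          t.cst g (unitIncl p γ) • D.toPG.gam γ (t.cst g _ • D.toPG.phi (f.1 g))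
        rw [(D.toPG.gam γ).map_smulₛₗ, D.toPG.phi.map_smulₛₗ, t.gamK_cst, t.phiK_cst, D.toPG.phi_gam,
          smul_comm]
      etale := IndSpace.etale
      continuous_gam := IndSpace.continuous_gam }
  theta := IndSpace.theta
  theta_phi a f := IndSpace.ext fun g => by
    change t.cst (g * a) _ • D.toPG.phi (f.1 (g * a)) = t.cst a _ • t.cst g _ • D.toPG.phi (f.1 (g * a))
    rw [t.cst_mul, mul_comm, mul_smul]
  theta_gam a γ f := IndSpace.ext fun g => by
    change t.cst (g * a) _ • D.toPG.gam γ (f.1 (g * a)) =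
      t.cst a _ • t.cst g _ • D.toPG.gam γ (f.1 (g * a))
    rw [t.cst_mul, mul_comm, mul_smul]
  smooth f := by
    have := Δ.fintypeQuotientOfFiniteIndex
    have h1 : ∀ q : Ω ⧸ Δ, ∀ᶠ a in nhds (1 : Ω),
        f.1 (IndSpace.rep Δ q * a) = f.1 (IndSpace.rep Δ q) := fun q => by
      set r := IndSpace.rep Δ q
      have hc : Filter.Tendsto (fun a => r * a * r⁻¹) (nhds 1) (nhds 1) :=
        (by fun_prop : Continuous fun a => r * a * r⁻¹).tendsto' _ _ (by group)
      have h2 := D.smooth (f.1 r)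
      rw [nhds_subtype_eq_comap, Filter.eventually_comap] at h2
      filter_upwards [hc.eventually h2, hc.eventually (hΔ.mem_nhds Δ.one_mem)] with a ha ha'
      have h3 := f.2 ⟨_, ha'⟩ r
      rw [ha ⟨_, ha'⟩ rfl] at h3
      rw [← h3]
      exact congrArg f.1 (by group)
    filter_upwards [Filter.eventually_all.2 h1] with a ha
    refine IndSpace.ext fun g => ?_
    change f.1 (g * a) = f.1 g
    have h := (IndSpace.mul_inv_rep g (QuotientGroup.mk (s := Δ) g⁻¹)).2 rfl
    have h4 := f.2 ⟨_, h⟩ (IndSpace.rep Δ (QuotientGroup.mk g⁻¹) * a)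
    have h5 := f.2 ⟨_, h⟩ (IndSpace.rep Δ (QuotientGroup.mk g⁻¹))
    rw [ha, ← h5] at h4
    rw [show ((⟨_, h⟩ : Δ) : Ω) = g * (IndSpace.rep Δ (QuotientGroup.mk g⁻¹))⁻¹ from rfl,
      inv_mul_cancel_right] at h4
    rw [← h4]
    exact congrArg f.1 (by group)
  genuine ζ f := IndSpace.ext fun g => by
    change f.1 (g * t.mu ζ) = constK k _ • f.1 g
    rw [← t.mu_central, ← D.genuine]
    exact f.2 ⟨_, hmu ζ⟩ g

/-- The map on induced spaces given by composition with a morphism. -/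
def IndSpace.map {E : EqMod (t.restrict Δ hmu)} (j : D ⟶ E) :
    IndSpace D →ₗ[LaurentSeries k] IndSpace E where
  toFun f := ⟨fun g => j.toHom.toLin (f.1 g), fun h g => by
    beta_reduce
    rw [f.2, j.map_theta]⟩
  map_add' _ _ := IndSpace.ext fun _ => j.toHom.toLin.map_add _ _
  map_smul' _ _ := IndSpace.ext fun _ => j.toHom.toLin.map_smul _ _

/-- The induction functor `Ind_Δ^Ω` on smooth genuine equivariant `(φ, Γ)`-modules, for an open
subgroup `Δ ⊆ Ω` of finite index. -/
def IndFunctor (t : TwistDatum p k Ω) (Δ : Subgroup Ω) [Δ.FiniteIndex] (hmu : ∀ ζ, t.mu ζ ∈ Δ)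
    (hΔ : IsOpen (Δ : Set Ω)) : EqMod (t.restrict Δ hmu) ⥤ EqMod t where
  obj D := IndObj D hΔ
  map {D E} j :=
    { toHom :=
      { toLin := IndSpace.map D j
        map_phi := fun f => IndSpace.ext fun g => by
          refine (j.toHom.toLin.map_smul _ _).trans ?_
          rw [j.toHom.map_phi]; rfl
        map_gam := fun γ f => IndSpace.ext fun g => by
          refine (j.toHom.toLin.map_smul _ _).trans ?_
          rw [j.toHom.map_gam]; rfl }
      map_theta := fun _ _ => rfl }

end Ind
end Twist
end Metaplectic

namespace Metaplectic
open PowerSeries CategoryTheory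
noncomputable section MFun
set_option linter.unusedSectionVars false
variable {p : ℕ} [Fact p.Prime] {k : Type u} [Field k] [CharP k p]

namespace XFGMod

section pull
variable {T T' : XFGMod p k} (j : T.carrier →ₗ[k⟦X⟧] T'.carrier)

/-- The map `(T^∨[1/X])' → (T'^∨[1/X])'` induced by a `k⟦X⟧`-linear map `T → T'`. -/
def pull : T.DSpace →ₗ[LaurentSeries k] T'.DSpace where
  toFun u := u ∘ₗ PDual.map j
  map_add' _ _ := rfl
  map_smul' _ _ := rfl

lemma pull_apply (u : T.DSpace) (f : PDual k T'.carrier) : pull j u f = u (PDual.map j f) := rfl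

variable {j}

lemma map_C_smul (c : k) (u : T.DSpace) (f : PDual k T.carrier) :
    u ((C c : k⟦X⟧) • f) = constK k c * u f := by
  rw [map_smul, Algebra.smul_def]; rfl

lemma pull_phi (c : k) (h : ∀ w, j (T.F w) = (C c : k⟦X⟧) • T'.F (j w)) (u : T.DSpace) :
    pull j (phiD u) = constK k c • phiD (pull j u) := by
  refine LinearMap.ext fun f => ?_
  change phiVal u (PDual.map j f) = constK k c * phiVal (pull j u) f
  rw [phiVal, phiVal, Finset.mul_sum]
  refine Finset.sum_congr rfl fun i _ => ?_
  have h1 : PDual.transpose T.F (onePlusX p k (-(i : ℤ_[p])) • PDual.map j f) =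
      (C c : k⟦X⟧) • PDual.map j (PDual.transpose T'.F (onePlusX p k (-(i : ℤ_[p])) • f)) := by
    rw [← map_smul]
    refine PDual.ext fun w => ?_
    change (onePlusX p k (-(i : ℤ_[p])) • f) (j (T.F w)) =
      (onePlusX p k (-(i : ℤ_[p])) • f) (T'.F (j ((C c : k⟦X⟧) • w)))
    rw [h, j.map_smul, T'.F_smul, show phiA p k (C c) = C c from (phiA p k).commutes c]
  rw [phiTerm, h1, map_C_smul, map_mul, phiK_constK, phiTerm, mul_left_comm]
  rfl

lemma pull_gam (c : k) (γ : ℤ_[p]ˣ) (h : ∀ w, j (T.gam γ w) = (C c : k⟦X⟧) • T'.gam γ (j w))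
    (u : T.DSpace) : pull j (gamD γ u) = constK k c • gamD γ (pull j u) := by
  refine LinearMap.ext fun f => ?_
  have h1 : PDual.transpose (T.gam γ) (PDual.map j f) =
      (C c : k⟦X⟧) • PDual.map j (PDual.transpose (T'.gam γ) f) := by
    refine PDual.ext fun w => ?_
    change f (j (T.gam γ w)) = f (T'.gam γ (j ((C c : k⟦X⟧) • w)))
    rw [h, j.map_smul, T'.gam_smul, show gamA p k γ (C c) = C c from (gamA p k γ).commutes c]
  change gamK p k γ (u (PDual.transpose (T.gam γ) (PDual.map j f))) =
    constK k c * gamK p k γ (u (PDual.map j (PDual.transpose (T'.gam γ) f)))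
  rw [h1, map_C_smul, map_mul, gamK_constK]

lemma pull_smul {j : T.carrier →ₗ[k⟦X⟧] T.carrier} (c : k) (h : ∀ w, j w = (C c : k⟦X⟧) • w)
    (u : T.DSpace) : pull j u = constK k c • u := by
  refine LinearMap.ext fun f => ?_
  have h1 : PDual.map j f = (C c : k⟦X⟧) • f := PDual.ext fun w => congrArg f (h w)
  rw [pull_apply, h1, map_C_smul]; rfl

lemma pull_eq_self {j : T.carrier →ₗ[k⟦X⟧] T.carrier} (h : ∀ w, j w = w) (u : T.DSpace) :
    pull j u = u := by
  rw [pull_smul 1 (fun w => by rw [map_one, one_smul, h]), map_one, one_smul]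

lemma pull_comp {j j₁ j₂ : T.carrier →ₗ[k⟦X⟧] T.carrier} (h : ∀ w, j w = j₁ (j₂ w))
    (u : T.DSpace) : pull j u = pull j₁ (pull j₂ u) :=
  LinearMap.ext fun f => congrArg u (PDual.ext fun w => congrArg f (h w))

end pull

variable (V : XFGMod p k)

/-- A `k⟦X⟧[F, Γ]`-submodule. -/
def IsStable (W : Submodule k⟦X⟧ V.carrier) : Prop :=
  (∀ w ∈ W, V.F w ∈ W) ∧ ∀ γ, ∀ w ∈ W, V.gam γ w ∈ W

instance (W : Submodule k⟦X⟧ V.carrier) : IsScalarTower k k⟦X⟧ W :=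
  ⟨fun a b w => Subtype.ext (smul_assoc a b w.1)⟩

/-- A `k⟦X⟧[F, Γ]`-submodule, as a module. -/
abbrev sub (W : Submodule k⟦X⟧ V.carrier) (h : V.IsStable W) : XFGMod p k where
  carrier := W
  isScalarTower := ⟨fun a b w => Subtype.ext (smul_assoc a b w.1)⟩
  F := V.F.restrict (p := W.restrictScalars k) (q := W.restrictScalars k) h.1
  gam γ := (V.gam γ).restrict (p := W.restrictScalars k) (q := W.restrictScalars k) (h.2 γ)
  F_smul a w := Subtype.ext (V.F_smul a w)
  gam_smul γ a w := Subtype.ext (V.gam_smul γ a w)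
  gam_one w := Subtype.ext (V.gam_one w)
  gam_mul γ δ w := Subtype.ext (V.gam_mul γ δ w)
  F_gam γ w := Subtype.ext (V.F_gam γ w)
  torsion w := (V.torsion w).imp fun _ hn => Subtype.ext hn
  smooth w := (V.smooth w).mono fun _ h => Subtype.ext h

/-- The set `M(V)` of finitely generated `k⟦X⟧[F, Γ]`-submodules of `V` whose `X`-torsion is finite
dimensional. -/
@[ext]
structure MSub where
  toSub : Submodule k⟦X⟧ V.carrier
  stable : V.IsStable toSub
  /-- `toSub` is the smallest `k⟦X⟧[F, Γ]`-submodule containing some finite set. -/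
  fg : ∃ s : Set V.carrier, s.Finite ∧ IsLeast {W | V.IsStable W ∧ s ⊆ W} toSub
  fin : Module.Finite k (Submodule.torsionBy k⟦X⟧ toSub X)

instance : PartialOrder V.MSub := PartialOrder.lift MSub.toSub fun _ _ h => MSub.ext h

variable {V}
namespace MSub

lemma le_iff {W W' : V.MSub} : W ≤ W' ↔ W.toSub ≤ W'.toSub := Iff.rfl

/-- An element of `M(V)`, as a module. -/
abbrev mod (W : V.MSub) : XFGMod p k := V.sub W.toSub W.stable

lemma finite_dual (W : V.MSub) : Module.Finite k⟦X⟧ (PDual k W.mod.carrier) :=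
  PDual.finite W.mod.torsion W.fin

lemma coker (W : V.MSub) : ∃ m : ℕ, ∀ w : W.mod.carrier, (X : k⟦X⟧) ^ m • w ∈
    Submodule.span k⟦X⟧ (Set.range W.mod.F) := by
  obtain ⟨s, hs, hW⟩ := W.fg
  choose n hn using V.torsion
  set N := Submodule.span k⟦X⟧ (V.F '' W.toSub)
  set S := Submodule.span k⟦X⟧ {x | ∃ (γ : ℤ_[p]ˣ) (w : V.carrier), w ∈ s ∧ x = V.gam γ w}
  have hsW : s ⊆ W.toSub := hW.1.2
  have hS : S ≤ W.toSub := Submodule.span_le.2 (by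
    rintro _ ⟨γ, w, hw, rfl⟩
    exact W.stable.2 _ _ (hsW hw))
  have hN : N ≤ W.toSub := Submodule.span_le.2 (by
    rintro _ ⟨w, hw, rfl⟩
    exact W.stable.1 _ hw)
  have hgam : ∀ (B : Set V.carrier) (γ : ℤ_[p]ˣ), (∀ x ∈ B, V.gam γ x ∈ Submodule.span k⟦X⟧ B) →
      ∀ x ∈ Submodule.span k⟦X⟧ B, V.gam γ x ∈ Submodule.span k⟦X⟧ B := by
    intro B γ hB x hx
    induction hx using Submodule.span_induction with
    | mem x h => exact hB x h
    | zero => rw [map_zero]; exact Submodule.zero_mem _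
    | add x y _ _ hx hy => rw [map_add]; exact Submodule.add_mem _ hx hy
    | smul a x _ hx => rw [V.gam_smul]; exact Submodule.smul_mem _ _ hx
  have hst : V.IsStable (S ⊔ N) := by
    refine ⟨fun w hw => ?_, fun γ w hw => ?_⟩
    · exact le_sup_right (a := S) (Submodule.subset_span ⟨w, (sup_le hS hN) hw, rfl⟩)
    · obtain ⟨x, hx, y, hy, rfl⟩ := Submodule.mem_sup.1 hw
      rw [map_add]
      refine Submodule.add_mem_sup (hgam _ γ ?_ x hx) (hgam _ γ ?_ y hy)
      · rintro _ ⟨δ, w, hw, rfl⟩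
        exact Submodule.subset_span ⟨γ * δ, w, hw, (V.gam_mul _ _ _).symm⟩
      · rintro _ ⟨w, hw, rfl⟩
        exact Submodule.subset_span ⟨_, W.stable.2 γ w hw, V.F_gam γ w⟩
  have hle : W.toSub ≤ S ⊔ N := hW.2 ⟨hst, fun w hw => le_sup_left (b := N)
    (Submodule.subset_span ⟨1, w, hw, (V.gam_one w).symm⟩)⟩
  set m := ∑ w ∈ hs.toFinset, n w
  have hm : ∀ w ∈ s, (X : k⟦X⟧) ^ m • w = 0 := fun w hw => by
    have h1 : n w ≤ m := Finset.single_le_sum (f := n) (fun _ _ => Nat.zero_le _)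
      (hs.mem_toFinset.2 hw)
    rw [← Nat.sub_add_cancel h1, pow_add, mul_smul, hn, smul_zero]
  have hSm : ∀ x ∈ S, (X : k⟦X⟧) ^ m • x = 0 := by
    intro x hx
    induction hx using Submodule.span_induction with
    | mem x h =>
      obtain ⟨γ, w, hw, rfl⟩ := h
      obtain ⟨c, hc⟩ := X_dvd_gamA_unit p k γ
      rw [hc, mul_pow, mul_comm, ← map_pow, mul_smul, ← V.gam_smul, hm w hw, map_zero, smul_zero]
    | zero => exact smul_zero _
    | add x y _ _ hx hy => rw [smul_add, hx, hy, add_zero]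
    | smul a x _ hx => rw [smul_comm, hx, smul_zero]
  have hspan : N = (Submodule.span k⟦X⟧ (Set.range W.mod.F)).map W.toSub.subtype := by
    rw [Submodule.map_span]
    refine congrArg (Submodule.span k⟦X⟧) (Set.ext fun x => ?_)
    constructor
    · rintro ⟨w, hw, rfl⟩; exact ⟨_, ⟨⟨w, hw⟩, rfl⟩, rfl⟩
    · rintro ⟨_, ⟨w, rfl⟩, rfl⟩; exact ⟨w.1, w.2, rfl⟩
  refine ⟨m, fun w => ?_⟩
  obtain ⟨x, hx, y, hy, hxy⟩ := Submodule.mem_sup.1 (hle w.2)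
  have h1 : (X : k⟦X⟧) ^ m • w.1 ∈ N := by
    rw [← hxy, smul_add, hSm x hx, zero_add]
    exact Submodule.smul_mem _ _ hy
  rw [hspan] at h1
  obtain ⟨z, hz, hz'⟩ := h1
  have : z = (X : k⟦X⟧) ^ m • w := Subtype.ext hz'
  rwa [← this]

/-- The étale `(φ, Γ)`-module `(τ^∨[1/X])'` attached to `τ ∈ M(V)`. -/
def D (W : V.MSub) : PGMod p k := W.mod.D (hN := W.finite_dual) W.coker

/-- The inclusion `τ ⊆ τ'`. -/
def incl {W W' : V.MSub} (h : W ≤ W') : W.mod.carrier →ₗ[k⟦X⟧] W'.mod.carrier :=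
  Submodule.inclusion h

/-- The transition map `(τ^∨[1/X])' → (τ'^∨[1/X])'` for `τ ⊆ τ'`. -/
def DMap {W W' : V.MSub} (h : W ≤ W') : W.D ⟶ W'.D where
  toLin := pull (incl h)
  map_phi u := (pull_phi (j := incl h) 1 (fun w => by rw [map_one, one_smul]; rfl) u).trans
    (by rw [map_one, one_smul]; rfl)
  map_gam γ u := (pull_gam (j := incl h) 1 γ (fun w => by rw [map_one, one_smul]; rfl) u).trans
    (by rw [map_one, one_smul]; rfl)

end MSub

variable (V) in
/-- The functor `τ ↦ (τ^∨[1/X])'` on `M(V)`. -/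
def DFunctor : V.MSub ⥤ PGMod p k where
  obj W := W.D
  map h := MSub.DMap (leOfHom h)
  map_id _ := rfl
  map_comp _ _ := rfl

section sup

lemma isStable_bot : V.IsStable ⊥ :=
  ⟨fun w hw => by rw [Submodule.mem_bot] at *; rw [hw, map_zero],
    fun γ w hw => by rw [Submodule.mem_bot] at *; rw [hw, map_zero]⟩

lemma isStable_sup {W W' : Submodule k⟦X⟧ V.carrier} (h : V.IsStable W) (h' : V.IsStable W') :
    V.IsStable (W ⊔ W') := by
  refine ⟨fun w hw => ?_, fun γ w hw => ?_⟩ <;>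
  obtain ⟨x, hx, y, hy, rfl⟩ := Submodule.mem_sup.1 hw <;> rw [map_add]
  · exact Submodule.add_mem_sup (h.1 _ hx) (h'.1 _ hy)
  · exact Submodule.add_mem_sup (h.2 _ _ hx) (h'.2 _ _ hy)

instance : Bot V.MSub where
  bot :=
    { toSub := ⊥
      stable := isStable_bot
      fg := ⟨∅, Set.finite_empty, ⟨isStable_bot, Set.empty_subset _⟩, fun _ _ => bot_le⟩
      fin := inferInstance }

instance : Max V.MSub where
  max W W' :=
    { toSub := W.toSub ⊔ W'.toSub
      stable := isStable_sup W.stable W'.stable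
      fg := by
        obtain ⟨s, hs, h⟩ := W.fg
        obtain ⟨s', hs', h'⟩ := W'.fg
        exact ⟨s ∪ s', hs.union hs', ⟨isStable_sup W.stable W'.stable, Set.union_subset
          (h.1.2.trans (le_sup_left (a := W.toSub))) (h'.1.2.trans (le_sup_right (a := W.toSub)))⟩,
          fun U hU => sup_le (h.2 ⟨hU.1, Set.subset_union_left.trans hU.2⟩)
            (h'.2 ⟨hU.1, Set.subset_union_right.trans hU.2⟩)⟩
      fin := by
        refine PDual.finite_torsion ?_
        have h1 : Module.Finite k⟦X⟧ (PDual k W.toSub) := PDual.finite W.mod.torsion W.fin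
        have h2 : Module.Finite k⟦X⟧ (PDual k W'.toSub) := PDual.finite W'.mod.torsion W'.fin
        refine Module.Finite.of_injective ((PDual.map (k := k) (Submodule.inclusion
          (le_sup_left (a := W.toSub) (b := W'.toSub)))).prod (PDual.map (k := k)
          (Submodule.inclusion (le_sup_right (a := W.toSub) (b := W'.toSub))))) fun f g hfg => ?_
        refine PDual.ext fun w => ?_
        obtain ⟨x, hx, y, hy, hxy⟩ := Submodule.mem_sup.1 w.2
        have h3 := DFunLike.congr_fun (congrArg Prod.fst hfg) ⟨x, hx⟩
        have h4 := DFunLike.congr_fun (congrArg Prod.snd hfg) ⟨y, hy⟩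
        have h5 : w = Submodule.inclusion (le_sup_left (a := W.toSub) (b := W'.toSub)) ⟨x, hx⟩ +
          Submodule.inclusion (le_sup_right (a := W.toSub) (b := W'.toSub)) ⟨y, hy⟩ :=
          Subtype.ext hxy.symm
        rw [h5]
        exact (map_add (PDual.lin f) _ _).trans ((congrArg₂ (· + ·) h3 h4).trans
          (map_add (PDual.lin g) _ _).symm) }

instance : Nonempty V.MSub := ⟨⊥⟩

instance : IsDirectedOrder V.MSub :=
  ⟨fun W W' => ⟨W ⊔ W', (le_sup_left : W.toSub ≤ _), (le_sup_right : W'.toSub ≤ _)⟩⟩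

end sup
end XFGMod

/-- The ind-`(φ, Γ)`-module `D(V)`, the filtered colimit of `(τ^∨[1/X])'` over `τ ∈ M(V)`. -/
def indD (V : XFGMod p k) : Ind (PGMod p k) := Limits.colimit (V.DFunctor ⋙ Ind.yoneda)

end MFun
end Metaplectic

namespace Metaplectic
open PowerSeries CategoryTheory
noncomputable section MEq
set_option linter.unusedSectionVars false
variable {p : ℕ} [Fact p.Prime] {k : Type u} [Field k] [CharP k p]
variable {Ω : Type} [Group Ω] [TopologicalSpace Ω] (t : TwistDatum p k Ω)

/-- A smooth `k⟦X⟧[F, Γ]`-module `V` with a smooth genuine action of `Ω` such that `g ∈ Ω` is a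
morphism `V → V ⊗ χ_g`. -/
structure EqXFG where
  toXFG : XFGMod p k
  theta : Ω →* Module.End k⟦X⟧ toXFG.carrier
  theta_F : ∀ g w, theta g (toXFG.F w) = (C (t.char g (pUnit p) : k) : k⟦X⟧) • toXFG.F (theta g w)
  theta_gam : ∀ g γ w, theta g (toXFG.gam γ w) =
    (C (t.char g (unitIncl p γ) : k) : k⟦X⟧) • toXFG.gam γ (theta g w)
  smooth : ∀ w : toXFG.carrier, ∀ᶠ g in nhds (1 : Ω), theta g w = w
  genuine : ∀ ζ w, theta (t.mu ζ) w = (C (iota p k ζ : k) : k⟦X⟧) • w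

variable {t}
namespace EqXFG
variable (V : EqXFG t)

/-- The set of `Ω`-stable elements of `M(V)`. -/
abbrev MSub : Type u := {W : V.toXFG.MSub // ∀ g, ∀ w ∈ W.toSub, V.theta g w ∈ W.toSub}

instance : Nonempty V.MSub :=
  ⟨⟨⊥, fun g w hw => (Submodule.mem_bot _).2 (by rw [(Submodule.mem_bot _).1 hw, map_zero])⟩⟩

instance : IsDirectedOrder V.MSub :=
  ⟨fun W W' => ⟨⟨W.1 ⊔ W'.1, fun g w hw => by
    obtain ⟨x, hx, y, hy, rfl⟩ := Submodule.mem_sup.1 hw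
    rw [map_add]
    exact Submodule.add_mem_sup (W.2 g x hx) (W'.2 g y hy)⟩,
    (le_sup_left : W.1.toSub ≤ _), (le_sup_right : W'.1.toSub ≤ _)⟩⟩

variable {V}
namespace MSub
variable (W : V.MSub)

/-- The action of `g ∈ Ω` on `W`. -/
def act (g : Ω) : W.1.mod.carrier →ₗ[k⟦X⟧] W.1.mod.carrier := (V.theta g).restrict (W.2 g)

/-- The action of `Ω` on `(τ^∨[1/X])'`: `(g u)(f) = u(f ∘ g)`. -/
def theta : Ω →* Module.End (LaurentSeries k) W.1.D.carrier where
  toFun g := XFGMod.pull (W.act g)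
  map_one' := LinearMap.ext fun u =>
    XFGMod.pull_eq_self (j := W.act 1) (fun w => Subtype.ext (LinearMap.congr_fun (map_one V.theta) w.1)) u
  map_mul' g h := LinearMap.ext fun u =>
    XFGMod.pull_comp (j := W.act (g * h)) (j₁ := W.act g) (j₂ := W.act h) (fun w => Subtype.ext (LinearMap.congr_fun (map_mul V.theta g h) w.1)) u

/-- Elements of `Ω` close to `1` act trivially on `W`. -/
lemma eventually_theta : ∀ᶠ g in nhds (1 : Ω), ∀ w ∈ W.1.toSub, V.theta g w = w := by
  obtain ⟨s, hs, hW⟩ := W.1.fg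
  filter_upwards [t.smooth, (Filter.eventually_all_finite hs).2 fun w _ => V.smooth w] with g hg hgs
  have hst : V.toXFG.IsStable (LinearMap.eqLocus (V.theta g) LinearMap.id) := by
    refine ⟨fun w hw => ?_, fun γ w hw => ?_⟩
    · have hw' : V.theta g w = w := hw
      change V.theta g (V.toXFG.F w) = V.toXFG.F w
      rw [V.theta_F, hw', hg, MonoidHom.one_apply, Units.val_one, map_one, one_smul]
    · have hw' : V.theta g w = w := hw
      change V.theta g (V.toXFG.gam γ w) = V.toXFG.gam γ w
      rw [V.theta_gam, hw', hg, MonoidHom.one_apply, Units.val_one, map_one, one_smul]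
  exact fun w hw => hW.2 ⟨hst, hgs⟩ hw

/-- The equivariant `(φ, Γ)`-module `(τ^∨[1/X])'` for an `Ω`-stable `τ ∈ M(V)`. -/
def D : EqMod t where
  toPG := W.1.D
  theta := W.theta
  theta_phi g u := XFGMod.pull_phi (j := W.act g) _ (fun w => Subtype.ext (V.theta_F g w.1)) u
  theta_gam g γ u := XFGMod.pull_gam (j := W.act g) _ γ (fun w => Subtype.ext (V.theta_gam g γ w.1)) u
  smooth u := by
    filter_upwards [W.eventually_theta] with g hg
    exact XFGMod.pull_eq_self (j := W.act g) (fun w => Subtype.ext (hg w.1 w.2)) u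
  genuine ζ u := XFGMod.pull_smul (j := W.act (t.mu ζ)) _ (fun w => Subtype.ext (V.genuine ζ w.1)) u

end MSub

variable (V) in
/-- The functor `τ ↦ (τ^∨[1/X])'` on the `Ω`-stable elements of `M(V)`. -/
def DFunctor : V.MSub ⥤ EqMod t where
  obj W := W.D
  map {W W'} h :=
    { toHom := XFGMod.MSub.DMap (leOfHom h : W.1 ≤ W'.1)
      map_theta := fun _ _ => rfl }
  map_id _ := rfl
  map_comp _ _ := rfl

end EqXFG

/-- The ind-object `D(V)` of the category of smooth genuine equivariant `(φ, Γ)`-modules: the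
filtered colimit of `(τ^∨[1/X])'` over the `Ω`-stable `τ ∈ M(V)`. -/
def indDEq (V : EqXFG t) : Ind (EqMod t) := Limits.colimit (V.DFunctor ⋙ Ind.yoneda)

section Box
variable (t)

/-- `D` with `Ω` acting through a smooth character `η` extending `ι`, if all `χ_g` are trivial. -/
def boxObj (htriv : ∀ g, t.char g = 1) (η : Ω →* kˣ) (hη : ∀ᶠ g in nhds (1 : Ω), η g = 1)
    (hmu : ∀ ζ, η (t.mu ζ) = iota p k ζ) (D : PGMod p k) : EqMod t where
  toPG := D
  theta := (algebraMap (LaurentSeries k) (Module.End (LaurentSeries k) D.carrier)).toMonoidHom.comp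
    ((constK k).toMonoidHom.comp ((Units.coeHom k).comp η))
  theta_phi g x := by
    change constK k _ • _ = _ • D.phi (constK k _ • x)
    rw [D.phi.map_smulₛₗ, phiK_constK, TwistDatum.cst, htriv, MonoidHom.one_apply, Units.val_one,
      map_one]
    exact (one_smul _ _).symm
  theta_gam g γ x := by
    change constK k _ • _ = _ • D.gam γ (constK k _ • x)
    rw [(D.gam γ).map_smulₛₗ, gamK_constK, TwistDatum.cst, htriv, MonoidHom.one_apply,
      Units.val_one, map_one]
    exact (one_smul _ _).symm
  smooth x := by
    filter_upwards [hη] with g hg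
    change constK k (η g : k) • x = x
    rw [hg, Units.val_one, map_one, one_smul]
  genuine ζ x := by
    change constK k (η (t.mu ζ) : k) • x = _
    rw [hmu]

/-- The functor `D ↦ η ⊠ D`. -/
def boxFunctor (htriv : ∀ g, t.char g = 1) (η : Ω →* kˣ) (hη : ∀ᶠ g in nhds (1 : Ω), η g = 1)
    (hmu : ∀ ζ, η (t.mu ζ) = iota p k ζ) : PGMod p k ⥤ EqMod t where
  obj D := boxObj t htriv η hη hmu D
  map f := ⟨f, fun _ _ => f.toLin.map_smul _ _⟩

end Box
end MEq
end Metaplectic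

namespace Metaplectic
open PowerSeries CategoryTheory
noncomputable section Hilb
set_option linter.unusedSectionVars false
variable (p : ℕ) [Fact p.Prime]

/-- The `p`-adic valuation of an element of `ℚ_pˣ`. -/
def val (x : ℚ_[p]ˣ) : ℤ := Padic.valuation (x : ℚ_[p])

variable {p}
lemma val_mul (x y : ℚ_[p]ˣ) : val p (x * y) = val p x + val p y :=
  Padic.valuation_mul x.ne_zero y.ne_zero

lemma val_pow (x : ℚ_[p]ˣ) (n : ℤ) : val p (x ^ n) = n * val p x := by
  rw [val, Units.val_zpow_eq_zpow_val, Padic.valuation_zpow]; rfl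

lemma norm_unitPart (x : ℚ_[p]ˣ) : ‖(x : ℚ_[p]) * (p : ℚ_[p]) ^ (-val p x)‖ = 1 := by
  have hp : (0 : ℝ) < p := by exact_mod_cast (Fact.out : p.Prime).pos
  rw [norm_mul, Padic.norm_eq_zpow_neg_valuation x.ne_zero, Padic.norm_p_zpow, neg_neg]
  change (p : ℝ) ^ (-val p x) * (p : ℝ) ^ val p x = 1
  rw [← zpow_add₀ hp.ne', neg_add_cancel, zpow_zero]

/-- The unit `x / p ^ v(x)`. -/
def unitPart (x : ℚ_[p]ˣ) : ℤ_[p]ˣ := PadicInt.mkUnits (norm_unitPart x)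

lemma unitPart_coe (x : ℚ_[p]ˣ) :
    ((unitPart x : ℤ_[p]) : ℚ_[p]) = (x : ℚ_[p]) * (p : ℚ_[p]) ^ (-val p x) := rfl

lemma eq_unitPart (x : ℚ_[p]ˣ) : x = unitIncl p (unitPart x) * pUnit p ^ val p x := by
  have hp0 : (p : ℚ_[p]) ≠ 0 := Nat.cast_ne_zero.2 (Fact.out : p.Prime).ne_zero
  refine Units.ext ?_
  rw [Units.val_mul, Units.val_zpow_eq_zpow_val]
  change (x : ℚ_[p]) = (x : ℚ_[p]) * (p : ℚ_[p]) ^ (-val p x) * (p : ℚ_[p]) ^ (val p x)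
  rw [mul_assoc, ← zpow_add₀ hp0, neg_add_cancel, zpow_zero, mul_one]

lemma unitPart_mul (x y : ℚ_[p]ˣ) : unitPart (x * y) = unitPart x * unitPart y := by
  have hp0 : (p : ℚ_[p]) ≠ 0 := Nat.cast_ne_zero.2 (Fact.out : p.Prime).ne_zero
  refine Units.ext (Subtype.ext ?_)
  rw [Units.val_mul, PadicInt.coe_mul]
  rw [unitPart_coe, unitPart_coe, unitPart_coe, Units.val_mul, val_mul, neg_add, zpow_add₀ hp0]
  ring

variable (p)
/-- The mod `p` cyclotomic character `ω : ℚ_pˣ → 𝔽_pˣ`: it maps `p` to `1`, and a unit to its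
residue class. -/
def omega : ℚ_[p]ˣ →* (ZMod p)ˣ :=
  (Units.map (PadicInt.toZMod (p := p)).toMonoidHom).comp (MonoidHom.mk' unitPart unitPart_mul)

variable [Fact (p ≠ 2)]

lemma two_mul_half : 2 * ((p - 1) / 2) = p - 1 :=
  Nat.two_mul_div_two_of_even
    ((Fact.out : p.Prime).even_sub_one (Fact.out : p ≠ 2))

/-- The map `x ↦ x ^ ((p - 1) / 2)` from `𝔽_pˣ` to `μ₂`. -/
def quad : (ZMod p)ˣ →* Mu2 p where
  toFun x := ⟨x ^ ((p - 1) / 2), by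
    rw [mem_rootsOfUnity, ← pow_mul, mul_comm, two_mul_half, ZMod.units_pow_card_sub_one_eq_one]⟩
  map_one' := Subtype.ext (one_pow _)
  map_mul' x y := Subtype.ext (mul_pow _ _ _)

variable {p}
lemma mu2_sq (ζ : Mu2 p) : ζ * ζ = 1 := by
  have := ζ.2
  rw [mem_rootsOfUnity] at this
  exact Subtype.ext ((pow_two _).symm.trans this)

lemma mu2_inv (ζ : Mu2 p) : ζ⁻¹ = ζ := inv_eq_of_mul_eq_one_right (mu2_sq ζ)

/-- The quadratic Hilbert symbol
`(a, b) = ω((-1) ^ (v(a) v(b)) b ^ v(a) / a ^ v(b)) ^ ((p - 1) / 2)`. -/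
def hilb (a b : ℚ_[p]ˣ) : Mu2 p :=
  quad p (omega p ((-1) ^ (val p a * val p b) * (b ^ val p a / a ^ val p b)))

lemma hilb_mul_left (a a' b : ℚ_[p]ˣ) : hilb (a * a') b = hilb a b * hilb a' b := by
  rw [hilb, hilb, hilb, ← map_mul, ← map_mul, val_mul, add_mul, zpow_add, zpow_add, mul_zpow,
    mul_mul_mul_comm, mul_div_mul_comm]

lemma hilb_mul_right (a b b' : ℚ_[p]ˣ) : hilb a (b * b') = hilb a b * hilb a b' := by
  rw [hilb, hilb, hilb, ← map_mul, ← map_mul, val_mul, mul_add, zpow_add, zpow_add, mul_zpow,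
    mul_mul_mul_comm, mul_div_mul_comm]

lemma hilb_one_left (b : ℚ_[p]ˣ) : hilb 1 b = 1 := by
  have := hilb_mul_left 1 1 b
  rwa [mul_one, left_eq_mul] at this

lemma hilb_one_right (b : ℚ_[p]ˣ) : hilb b 1 = 1 := by
  have := hilb_mul_right b 1 1
  rwa [mul_one, left_eq_mul] at this

lemma hilb_sq_left (a b : ℚ_[p]ˣ) : hilb (a * a) b = 1 := by rw [hilb_mul_left, mu2_sq]
lemma hilb_sq_right (a b : ℚ_[p]ˣ) : hilb a (b * b) = 1 := by rw [hilb_mul_right, mu2_sq]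

lemma perm6 {G : Type} [CommGroup G] (a b c d e f : G) :
    a * b * (c * d * (e * f)) = a * (c * e) * (b * (d * f)) := by
  rw [mul_mul_mul_comm c, mul_mul_mul_comm]

/-- The character `χ_z : ℚ_pˣ → μ₂`,
`χ_z(x) = ((-1) ^ (v(z) v(x)) ω(x) ^ v(z) ω(z) ^ v(x)) ^ ((p - 1) / 2)`. -/
def chi (z : ℚ_[p]ˣ) : ℚ_[p]ˣ →* Mu2 p :=
  MonoidHom.mk' (fun x => quad p ((-1) ^ (val p z * val p x) * (omega p x ^ val p z *
    omega p z ^ val p x))) fun x y => by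
      rw [← map_mul, val_mul, mul_add, zpow_add, zpow_add, map_mul (omega p), mul_zpow]
      exact congrArg _ (perm6 _ _ _ _ _ _)

lemma chi_apply (z x : ℚ_[p]ˣ) : chi z x = quad p ((-1) ^ (val p z * val p x) *
  (omega p x ^ val p z * omega p z ^ val p x)) := rfl

lemma chi_mul (z z' x : ℚ_[p]ˣ) : chi (z * z') x = chi z x * chi z' x := by
  rw [chi_apply, chi_apply, chi_apply, ← map_mul, val_mul, add_mul, zpow_add, zpow_add,
    map_mul (omega p), mul_zpow]
  exact congrArg _ (perm6 _ _ _ _ _ _)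

lemma val_neg_one : val p (-1) = 0 := by
  have h := val_mul (p := p) (-1) (-1)
  rw [neg_mul_neg, one_mul, val, Units.val_one, Padic.valuation_one] at h
  omega

lemma omega_neg_one : omega p (-1) = -1 := by
  refine Units.ext ?_
  have h : unitPart (-1 : ℚ_[p]ˣ) = -1 := Units.ext (Subtype.ext (by
    rw [unitPart_coe, val_neg_one]; simp))
  change PadicInt.toZMod ((unitPart (-1 : ℚ_[p]ˣ) : ℤ_[p])) = _
  rw [h]; simp

/-- Commutators in the cover are computed by `χ_z`. -/
lemma hilb_eq_chi (z x : ℚ_[p]ˣ) : hilb x z = chi z x := by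
  rw [hilb, chi_apply, map_mul, map_mul, map_mul, map_mul, map_div, map_div, map_zpow, omega_neg_one,
    map_zpow (omega p), map_zpow (omega p), div_eq_mul_inv, mu2_inv, mul_comm (val p z),
    mul_comm (quad p (omega p z ^ _))]

lemma hilb_comm (x y : ℚ_[p]ˣ) : hilb x y = hilb y x := by
  rw [hilb_eq_chi, hilb_eq_chi, chi_apply, chi_apply, mul_comm (val p x),
    mul_comm (omega p x ^ _)]

/-- If `v(x) = 0` and `ω(x) = 1`, then `x` is a square. -/
lemma isSquare_of (x : ℚ_[p]ˣ) (hv : val p x = 0) (hω : omega p x = 1) : IsSquare x := by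
  have hx := eq_unitPart x
  rw [hv, zpow_zero, mul_one] at hx
  have h1 : PadicInt.toZMod (unitPart x : ℤ_[p]) = 1 := congrArg Units.val hω
  have h2 : ‖(unitPart x : ℤ_[p]) - 1‖ < 1 := by
    rw [← PadicInt.mem_nonunits, ← IsLocalRing.mem_maximalIdeal, ← PadicInt.ker_toZMod,
      RingHom.mem_ker, map_sub, h1, map_one, sub_self]
  have h3 : ‖(2 : ℤ_[p])‖ = 1 := by
    have : ¬ (p : ℤ) ∣ 2 := fun h => (Fact.out : p ≠ 2)
      ((Nat.prime_dvd_prime_iff_eq (Fact.out : p.Prime) Nat.prime_two).1 (by exact_mod_cast h))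
    have h4 := (PadicInt.norm_int_lt_one_iff_dvd (p := p) 2).not.2 this
    exact le_antisymm (PadicInt.norm_le_one _) (by simpa using h4)
  obtain ⟨z, hz, -⟩ := hensels_lemma (p := p)
    (F := Polynomial.X ^ 2 - Polynomial.C (unitPart x : ℤ_[p])) (a := 1) (by
      simp only [map_sub, map_pow, Polynomial.aeval_X, Polynomial.aeval_C, Polynomial.derivative_X_pow,
        Polynomial.derivative_C, sub_zero]
      simp [h3]
      rwa [norm_sub_rev])
  have hz2 : z ^ 2 = unitPart x := by
    simpa [sub_eq_zero] using hz
  have hzu : IsUnit z := isUnit_of_dvd_unit (Dvd.intro_left z (pow_two z).symm |>.trans (by rw [hz2])) (unitPart x).isUnit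
  obtain ⟨w, rfl⟩ := hzu
  refine ⟨unitIncl p w, ?_⟩
  rw [hx, ← map_mul, ← pow_two]
  congr 1
  exact Units.ext hz2.symm

/-- The subgroup of squares has finite index. -/
instance : (Subgroup.square ℚ_[p]ˣ).FiniteIndex := by
  let h : ℚ_[p]ˣ →* Multiplicative (ZMod 2) × (ZMod p)ˣ :=
    (MonoidHom.mk' (fun x => Multiplicative.ofAdd (val p x : ZMod 2)) fun x y => by
      rw [val_mul, Int.cast_add, ofAdd_add]).prod (omega p)
  have h1 : h.ker ≤ Subgroup.square ℚ_[p]ˣ := by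
    intro x hx
    have hx1 : (val p x : ZMod 2) = 0 := congrArg Prod.fst (MonoidHom.mem_ker.1 hx)
    have hx2 : omega p x = 1 := congrArg Prod.snd (MonoidHom.mem_ker.1 hx)
    rw [ZMod.intCast_zmod_eq_zero_iff_dvd] at hx1
    obtain ⟨m, hm⟩ := hx1
    have hp : val p (pUnit p) = 1 := Padic.valuation_p
    have hpo : omega p (pUnit p) = 1 := by
      have h2 := eq_unitPart (pUnit p)
      rw [hp, zpow_one, right_eq_mul] at h2
      have h3 : unitPart (pUnit p) = 1 :=
        Units.ext (Subtype.ext (congrArg (fun u : ℚ_[p]ˣ => (u : ℚ_[p])) h2))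
      change Units.map _ (unitPart (pUnit p)) = 1
      rw [h3, map_one]
    obtain ⟨y, hy⟩ := isSquare_of (x * pUnit p ^ (-(2 * m))) (by
      rw [val_mul, val_pow, hp, hm]; push_cast; ring) (by
      rw [map_mul, map_zpow, hx2, hpo, one_zpow, one_mul])
    refine ⟨y * pUnit p ^ m, ?_⟩
    rw [mul_mul_mul_comm, ← hy, ← zpow_add, mul_assoc, ← zpow_add]
    rw [show -(2 * m) + (m + m) = 0 by ring, zpow_zero, mul_one]
  exact Subgroup.finiteIndex_of_le h1

lemma eventually_one : ∀ᶠ x : ℚ_[p]ˣ in nhds 1, val p x = 0 ∧ omega p x = 1 := by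
  have h : ∀ᶠ x : ℚ_[p] in nhds 1, ‖x - 1‖ < 1 := by
    filter_upwards [Metric.ball_mem_nhds (1 : ℚ_[p]) one_pos] with x hx
    exact mem_ball_iff_norm.1 hx
  filter_upwards [(Units.continuous_val.tendsto' (1 : ℚ_[p]ˣ) 1 rfl).eventually h] with x hx
  have h1 : ‖(x : ℚ_[p])‖ = 1 := by
    have h2 := Padic.add_eq_max_of_ne (p := p) (q := (x : ℚ_[p]) - 1) (r := 1) (by
      rw [norm_one]; exact hx.ne)
    rw [sub_add_cancel, norm_one, max_eq_right hx.le] at h2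
    exact h2
  have hv : val p x = 0 := by
    rw [Padic.norm_eq_zpow_neg_valuation x.ne_zero] at h1
    have hp : (1 : ℝ) < p := by exact_mod_cast (Fact.out : p.Prime).one_lt
    have := (zpow_eq_one_iff_right₀ (zero_le_one.trans hp.le) hp.ne').1 h1
    exact neg_eq_zero.1 this
  refine ⟨hv, Units.ext ?_⟩
  have hx' := unitPart_coe x
  rw [hv, neg_zero, zpow_zero, mul_one] at hx'
  have h2 : (unitPart x : ℤ_[p]) - 1 ∈ RingHom.ker (PadicInt.toZMod (p := p)) := by
    rw [PadicInt.ker_toZMod, IsLocalRing.mem_maximalIdeal, PadicInt.mem_nonunits, PadicInt.norm_def,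
      PadicInt.coe_sub, hx']
    exact hx
  rw [RingHom.mem_ker, map_sub, map_one, sub_eq_zero] at h2
  exact h2

end Hilb
end Metaplectic

namespace Metaplectic
open PowerSeries CategoryTheory
noncomputable section Cover
set_option linter.unusedSectionVars false
variable (p : ℕ) [Fact p.Prime]

/-- The subgroup of upper triangular matrices. -/
def Borel : Subgroup (GL (Fin 2) ℚ_[p]) where
  carrier := {g | g 1 0 = 0}
  mul_mem' {g h} hg hh := by
    change (g.1 * h.1) 1 0 = 0
    have hg' : g.1 1 0 = 0 := hg
    have hh' : h.1 1 0 = 0 := hh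
    rw [Matrix.mul_apply, Fin.sum_univ_two, hg', hh', zero_mul, mul_zero, add_zero]
  one_mem' := Matrix.one_apply_ne (by decide)
  inv_mem' {g} hg := by
    have hg' : g.1 1 0 = 0 := hg
    change (g⁻¹).1 1 0 = 0
    rw [Matrix.coe_units_inv, Matrix.inv_def, Matrix.adjugate_fin_two]
    simp [hg']

variable {p}
open Classical in
/-- The function `𝔠` with value the lower left entry, if it is nonzero, and else the lower right
entry. -/
def lowEntry (g : GL (Fin 2) ℚ_[p]) : ℚ_[p]ˣ :=
  if h : g 1 0 ≠ 0 then Units.mk0 (g 1 0) h else Units.mk0 (g 1 1) fun h1 => by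
    have h2 : g.1 1 0 = 0 := not_not.1 h
    have h1' : g.1 1 1 = 0 := h1
    have h3 := g.det.ne_zero
    rw [Matrix.GeneralLinearGroup.val_det_apply, Matrix.det_fin_two, h2, h1', mul_zero, mul_zero,
      sub_zero] at h3
    exact h3 rfl

lemma borel_entry (g : Borel p) : g.1.1 1 0 = 0 := g.2

lemma borel_det (g : Borel p) : (g.1.det : ℚ_[p]) = g.1.1 0 0 * g.1.1 1 1 := by
  rw [Matrix.GeneralLinearGroup.val_det_apply, Matrix.det_fin_two, borel_entry, mul_zero, sub_zero]

variable (p)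
/-- The upper left entry. -/
def aB : Borel p →* ℚ_[p]ˣ where
  toFun g := Units.mk0 (g.1.1 0 0) fun h => g.1.det.ne_zero (by rw [borel_det, h, zero_mul])
  map_one' := Units.ext (Matrix.one_apply_eq _)
  map_mul' g h := Units.ext (by
    change (g.1.1 * h.1.1) 0 0 = g.1.1 0 0 * h.1.1 0 0
    rw [Matrix.mul_apply, Fin.sum_univ_two, borel_entry, mul_zero, add_zero])

/-- The lower right entry. -/
def dB : Borel p →* ℚ_[p]ˣ where
  toFun g := Units.mk0 (g.1.1 1 1) fun h => g.1.det.ne_zero (by rw [borel_det, h, mul_zero])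
  map_one' := Units.ext (Matrix.one_apply_eq _)
  map_mul' g h := Units.ext (by
    change (g.1.1 * h.1.1) 1 1 = g.1.1 1 1 * h.1.1 1 1
    rw [Matrix.mul_apply, Fin.sum_univ_two, borel_entry, zero_mul, zero_add])

variable {p}
lemma det_eq (g : Borel p) : g.1.det = aB p g * dB p g := Units.ext (borel_det g)

lemma lowEntry_borel (g : Borel p) : lowEntry g.1 = dB p g := by
  have h : ¬ g.1 1 0 ≠ 0 := not_not.2 g.2
  rw [lowEntry, dif_neg h]; rfl

lemma continuous_entry (i j : Fin 2) : Continuous fun g : Borel p => g.1.1 i j :=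
  (Units.continuous_val.comp continuous_subtype_val).matrix_elem i j

lemma continuous_aB : Continuous (aB p) :=
  Units.isEmbedding_val₀.continuous_iff.2 (continuous_entry 0 0)

lemma continuous_dB : Continuous (dB p) :=
  Units.isEmbedding_val₀.continuous_iff.2 (continuous_entry 1 1)

variable [Fact (p ≠ 2)]

/-- The `2`-cocycle `σ` of `GL₂(ℚ_p)` with values in `μ₂` defining the metaplectic cover. -/
def sigma (g h : GL (Fin 2) ℚ_[p]) : Mu2 p :=
  hilb (lowEntry (g * h) / lowEntry g) (lowEntry (g * h) / lowEntry h * g.det)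

lemma sigma_borel (g h : Borel p) : sigma g.1 h.1 = hilb (dB p h) (aB p g) := by
  rw [sigma, show g.1 * h.1 = (g * h).1 from rfl, lowEntry_borel, lowEntry_borel, lowEntry_borel,
    det_eq, map_mul, mul_div_cancel_left, mul_div_cancel_right, mul_left_comm, hilb_mul_right,
    hilb_sq_right, mul_one]

lemma eventually_isSquare : ∀ᶠ x : ℚ_[p]ˣ in nhds 1, IsSquare x :=
  eventually_one.mono fun x hx => isSquare_of x hx.1 hx.2

lemma isOpen_square : IsOpen (Subgroup.square ℚ_[p]ˣ : Set ℚ_[p]ˣ) :=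
  Subgroup.isOpen_of_mem_nhds _ (g := 1) eventually_isSquare

lemma continuous_hilb : Continuous fun x : ℚ_[p]ˣ × ℚ_[p]ˣ => hilb x.1 x.2 := by
  refine continuous_iff_continuousAt.2 fun ⟨a, b⟩ => ?_
  refine Filter.EventuallyEq.continuousAt (y := hilb a b) ?_
  have h : ∀ c : ℚ_[p]ˣ, ∀ᶠ x in nhds c, IsSquare (x * c⁻¹) := fun c =>
    ((continuous_mul_const c⁻¹).tendsto' c 1 (mul_inv_cancel c)).eventually eventually_isSquare
  rw [nhds_prod_eq]
  filter_upwards [(h a).prod_mk (h b)] with x hx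
  obtain ⟨⟨y, hy⟩, ⟨z, hz⟩⟩ := hx
  rw [mul_inv_eq_iff_eq_mul] at hy hz
  rw [hy, hz, hilb_mul_left, hilb_sq_left, one_mul, hilb_mul_right, hilb_sq_right, one_mul]

variable (p)
/-- The preimage of the Borel subgroup in the metaplectic cover of `GL₂(ℚ_p)`, with elements
`(g, ζ)`. -/
@[ext]
structure Btilde where
  base : Borel p
  sgn : Mu2 p

variable {p}
namespace Btilde

instance : Mul (Btilde p) :=
  ⟨fun x y => ⟨x.base * y.base, x.sgn * y.sgn * sigma x.base.1 y.base.1⟩⟩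
instance : One (Btilde p) := ⟨⟨1, 1⟩⟩
instance : Inv (Btilde p) := ⟨fun x => ⟨x.base⁻¹, x.sgn * sigma x.base⁻¹.1 x.base.1⟩⟩

lemma base_mul (x y : Btilde p) : (x * y).base = x.base * y.base := rfl
lemma sgn_mul (x y : Btilde p) :
    (x * y).sgn = x.sgn * y.sgn * hilb (dB p y.base) (aB p x.base) := by
  rw [← sigma_borel]; rfl
lemma base_one : (1 : Btilde p).base = 1 := rfl
lemma sgn_one : (1 : Btilde p).sgn = 1 := rfl

instance : Group (Btilde p) := Group.ofLeftAxioms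
  (fun x y z => by
    refine Btilde.ext (mul_assoc _ _ _) ?_
    rw [sgn_mul, sgn_mul, sgn_mul, sgn_mul, base_mul, base_mul, map_mul, map_mul, hilb_mul_left,
      hilb_mul_right]
    have : ∀ a b c d e f : Mu2 p, a * b * d * c * (e * f) = a * (b * c * f) * (d * e) := fun a b c d e f => by
      rw [mul_assoc a, mul_assoc a, mul_assoc a, mul_assoc a, mul_right_comm b d c, mul_assoc (b * c),
        mul_assoc (b * c), ← mul_assoc d, mul_comm (d * e) f]
    exact this _ _ _ _ _ _)
  (fun x => by
    refine Btilde.ext (one_mul _) ?_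
    rw [sgn_mul, base_one, sgn_one, map_one, hilb_one_right, one_mul, mul_one])
  (fun x => by
    refine Btilde.ext (inv_mul_cancel _) ?_
    change x.sgn * sigma x.base⁻¹.1 x.base.1 * x.sgn * sigma x.base⁻¹.1 x.base.1 = 1
    rw [mul_assoc, mu2_sq])

/-- The topology on `B × μ₂`; note that `σ` is locally constant on `B × B`. -/
instance : TopologicalSpace (Btilde p) :=
  TopologicalSpace.induced (fun x => (x.base, x.sgn)) inferInstance

lemma continuous_iff {Y : Type*} [TopologicalSpace Y] {f : Y → Btilde p} :
    Continuous f ↔ Continuous (fun y => (f y).base) ∧ Continuous (fun y => (f y).sgn) := by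
  rw [continuous_induced_rng, continuous_prodMk.symm]; rfl

lemma continuous_pair : Continuous fun x : Btilde p => (x.base, x.sgn) := continuous_induced_dom
lemma continuous_base : Continuous (base : Btilde p → Borel p) :=
  continuous_fst.comp continuous_pair
lemma continuous_sgn : Continuous (sgn : Btilde p → Mu2 p) :=
  continuous_snd.comp continuous_pair

instance : IsTopologicalGroup (Btilde p) where
  continuous_mul := by
    refine continuous_iff.2 ⟨(continuous_base.comp continuous_fst).mul
      (continuous_base.comp continuous_snd), ?_⟩
    simp_rw [sgn_mul]
    have h1 := continuous_dB.comp (continuous_base.comp (continuous_snd (X := Btilde p) (Y := Btilde p)))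
    have h2 := continuous_aB.comp (continuous_base.comp (continuous_fst (X := Btilde p) (Y := Btilde p)))
    have h3 := continuous_hilb.comp (h1.prodMk h2)
    exact ((continuous_sgn.comp continuous_fst).mul (continuous_sgn.comp continuous_snd)).mul h3
  continuous_inv := by
    refine continuous_iff.2 ⟨continuous_base.inv, ?_⟩
    have : ∀ x : Btilde p, (x⁻¹).sgn = x.sgn * hilb (dB p x.base) (aB p x.base⁻¹) := fun x => by
      rw [← sigma_borel]; rfl
    simp_rw [this]
    have h1 := continuous_dB.comp (continuous_base (p := p))
    have h2 := continuous_aB.comp (continuous_base (p := p)).inv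
    have h3 := continuous_hilb.comp (h1.prodMk h2)
    exact continuous_sgn.mul h3

variable (p)
/-- The projection `B̃ → B`. -/
def proj : Btilde p →* Borel p where
  toFun := base
  map_one' := rfl
  map_mul' _ _ := rfl

/-- The inclusion `μ₂ → B̃`. -/
def mu : Mu2 p →* Btilde p where
  toFun ζ := ⟨1, ζ⟩
  map_one' := rfl
  map_mul' ζ ξ := Btilde.ext (one_mul 1).symm (by
    rw [sgn_mul, map_one, hilb_one_left, mul_one])

variable {p}
lemma mu_mul (ζ : Mu2 p) (x : Btilde p) : mu p ζ * x = ⟨x.base, ζ * x.sgn⟩ :=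
  Btilde.ext (one_mul _) (by
    rw [sgn_mul]
    change ζ * x.sgn * hilb _ (aB p 1) = _
    rw [map_one, hilb_one_right, mul_one])

lemma mu_central (ζ : Mu2 p) (x : Btilde p) : mu p ζ * x = x * mu p ζ := by
  refine Btilde.ext ((one_mul _).trans (mul_one _).symm) ?_
  rw [mu_mul, sgn_mul]
  change _ = x.sgn * ζ * hilb (dB p 1) _
  rw [map_one, hilb_one_left, mul_one, mul_comm]

end Btilde

lemma scalar_entry (z : ℚ_[p]ˣ) (i j : Fin 2) :
    (Matrix.GeneralLinearGroup.scalar (Fin 2) z).1 i j = if i = j then (z : ℚ_[p]) else 0 := by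
  simp [Matrix.GeneralLinearGroup.scalar, Matrix.diagonal_apply]

variable (p)
/-- The scalar matrices. -/
def scalarB : ℚ_[p]ˣ →* Borel p :=
  (Matrix.GeneralLinearGroup.scalar (Fin 2)).codRestrict (Borel p) fun z =>
    (scalar_entry z 1 0).trans (if_neg (by decide))

/-- The preimage `Z̃` of the center of `GL₂(ℚ_p)`, which is the group of scalar matrices; it is
also denoted `Q̃_pˣ`. -/
def Zt : Subgroup (Btilde p) := (scalarB p).range.comap (Btilde.proj p)

/-- The projection `Z̃ → ℚ_pˣ`. -/
def zc : Zt p →* ℚ_[p]ˣ := (dB p).comp ((Btilde.proj p).comp (Zt p).subtype)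

variable {p}
lemma dB_scalarB (z : ℚ_[p]ˣ) : dB p (scalarB p z) = z :=
  Units.ext ((scalar_entry z 1 1).trans (if_pos rfl))
lemma aB_scalarB (z : ℚ_[p]ˣ) : aB p (scalarB p z) = z :=
  Units.ext ((scalar_entry z 0 0).trans (if_pos rfl))

lemma base_Zt (x : Zt p) : x.1.base = scalarB p (zc p x) := by
  obtain ⟨z, hz⟩ := x.2
  have hz' : scalarB p z = x.1.base := hz
  change _ = scalarB p (dB p x.1.base)
  rw [← hz', dB_scalarB]

lemma continuous_zc : Continuous (zc p) :=
  continuous_dB.comp (Btilde.continuous_base.comp continuous_subtype_val)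

/-- Conjugation by `z̃ ∈ Z̃` on `B̃` is given by the character `χ_z ∘ det`. -/
lemma Zt_conj (x : Zt p) (g : Btilde p) :
    x.1 * g = Btilde.mu p (chi (zc p x) g.base.1.det) * (g * x.1) := by
  rw [Btilde.mu_mul]
  refine Btilde.ext ?_ ?_
  · change x.1.base * g.base = g.base * x.1.base
    rw [base_Zt]
    refine Subtype.ext (Units.ext ?_)
    exact (Matrix.scalar_commute (n := Fin 2) (zc p x : ℚ_[p]) (fun _ => Commute.all _ _) g.base.1.1).eq
  · rw [Btilde.sgn_mul]
    change _ = chi _ _ * (g * x.1).sgn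
    rw [Btilde.sgn_mul, base_Zt, aB_scalarB, dB_scalarB, ← hilb_eq_chi, det_eq,
      hilb_mul_left, hilb_comm (zc p x)]
    have h : ∀ a b c d : Mu2 p, d * c * b = a * b * (c * d * a) := fun a b c d => by
      rw [mul_comm (c * d), mul_mul_mul_comm, mu2_sq, one_mul, mul_comm b, mul_comm c]
    exact h _ _ _ _

variable (p) (k : Type u) [Field k] [CharP k p]

/-- The action of `Z̃` on `(φ, Γ)`-modules by twisting with the characters `χ_z`. -/
def twist : TwistDatum p k (Zt p) where
  char := MonoidHom.mk' (fun x => (iota p k).comp (chi (zc p x))) fun x y => MonoidHom.ext fun a => by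
    change iota p k _ = iota p k _ * iota p k _
    rw [map_mul, chi_mul, map_mul]
  char_smooth x := by
    have h : Continuous (unitIncl p) := Continuous.units_map _ continuous_subtype_val
    filter_upwards [(h.tendsto' 1 1 (map_one _)).eventually eventually_one] with γ hγ
    change iota p k (chi (zc p x) _) = 1
    rw [chi_apply, hγ.1, hγ.2]
    simp
  smooth := by
    filter_upwards [(continuous_zc.tendsto' 1 1 (map_one _)).eventually eventually_one] with x hx
    refine MonoidHom.ext fun a => ?_
    change iota p k (chi (zc p x) a) = 1
    rw [chi_apply, hx.1, hx.2]
    simp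
  mu := (Btilde.mu p).codRestrict (Zt p) fun ζ => ⟨1, map_one _⟩
  mu_central ζ x := Subtype.ext (Btilde.mu_central ζ x.1)

/-- The preimage `S̃` of the group of squares in `Z̃`. -/
def St : Subgroup (Zt p) := (Subgroup.square ℚ_[p]ˣ).comap (zc p)

instance : (St p).FiniteIndex := ⟨by
  rw [St, Subgroup.index_comap]
  exact Subgroup.FiniteIndex.index_ne_zero (H := (Subgroup.square ℚ_[p]ˣ).subgroupOf (zc p).range)⟩

lemma isOpen_St : IsOpen (St p : Set (Zt p)) := isOpen_square.preimage continuous_zc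

lemma mu_mem_St (ζ : Mu2 p) : (twist p k).mu ζ ∈ St p := by
  have : zc p ((twist p k).mu ζ) = 1 := map_one (dB p)
  change zc p _ ∈ Subgroup.square ℚ_[p]ˣ
  rw [this]; exact one_mem _

lemma twist_St (x : St p) : ((twist p k).restrict (St p) (mu_mem_St p k)).char x = 1 := by
  obtain ⟨y, hy⟩ := x.2
  refine MonoidHom.ext fun a => ?_
  change iota p k (chi (zc p x) a) = 1
  rw [hy, chi_mul, mu2_sq, map_one]

variable {k} in
/-- The character `(z, ζ) ↦ χ(z) ι(ζ)` of `S̃ = S × μ₂`. -/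
def etaS (χ : ℚ_[p]ˣ →* kˣ) : St p →* kˣ :=
  MonoidHom.mk' (fun x => χ (zc p x) * iota p k x.1.1.sgn) fun x y => by
    obtain ⟨z, hz⟩ := x.2
    have h : (x * y).1.1.sgn = x.1.1.sgn * y.1.1.sgn := by
      change (x.1.1 * y.1.1).sgn = _
      rw [Btilde.sgn_mul, base_Zt, base_Zt, aB_scalarB, hz, hilb_sq_right, mul_one]
    rw [h, map_mul]
    change χ (zc p (x.1 * y.1)) * _ = _
    rw [map_mul, map_mul, mul_mul_mul_comm]

/-- The subgroup `B_S` of `B` of matrices whose lower right entry is a square. -/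
def BS : Subgroup (Borel p) := (Subgroup.square ℚ_[p]ˣ).comap (dB p)

/-- The preimage of `B_S` in `B̃`. -/
def BSt : Subgroup (Btilde p) := (BS p).comap (Btilde.proj p)

lemma isOpen_BSt : IsOpen (BSt p : Set (Btilde p)) :=
  (isOpen_square.preimage continuous_dB).preimage Btilde.continuous_base

/-- The mirabolic subgroup `P` of matrices in `B` with lower right entry `1`. -/
def Mirab : Subgroup (Borel p) := (dB p).ker

/-- The splitting `P → B̃`, `g ↦ (g, 1)`. -/
def secP : Mirab p →* Btilde p where
  toFun g := ⟨g, 1⟩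
  map_one' := rfl
  map_mul' g h := Btilde.ext rfl (by
    rw [Btilde.sgn_mul, MonoidHom.mem_ker.1 h.2, hilb_one_left, mul_one, mul_one])

lemma continuous_secP : Continuous (secP p) :=
  Btilde.continuous_iff.2 ⟨continuous_subtype_val, continuous_const⟩

end Cover
end Metaplectic

namespace Metaplectic
open PowerSeries CategoryTheory
noncomputable section PSAction
set_option linter.unusedSectionVars false
variable {k : Type u} [Field k]

section
variable {V : Type u} [AddCommGroup V] [Module k V] (e : Module.End k V)
  (he : ∀ v, ∃ n : ℕ, (e ^ n) v = 0)

open Classical in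
/-- The action of a power series `a` in a locally nilpotent endomorphism `e`. -/
def psSMul (a : k⟦X⟧) (v : V) : V := Polynomial.aeval e (trunc (Nat.find (he v)) a) v

variable {e}
lemma pow_apply_zero {m n : ℕ} (h : m ≤ n) {v : V} (hv : (e ^ m) v = 0) : (e ^ n) v = 0 := by
  rw [← Nat.sub_add_cancel h, pow_add, Module.End.mul_apply, hv, map_zero]

variable {he}
lemma psSMul_eq {a : k⟦X⟧} {v : V} {N : ℕ} {q : Polynomial k} (hv : (e ^ N) v = 0)
    (hq : (X : k⟦X⟧) ^ N ∣ a - q) : psSMul e he a v = Polynomial.aeval e q v := by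
  classical
  have hn := Nat.find_spec (he v)
  have hle : Nat.find (he v) ≤ N := Nat.find_min' (he v) hv
  rw [psSMul]
  generalize Nat.find (he v) = n at *
  have h1 : Polynomial.X ^ n ∣ trunc n a - q := by
    rw [Polynomial.X_pow_dvd_iff]
    intro d hd
    have := X_pow_dvd_iff.1 hq d (hd.trans_le hle)
    rw [map_sub, Polynomial.coeff_coe] at this
    rw [Polynomial.coeff_sub, coeff_trunc, if_pos hd, this]
  obtain ⟨r, hr⟩ := h1
  rw [← sub_eq_zero, ← LinearMap.sub_apply, ← map_sub, hr, mul_comm, map_mul, Module.End.mul_apply,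
    map_pow, Polynomial.aeval_X, hn, map_zero]

lemma psSMul_eq_trunc {a : k⟦X⟧} {v : V} {N : ℕ} (hv : (e ^ N) v = 0) :
    psSMul e he a v = Polynomial.aeval e (trunc N a) v := by
  refine psSMul_eq hv ?_
  rw [X_pow_dvd_iff]
  intro m hm
  rw [map_sub, Polynomial.coeff_coe, coeff_trunc, if_pos hm, sub_self]

lemma psSMul_coe (q : Polynomial k) (v : V) : psSMul e he q v = Polynomial.aeval e q v := by
  obtain ⟨N, hN⟩ := he v
  exact psSMul_eq hN (by rw [sub_self]; exact dvd_zero _)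

variable (e he) in
/-- The `k⟦X⟧`-module structure on `V` with `X` acting through `e`. -/
abbrev psModule : Module k⟦X⟧ V where
  smul := psSMul e he
  one_smul v := by
    have := psSMul_coe (he := he) (1 : Polynomial k) v
    rw [Polynomial.coe_one, map_one] at this
    exact this
  mul_smul a b v := by
    change psSMul e he (a * b) v = psSMul e he a (psSMul e he b v)
    obtain ⟨N, hN⟩ := he v
    have h1 : (e ^ N) (psSMul e he b v) = 0 := by
      have h2 := congrArg (fun f : Module.End k V => f v)
        ((Commute.all (Polynomial.X ^ N : Polynomial k) (trunc N b)).map (Polynomial.aeval e)).eq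
      simp only [map_pow, Polynomial.aeval_X, Module.End.mul_apply] at h2
      rw [psSMul_eq_trunc hN, h2, hN, map_zero]
    rw [psSMul_eq_trunc h1, psSMul_eq_trunc (a := b) hN, ← Module.End.mul_apply, ← map_mul]
    refine psSMul_eq hN ?_
    have h3 : ∀ c : k⟦X⟧, (X : k⟦X⟧) ^ N ∣ c - trunc N c := fun c => by
      rw [X_pow_dvd_iff]
      intro m hm
      rw [map_sub, Polynomial.coeff_coe, coeff_trunc, if_pos hm, sub_self]
    rw [Polynomial.coe_mul, show a * b - (trunc N a : k⟦X⟧) * trunc N b =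
      (a - trunc N a) * b + trunc N a * (b - trunc N b) by ring]
    exact dvd_add (Dvd.dvd.mul_right (h3 a) _) (Dvd.dvd.mul_left (h3 b) _)
  smul_zero a := by
    change psSMul e he a 0 = 0
    rw [psSMul, map_zero]
  zero_smul v := by
    have := psSMul_coe (he := he) (0 : Polynomial k) v
    rw [Polynomial.coe_zero, map_zero] at this
    exact this
  smul_add a v w := by
    change psSMul e he a (v + w) = psSMul e he a v + psSMul e he a w
    obtain ⟨m, hm⟩ := he v
    obtain ⟨n, hn⟩ := he w
    have h1 := pow_apply_zero (le_max_left m n) hm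
    have h2 := pow_apply_zero (le_max_right m n) hn
    rw [psSMul_eq_trunc h1, psSMul_eq_trunc h2, ← map_add]
    exact psSMul_eq_trunc (by rw [map_add, h1, h2, add_zero])
  add_smul a b v := by
    change psSMul e he (a + b) v = psSMul e he a v + psSMul e he b v
    obtain ⟨N, hN⟩ := he v
    rw [psSMul_eq_trunc hN, psSMul_eq_trunc hN, psSMul_eq_trunc hN, map_add, map_add,
      LinearMap.add_apply]

variable (e he)
lemma psModule_coe (q : Polynomial k) (v : V) :
    (psModule e he).toSMul.smul (q : k⟦X⟧) v = Polynomial.aeval e q v := psSMul_coe q v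

lemma psModule_tower : @IsScalarTower k k⟦X⟧ V _ (psModule e he).toSMul _ := by
  let _ := psModule e he
  refine ⟨fun c a v => ?_⟩
  have h1 : ∀ v : V, (C c : k⟦X⟧) • v = c • v := fun v => by
    have := psSMul_coe (he := he) (Polynomial.C c) v
    rw [Polynomial.coe_C, Polynomial.aeval_C] at this
    exact this
  rw [PowerSeries.smul_eq_C_mul, mul_smul, h1]

end

section
variable {M M' : Type u} [AddCommGroup M] [Module k M] [Module k⟦X⟧ M] [IsScalarTower k k⟦X⟧ M]
  [AddCommGroup M'] [Module k M'] [Module k⟦X⟧ M'] [IsScalarTower k k⟦X⟧ M']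

lemma semilinear_of_X (T : M →ₗ[k] M') (ψ : k⟦X⟧ →ₐ[k] k⟦X⟧) (hψ : X ∣ ψ X)
    (hM : ∀ v : M, ∃ n : ℕ, (X : k⟦X⟧) ^ n • v = 0)
    (hM' : ∀ v : M', ∃ n : ℕ, (X : k⟦X⟧) ^ n • v = 0)
    (h : ∀ v, T ((X : k⟦X⟧) • v) = ψ X • T v) (a : k⟦X⟧) (v : M) : T (a • v) = ψ a • T v := by
  have hpow : ∀ (n : ℕ) (v : M), T ((X : k⟦X⟧) ^ n • v) = ψ (X ^ n) • T v := by
    intro n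
    induction n with
    | zero => intro v; rw [pow_zero, one_smul, map_one, one_smul]
    | succ n ih => intro v; rw [pow_succ, mul_smul, ih, h, smul_smul, map_mul]
  have hpoly : ∀ (q : Polynomial k) (v : M), T ((q : k⟦X⟧) • v) = ψ q • T v := by
    intro q v
    induction q using Polynomial.induction_on' with
    | add q r hq hr => rw [Polynomial.coe_add, add_smul, map_add, hq, hr, map_add, add_smul]
    | monomial n c =>
      have hc : (monomial n c : k⟦X⟧) = c • (X : k⟦X⟧) ^ n := by
        rw [PowerSeries.smul_eq_C_mul]; ext m; rw [coeff_monomial, coeff_C_mul_X_pow]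
      have h4 : T (c • ((X : k⟦X⟧) ^ n • v)) = c • T ((X : k⟦X⟧) ^ n • v) := map_smul T c _
      have h5 : ψ (c • (X : k⟦X⟧) ^ n) = c • ψ (X ^ n) := map_smul ψ c _
      rw [Polynomial.coe_monomial, hc, smul_assoc, h4, hpow, h5, smul_assoc]
  obtain ⟨m, hm⟩ := hM v
  obtain ⟨n, hn⟩ := hM' (T v)
  obtain ⟨N, hmN, hnN⟩ : ∃ N, m ≤ N ∧ n ≤ N := ⟨_, le_max_left _ _, le_max_right _ _⟩
  have h1 : (X : k⟦X⟧) ^ N • v = 0 := by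
    rw [← Nat.sub_add_cancel hmN, pow_add, mul_smul, hm, smul_zero]
  have h2 : (X : k⟦X⟧) ^ N • T v = 0 := by
    rw [← Nat.sub_add_cancel hnN, pow_add, mul_smul, hn, smul_zero]
  obtain ⟨c, hc⟩ := pow_dvd_pow_of_dvd hψ N
  rw [eq_X_pow_mul_shift_add_trunc N a, add_smul, map_add, mul_comm, mul_smul, h1, smul_zero, map_zero,
    zero_add, hpoly, map_add, add_smul, map_mul, map_pow, hc, mul_comm (X ^ N), ← mul_assoc, mul_smul,
    h2, smul_zero, zero_add]
end

end PSAction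
end Metaplectic

namespace Metaplectic
open PowerSeries CategoryTheory
noncomputable section SmoothRep
set_option linter.unusedSectionVars false

/-- A smooth representation of the topological group `G` on a `k`-vector space. -/
structure SmRep (k : Type u) [Field k] (G : Type) [Group G] [TopologicalSpace G] where
  V : Type u
  [addCommGroup : AddCommGroup V]
  [module : Module k V]
  ρ : Representation k G V
  smooth : ∀ v, IsOpen {g | ρ g v = v}

attribute [instance] SmRep.addCommGroup SmRep.module

namespace SmRep
variable {k : Type u} [Field k] {G H : Type} [Group G] [TopologicalSpace G] [Group H]
  [TopologicalSpace H]

lemma eventually (σ : SmRep k G) (v : σ.V) : ∀ᶠ g in nhds (1 : G), σ.ρ g v = v :=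
  (σ.smooth v).mem_nhds (by rw [Set.mem_ofPred_eq, map_one]; rfl)

lemma isOpen_of_eventually [IsTopologicalGroup G] {V : Type u} [AddCommGroup V] [Module k V]
    (ρ : Representation k G V) (v : V) (h : ∀ᶠ g in nhds (1 : G), ρ g v = v) :
    IsOpen {g | ρ g v = v} := by
  let St : Subgroup G :=
    { carrier := {g | ρ g v = v}
      mul_mem' := fun {a b} ha hb => by
        rw [Set.mem_ofPred_eq] at *
        rw [map_mul, Module.End.mul_apply, hb, ha]
      one_mem' := by rw [Set.mem_ofPred_eq, map_one]; rfl
      inv_mem' := fun {a} ha => by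
        rw [Set.mem_ofPred_eq] at *
        conv_lhs => rw [← ha]
        rw [← Module.End.mul_apply, ← map_mul, inv_mul_cancel, map_one]; rfl }
  exact St.isOpen_of_mem_nhds (g := 1) h

/-- The restriction of a smooth representation along a continuous homomorphism. -/
def res (σ : SmRep k G) (f : H →* G) (hf : Continuous f) : SmRep k H where
  V := σ.V
  ρ := σ.ρ.comp f
  smooth v := (σ.smooth v).preimage hf

end SmRep

section Mir
variable {p : ℕ} [Fact p.Prime]

/-- The matrix with rows `(a, b)` and `(0, 1)`. -/
def pMat (a : ℚ_[p]ˣ) (b : ℚ_[p]) : Mirab p :=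
  ⟨⟨⟨!![(a : ℚ_[p]), b; 0, 1], !![((a⁻¹ : ℚ_[p]ˣ) : ℚ_[p]), -((a⁻¹ : ℚ_[p]ˣ) : ℚ_[p]) * b; 0, 1],
    by ext i j; fin_cases i <;> fin_cases j <;> simp [Matrix.mul_apply, Fin.sum_univ_two],
    by ext i j; fin_cases i <;> fin_cases j <;> simp [Matrix.mul_apply, Fin.sum_univ_two]⟩,
    rfl⟩, Units.ext rfl⟩

lemma pMat_mul (a a' : ℚ_[p]ˣ) (b b' : ℚ_[p]) :
    pMat a b * pMat a' b' = pMat (a * a') (a * b' + b) := by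
  refine Subtype.ext (Subtype.ext (Units.ext ?_))
  change !![(a : ℚ_[p]), b; 0, 1] * !![(a' : ℚ_[p]), b'; 0, 1] = !![((a * a' : ℚ_[p]ˣ) : ℚ_[p]), _; 0, 1]
  ext i j; fin_cases i <;> fin_cases j <;> simp [Matrix.mul_apply, Fin.sum_univ_two]

lemma pMat_one : (pMat 1 0 : Mirab p) = 1 := by
  refine Subtype.ext (Subtype.ext (Units.ext ?_))
  change !![((1 : ℚ_[p]ˣ) : ℚ_[p]), 0; 0, 1] = 1
  ext i j; fin_cases i <;> fin_cases j <;> simp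

lemma continuous_pMat : Continuous fun x : ℚ_[p]ˣ × ℚ_[p] => pMat x.1 x.2 := by
  have h1 : Continuous fun x : ℚ_[p]ˣ × ℚ_[p] => (x.1 : ℚ_[p]) :=
    Units.continuous_val.comp continuous_fst
  have h2 : Continuous fun x : ℚ_[p]ˣ × ℚ_[p] => ((x.1⁻¹ : ℚ_[p]ˣ) : ℚ_[p]) :=
    Units.continuous_val.comp continuous_fst.inv
  refine (Units.continuous_iff.2 ⟨?_, ?_⟩).subtype_mk _ |>.subtype_mk _
  · change Continuous fun x : ℚ_[p]ˣ × ℚ_[p] => !![(x.1 : ℚ_[p]), x.2; 0, 1]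
    refine continuous_matrix fun i j => ?_
    fin_cases i <;> fin_cases j <;> simp <;> fun_prop
  · change Continuous fun x : ℚ_[p]ˣ × ℚ_[p] =>
      !![((x.1⁻¹ : ℚ_[p]ˣ) : ℚ_[p]), -((x.1⁻¹ : ℚ_[p]ˣ) : ℚ_[p]) * x.2; 0, 1]
    refine continuous_matrix fun i j => ?_
    fin_cases i <;> fin_cases j <;> simp only [Fin.zero_eta, Fin.mk_one, Matrix.of_apply, Matrix.cons_val_zero, Matrix.cons_val_one, Matrix.cons_val_fin_one] <;> fun_prop

variable {k : Type u} [Field k] [CharP k p] (σ : SmRep k (Mirab p))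

namespace Mir

lemma uni_add (b b' : ℚ_[p]) : pMat 1 (b + b') = pMat 1 b * pMat 1 b' := by
  rw [pMat_mul, one_mul, Units.val_one, one_mul, add_comm]

lemma uni_nat (n : ℕ) (v : σ.V) : (σ.ρ (pMat 1 1) ^ n) v = σ.ρ (pMat 1 (n : ℚ_[p])) v := by
  rw [← map_pow]
  congr 2
  induction n with
  | zero => rw [pow_zero, Nat.cast_zero, pMat_one]
  | succ n ih => rw [pow_succ, ih, Nat.cast_succ, uni_add]

lemma exists_fix (v : σ.V) : ∃ n : ℕ, ∀ b : ℤ_[p], σ.ρ (pMat 1 ((p ^ n * b : ℤ_[p]) : ℚ_[p])) v = v := by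
  have hc : Continuous fun b : ℤ_[p] => pMat 1 (b : ℚ_[p]) :=
    continuous_pMat.comp (continuous_const.prodMk continuous_subtype_val)
  have h := (hc.tendsto' 0 1 (by rw [PadicInt.coe_zero, pMat_one])).eventually (σ.eventually v)
  obtain ⟨ε, hε, h⟩ := Metric.eventually_nhds_iff.1 h
  obtain ⟨n, hn⟩ := PadicInt.exists_pow_neg_lt p hε
  refine ⟨n, fun b => h ?_⟩
  rw [dist_zero_right]
  refine lt_of_le_of_lt ?_ hn
  rw [PadicInt.norm_le_pow_iff_mem_span_pow, Ideal.mem_span_singleton]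
  exact dvd_mul_right _ _

/-- The action of `u - 1` for the matrix `u` with rows `(1, 1)` and `(0, 1)`. -/
def e : Module.End k σ.V := σ.ρ (pMat 1 1) - 1

lemma aeval_e (q : Polynomial k) :
    Polynomial.aeval (e σ) (q.comp (1 + Polynomial.X)) = Polynomial.aeval (σ.ρ (pMat 1 1)) q := by
  rw [Polynomial.aeval_comp, map_add, Polynomial.aeval_X, map_one, e, add_sub_cancel]

lemma e_pow (n : ℕ) (v : σ.V) (h : ∀ b : ℤ_[p], σ.ρ (pMat 1 ((p ^ n * b : ℤ_[p]) : ℚ_[p])) v = v) :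
    (e σ ^ p ^ n) v = 0 := by
  have h1 : (Polynomial.X : Polynomial k) ^ p ^ n =
      (Polynomial.X ^ p ^ n - 1 : Polynomial k).comp (1 + Polynomial.X) := by
    rw [Polynomial.sub_comp, Polynomial.pow_comp, Polynomial.X_comp, Polynomial.one_comp,
      add_pow_char_pow, one_pow, add_sub_cancel_left]
  have h2 := congrArg (Polynomial.aeval (e σ)) h1
  rw [aeval_e, map_pow, Polynomial.aeval_X, map_sub, map_pow, Polynomial.aeval_X, map_one] at h2
  have h3 := h 1
  rw [mul_one] at h3
  push_cast at h3
  rw [h2, LinearMap.sub_apply, uni_nat, Module.End.one_apply]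
  push_cast
  rw [h3, sub_self]

lemma e_nil (v : σ.V) : ∃ n : ℕ, (e σ ^ n) v = 0 :=
  let ⟨n, hn⟩ := exists_fix σ v
  ⟨_, e_pow σ n v hn⟩

/-- The `k⟦X⟧`-module structure on a smooth representation of the mirabolic group, where
`1 + X` acts as the matrix with rows `(1, 1)` and `(0, 1)`. -/
abbrev mod : Module k⟦X⟧ σ.V := psModule (e σ) (e_nil σ)

section
attribute [local instance] mod

instance tower : IsScalarTower k k⟦X⟧ σ.V := psModule_tower (e σ) (e_nil σ)

lemma coe_smul (q : Polynomial k) (v : σ.V) : (q : k⟦X⟧) • v = Polynomial.aeval (e σ) q v :=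
  psModule_coe (e σ) (e_nil σ) q v

lemma X_pow_smul (n : ℕ) (v : σ.V) : (X : k⟦X⟧) ^ n • v = (e σ ^ n) v := by
  rw [← Polynomial.coe_X, ← Polynomial.coe_pow, coe_smul, map_pow, Polynomial.aeval_X]

lemma torsion (v : σ.V) : ∃ n : ℕ, (X : k⟦X⟧) ^ n • v = 0 :=
  (e_nil σ v).imp fun n hn => (X_pow_smul σ n v).trans hn

lemma X_smul (v : σ.V) : (X : k⟦X⟧) • v = σ.ρ (pMat 1 1) v - v := by
  rw [← pow_one X, X_pow_smul, pow_one]; rfl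

lemma onePlusX_smul (a : ℤ_[p]) (v : σ.V) : onePlusX p k a • v = σ.ρ (pMat 1 (a : ℚ_[p])) v := by
  obtain ⟨n, hn⟩ := exists_fix σ v
  have h0 := e_pow σ n v hn
  obtain ⟨c, hc⟩ := Ideal.mem_span_singleton.1 (PadicInt.appr_spec n a)
  obtain ⟨r, hr⟩ := X_pow_dvd_onePlusX_sub p k n a (a.appr n) ⟨c, hc⟩
  rw [sub_eq_iff_eq_add] at hr hc
  rw [hr, add_smul, mul_comm, mul_smul, X_pow_smul, h0, smul_zero, zero_add, onePlusX_nat,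
    show (1 + X : k⟦X⟧) ^ a.appr n =
      (((Polynomial.X ^ a.appr n : Polynomial k).comp (1 + Polynomial.X) : Polynomial k) : k⟦X⟧) by
        simp, coe_smul, aeval_e, map_pow, Polynomial.aeval_X, uni_nat]
  conv_rhs => rw [hc, PadicInt.coe_add, add_comm, uni_add, map_mul, Module.End.mul_apply, hn]
  rw [PadicInt.coe_natCast]

end

/-- The action of the diagonal matrix with entries `a`, `1`. -/
def diag (a : ℚ_[p]ˣ) : σ.V →ₗ[k] σ.V := σ.ρ (pMat a 0)

lemma diag_mul (a b : ℚ_[p]ˣ) (v : σ.V) : diag σ (a * b) v = diag σ a (diag σ b v) := by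
  rw [diag, diag, diag, ← Module.End.mul_apply, ← map_mul, pMat_mul, mul_zero, add_zero]

lemma diag_uni (a : ℚ_[p]ˣ) (b : ℚ_[p]) (v : σ.V) :
    diag σ a (σ.ρ (pMat 1 b) v) = σ.ρ (pMat 1 (a * b)) (diag σ a v) := by
  rw [diag, ← Module.End.mul_apply, ← map_mul, pMat_mul, ← Module.End.mul_apply, ← map_mul,
    pMat_mul, mul_one, one_mul, Units.val_one, one_mul, add_zero, zero_add]

end Mir

/-- The smooth `k⟦X⟧[F, Γ]`-module given by a smooth representation of the mirabolic group `P`,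
where `1 + X`, `F` and `γ ∈ Γ` act as the matrices with rows `(1, 1), (0, 1)`, rows `(p, 0), (0, 1)`
and rows `(γ, 0), (0, 1)`. -/
def SmRep.toXFG : XFGMod p k :=
  let _ : Module k⟦X⟧ σ.V := Mir.mod σ
  { carrier := σ.V
    module := Mir.mod σ
    isScalarTower := Mir.tower σ
    F := Mir.diag σ (pUnit p)
    gam := fun γ => Mir.diag σ (unitIncl p γ)
    F_smul := semilinear_of_X _ _ (X_dvd_phiA_X p k) (Mir.torsion σ) (Mir.torsion σ) fun v => by
      have h : phiA p k X = onePlusX p k p - 1 := by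
        have := charP_of_injective_ringHom (C_injective (R := k)) p
        rw [phiA_X, onePlusX_nat, add_pow_char, one_pow, add_sub_cancel_left]
      rw [Mir.X_smul, map_sub, h, sub_smul, one_smul, Mir.onePlusX_smul, Mir.diag_uni, mul_one,
        PadicInt.coe_natCast]
      rfl
    gam_smul := fun γ => semilinear_of_X _ _ (X_dvd_gamA_X p k γ) (Mir.torsion σ) (Mir.torsion σ) fun v => by
      rw [Mir.X_smul, map_sub, gamA_X, sub_smul, one_smul, Mir.onePlusX_smul, Mir.diag_uni, mul_one]
      rfl
    gam_one := fun w => by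
      rw [map_one, Mir.diag, pMat_one, map_one]; rfl
    gam_mul := fun γ δ w => by rw [map_mul, Mir.diag_mul]
    F_gam := fun γ w => by rw [← Mir.diag_mul, ← Mir.diag_mul, mul_comm]
    torsion := Mir.torsion σ
    smooth := fun w => by
      have h : Continuous (unitIncl p) := Continuous.units_map _ continuous_subtype_val
      have hc : Continuous fun γ : ℤ_[p]ˣ => pMat (unitIncl p γ) 0 :=
        continuous_pMat.comp (h.prodMk continuous_const)
      exact (hc.tendsto' 1 1 (by rw [map_one, pMat_one])).eventually (σ.eventually w) }

end Mir
end SmoothRep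
end Metaplectic

namespace Metaplectic
open PowerSeries CategoryTheory
noncomputable section Induction
set_option linter.unusedSectionVars false

namespace SmRep
section ind
variable {k : Type u} [Field k] {G : Type} [Group G] [TopologicalSpace G] [IsTopologicalGroup G]
  {Δ : Subgroup G} (σ : SmRep k Δ)

/-- The space of functions `f : G → σ` with `f(h g) = h f(g)` for `h ∈ Δ`, which are invariant under
right translation by all elements of `G` close to `1`. -/
def indSub : Submodule k (G → σ.V) where
  carrier := {f | (∀ (h : Δ) (g : G), f (h * g) = σ.ρ h (f g)) ∧
    ∀ᶠ g in nhds (1 : G), ∀ x, f (x * g) = f x}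
  add_mem' {f f'} hf hf' := ⟨fun h g => by
      change f _ + f' _ = σ.ρ h (f g + f' g)
      rw [hf.1, hf'.1, map_add], by
      filter_upwards [hf.2, hf'.2] with g h h' x
      change f _ + f' _ = f x + f' x
      rw [h, h']⟩
  zero_mem' := ⟨fun h g => (map_zero (σ.ρ h)).symm, Filter.Eventually.of_forall fun _ _ => rfl⟩
  smul_mem' a f hf := ⟨fun h g => by
      change a • f _ = σ.ρ h (a • f g)
      rw [hf.1, map_smul], by
      filter_upwards [hf.2] with g h x
      change a • f _ = a • f x
      rw [h]⟩

lemma eventually_conj {P : G → Prop} (h : ∀ᶠ g in nhds (1 : G), P g) (a : G) :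
    ∀ᶠ g in nhds (1 : G), P (a⁻¹ * g * a) :=
  ((by fun_prop : Continuous fun g => a⁻¹ * g * a).tendsto' 1 1 (by group)).eventually h

/-- The smooth induction, on which `G` acts by right translation. -/
def ind : SmRep k G where
  V := σ.indSub
  ρ :=
    { toFun := fun a =>
      { toFun := fun f => ⟨fun g => f.1 (g * a), fun h g => by
          beta_reduce
          rw [mul_assoc, f.2.1], by
          filter_upwards [eventually_conj f.2.2 a] with g hg x
          rw [← hg (x * a)]
          exact congrArg f.1 (by group)⟩
        map_add' := fun _ _ => rfl
        map_smul' := fun _ _ => rfl }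
      map_one' := LinearMap.ext fun f => Subtype.ext (funext fun g => congrArg f.1 (mul_one g))
      map_mul' := fun a b => LinearMap.ext fun f => Subtype.ext (funext fun g =>
        congrArg f.1 (mul_assoc g a b).symm) }
  smooth f := isOpen_of_eventually _ f (f.2.2.mono fun _ hg => Subtype.ext (funext hg))

open Classical in
/-- The function supported on `Δ` with `h ↦ h v`. -/
def extFun (v : σ.V) (g : G) : σ.V := if h : g ∈ Δ then σ.ρ ⟨g, h⟩ v else 0

variable {σ}
lemma extFun_pos {g : G} (h : g ∈ Δ) (v : σ.V) : σ.extFun v g = σ.ρ ⟨g, h⟩ v := dif_pos h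
lemma extFun_neg {g : G} (h : g ∉ Δ) (v : σ.V) : σ.extFun v g = 0 := dif_neg h

lemma extFun_mul (h : Δ) (g : G) (v : σ.V) : σ.extFun v (h * g) = σ.ρ h (σ.extFun v g) := by
  have h1 : (h : G) * g ∈ Δ ↔ g ∈ Δ := Δ.mul_mem_cancel_left h.2
  by_cases h2 : g ∈ Δ
  · rw [extFun_pos h2, extFun_pos (h1.2 h2), ← Module.End.mul_apply, ← map_mul]; rfl
  · rw [extFun_neg h2, extFun_neg (mt h1.1 h2), map_zero]

lemma extFun_mul_right (g : G) (h : Δ) (v : σ.V) : σ.extFun v (g * h) = σ.extFun (σ.ρ h v) g := by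
  have h1 : g * (h : G) ∈ Δ ↔ g ∈ Δ := Δ.mul_mem_cancel_right h.2
  by_cases h2 : g ∈ Δ
  · rw [extFun_pos h2, extFun_pos (h1.2 h2), ← Module.End.mul_apply, ← map_mul]; rfl
  · rw [extFun_neg h2, extFun_neg (mt h1.1 h2)]

lemma extFun_add (v w : σ.V) (g : G) : σ.extFun (v + w) g = σ.extFun v g + σ.extFun w g := by
  by_cases h : g ∈ Δ
  · rw [extFun_pos h, extFun_pos h, extFun_pos h, map_add]
  · rw [extFun_neg h, extFun_neg h, extFun_neg h, add_zero]

lemma extFun_smul (a : k) (v : σ.V) (g : G) : σ.extFun (a • v) g = a • σ.extFun v g := by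
  by_cases h : g ∈ Δ
  · rw [extFun_pos h, extFun_pos h, map_smul]
  · rw [extFun_neg h, extFun_neg h, smul_zero]

lemma eventually_extFun (hΔ : IsOpen (Δ : Set G)) (v : σ.V) :
    ∀ᶠ a in nhds (1 : G), ∀ x, σ.extFun v (x * a) = σ.extFun v x := by
  have h2 := σ.eventually v
  rw [nhds_subtype_eq_comap, Filter.eventually_comap] at h2
  have h1 : ∀ᶠ a in nhds (1 : G), a ∈ Δ := hΔ.mem_nhds Δ.one_mem
  filter_upwards [h1, h2] with a ha ha' x
  rw [show x * a = x * (⟨a, ha⟩ : Δ) from rfl, extFun_mul_right, ha' ⟨a, ha⟩ rfl]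

variable (σ) in
/-- The `Δ`-equivariant inclusion `σ → Ind_Δ^G(σ)` whose image consists of the functions supported
on the open subgroup `Δ`. -/
def indIncl (hΔ : IsOpen (Δ : Set G)) : σ.V →ₗ[k] σ.ind.V where
  toFun v := ⟨σ.extFun v, fun h g => extFun_mul h g v, eventually_extFun hΔ v⟩
  map_add' v w := Subtype.ext (funext (extFun_add v w))
  map_smul' a v := Subtype.ext (funext (extFun_smul a v))

lemma indIncl_map (hΔ : IsOpen (Δ : Set G)) (h : Δ) (v : σ.V) :
    σ.indIncl hΔ (σ.ρ h v) = σ.ind.ρ h (σ.indIncl hΔ v) :=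
  Subtype.ext (funext fun g => (extFun_mul_right g h v).symm)

end ind
end SmRep

variable {p : ℕ} [Fact p.Prime] {k : Type u} [Field k] [CharP k p]

section hom
variable {σ τ : SmRep k (Mirab p)}

/-- A morphism of representations of the group of matrices with rows `(1, b)`, `(0, 1)` is
`k⟦X⟧`-linear. -/
def SmRep.homXFG (j : σ.V →ₗ[k] τ.V)
    (hj : ∀ b v, j (σ.ρ (pMat 1 b) v) = τ.ρ (pMat 1 b) (j v)) :
    (σ.toXFG (p := p)).carrier →ₗ[k⟦X⟧] (τ.toXFG (p := p)).carrier where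
  toFun := j
  map_add' := j.map_add
  map_smul' a v := by
    let _ : Module k⟦X⟧ σ.V := Mir.mod σ
    let _ : Module k⟦X⟧ τ.V := Mir.mod τ
    have := Mir.tower σ
    have := Mir.tower τ
    exact semilinear_of_X j (AlgHom.id k k⟦X⟧) (dvd_refl _) (Mir.torsion σ) (Mir.torsion τ)
      (fun v => by
        rw [AlgHom.id_apply, Mir.X_smul, Mir.X_smul, map_sub, hj]) a v

lemma C_smul_XFG (T : XFGMod p k) (c : k) (w : T.carrier) : (C c : k⟦X⟧) • w = c • w := by
  have h := smul_assoc c (1 : k⟦X⟧) w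
  rwa [PowerSeries.smul_eq_C_mul, mul_one, one_smul] at h

end hom

variable [Fact (p ≠ 2)]

lemma Zt_secP (σ : SmRep k (Btilde p))
    (hσ : ∀ ζ v, σ.ρ (Btilde.mu p ζ) v = (iota p k ζ : k) • v) (x : Zt p) (a : ℚ_[p]ˣ) (b : ℚ_[p])
    (v : σ.V) : σ.ρ x (σ.ρ (secP p (pMat a b)) v) =
      ((twist p k).char x a : k) • σ.ρ (secP p (pMat a b)) (σ.ρ x v) := by
  have h1 : (secP p (pMat a b)).base.1.det = a := by
    rw [det_eq, show dB p (secP p (pMat a b)).base = 1 from (pMat a b).2, mul_one]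
    exact Units.ext rfl
  rw [← Module.End.mul_apply, ← map_mul, Zt_conj, h1, map_mul, map_mul, Module.End.mul_apply, hσ]
  rfl

lemma commute_secP (σ : SmRep k (Btilde p))
    (hσ : ∀ ζ v, σ.ρ (Btilde.mu p ζ) v = (iota p k ζ : k) • v) (x : Zt p) (b : ℚ_[p]) (v : σ.V) :
    σ.ρ x (σ.ρ (secP p (pMat 1 b)) v) = σ.ρ (secP p (pMat 1 b)) (σ.ρ x v) := by
  rw [Zt_secP σ hσ, map_one, Units.val_one, one_smul]

/-- The `k⟦X⟧[F, Γ]`-module given by the restriction of a representation of `B̃` to `P`, along the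
splitting `P → B̃`. -/
def XFGMod.ofRep (σ : SmRep k (Btilde p)) : XFGMod p k := (σ.res (secP p) (continuous_secP p)).toXFG

/-- The action of `Z̃` on a genuine representation of `B̃`. -/
def thetaRep (σ : SmRep k (Btilde p))
    (hσ : ∀ ζ v, σ.ρ (Btilde.mu p ζ) v = (iota p k ζ : k) • v) :
    Zt p →* Module.End k⟦X⟧ (XFGMod.ofRep σ).carrier where
  toFun x := SmRep.homXFG (σ := σ.res (secP p) (continuous_secP p))
    (τ := σ.res (secP p) (continuous_secP p)) (σ.ρ x) (commute_secP σ hσ x)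
  map_one' := LinearMap.ext fun v => LinearMap.congr_fun (map_one σ.ρ) v
  map_mul' x y := LinearMap.ext fun v => LinearMap.congr_fun (map_mul σ.ρ x.1 y.1) v

/-- A smooth genuine representation of `B̃`, as a `k⟦X⟧[F, Γ]`-module with an action of `Z̃`. -/
def EqXFG.ofRep (σ : SmRep k (Btilde p))
    (hσ : ∀ ζ v, σ.ρ (Btilde.mu p ζ) v = (iota p k ζ : k) • v) : EqXFG (twist p k) where
  toXFG := XFGMod.ofRep σ
  theta := thetaRep σ hσ
  theta_F x v := (Zt_secP σ hσ x _ 0 v).trans (C_smul_XFG (XFGMod.ofRep σ) _ _).symm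
  theta_gam x _ v := (Zt_secP σ hσ x _ 0 v).trans (C_smul_XFG (XFGMod.ofRep σ) _ _).symm
  smooth v := (continuous_subtype_val.tendsto' (1 : Zt p) (1 : Btilde p) rfl).eventually
    (σ.eventually v)
  genuine ζ v := (hσ ζ v).trans (C_smul_XFG (XFGMod.ofRep σ) _ _).symm

/-- The functor `D̃` on objects: the ind-metaplectic `(φ, Γ)`-module attached to a smooth genuine
representation of `B̃`. -/
def metaD (σ : SmRep k (Btilde p)) (hσ : ∀ ζ v, σ.ρ (Btilde.mu p ζ) v = (iota p k ζ : k) • v) :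
    Ind (EqMod (twist p k)) := indDEq (EqXFG.ofRep σ hσ)

/-- The projection `B̃_S → B`. -/
def projS : BSt p →* Borel p := (Btilde.proj p).comp (BSt p).subtype

variable (p k) in
/-- The character `B̃_S = B_S × μ₂ → kˣ`, `(g, ζ) ↦ ι(ζ)`. -/
def iotaS : BSt p →* kˣ :=
  MonoidHom.mk' (fun x => iota p k x.1.sgn) fun x y => by
    obtain ⟨z, hz⟩ := y.2
    have hz' : dB p y.1.base = z * z := hz
    change iota p k (x.1 * y.1).sgn = _
    rw [Btilde.sgn_mul, hz', hilb_sq_left, mul_one, map_mul]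

lemma eventually_sgn {Y : Type} [TopologicalSpace Y] {f : Y → Btilde p} (hf : Continuous f) {y : Y}
    (hy : (f y).sgn = 1) : ∀ᶠ x in nhds y, (f x).sgn = 1 :=
  ((Btilde.continuous_sgn.comp hf).tendsto' y 1 hy) ((isOpen_discrete {1}).mem_nhds rfl)


variable (π : SmRep k (Borel p))

/-- The representation `π|_{B_S} ⊠ ι` of `B̃_S = B_S × μ₂`. -/
def boxS : SmRep k (BSt p) where
  V := π.V
  ρ :=
    { toFun := fun x => (iotaS p k x : k) • π.ρ (projS x)
      map_one' := by rw [map_one, map_one, map_one, Units.val_one, one_smul]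
      map_mul' := fun x y => by
        rw [map_mul, map_mul, map_mul, Units.val_mul, smul_mul_smul_comm] }
  smooth v := SmRep.isOpen_of_eventually _ v (by
    have h1 : ∀ᶠ x in nhds (1 : BSt p), x.1.sgn = 1 :=
      eventually_sgn continuous_subtype_val rfl
    have h2 : Continuous (projS (p := p)) := Btilde.continuous_base.comp continuous_subtype_val
    filter_upwards [h1, (h2.tendsto' 1 1 (map_one _)).eventually (π.eventually v)] with x hx hx'
    change (iota p k x.1.sgn : k) • π.ρ (projS x) v = v
    rw [hx, hx', map_one, Units.val_one, one_smul])

/-- The smooth genuine representation of `B̃` induced from `π|_{B_S} ⊠ ι`. -/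
def indB : SmRep k (Btilde p) := (boxS π).ind

lemma genuine_indB (ζ : Mu2 p) (f : (indB π).V) :
    (indB π).ρ (Btilde.mu p ζ) f = (iota p k ζ : k) • f := by
  have hm : Btilde.mu p ζ ∈ BSt p := by
    change dB p 1 ∈ Subgroup.square ℚ_[p]ˣ
    rw [map_one]; exact one_mem _
  refine Subtype.ext (funext fun g => ?_)
  change f.1 (g * Btilde.mu p ζ) = (iota p k ζ : k) • f.1 g
  rw [← Btilde.mu_central]
  refine (f.2.1 ⟨_, hm⟩ g).trans ?_
  change (iota p k ζ : k) • π.ρ 1 (f.1 g) = _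
  rw [map_one]; rfl

/-- The `k⟦X⟧[F, Γ]`-module given by the restriction of `π` to the mirabolic subgroup `P`. -/
def resP : XFGMod p k := (π.res (Mirab p).subtype continuous_subtype_val).toXFG

/-- The `k⟦X⟧[F, Γ]`-module with action of `Z̃` given by the induction of `π|_{B_S} ⊠ ι` to `B̃`. -/
def indXFG : EqXFG (twist p k) := EqXFG.ofRep (indB π) (genuine_indB π)

lemma secP_mem (g : Mirab p) : secP p g ∈ BSt p := by
  change dB p g.1 ∈ Subgroup.square ℚ_[p]ˣ
  rw [MonoidHom.mem_ker.1 g.2]; exact one_mem _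

lemma boxS_secP (g : Mirab p) (v : π.V) : (boxS π).ρ ⟨_, secP_mem g⟩ v = π.ρ g v := by
  change (iota p k 1 : k) • π.ρ g v = _
  rw [map_one, Units.val_one, one_smul]

lemma indIncl_secP (g : Mirab p) (v : π.V) :
    (boxS π).indIncl (isOpen_BSt p) (π.ρ g v) =
      (indB π).ρ (secP p g) ((boxS π).indIncl (isOpen_BSt p) v) := by
  rw [← boxS_secP]
  exact SmRep.indIncl_map (σ := boxS π) (isOpen_BSt p) ⟨_, secP_mem g⟩ v

/-- The inclusion of `π` into the induction of `π|_{B_S} ⊠ ι` to `B̃`; it is `P`-equivariant. -/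
def inclP : (resP π).carrier →ₗ[k⟦X⟧] (XFGMod.ofRep (indB π)).carrier :=
  SmRep.homXFG (σ := π.res (Mirab p).subtype continuous_subtype_val)
    (τ := (indB π).res (secP p) (continuous_secP p)) ((boxS π).indIncl (isOpen_BSt p))
    fun b v => indIncl_secP π (pMat 1 b) v

lemma resP_F (v : π.V) : (resP π).F v = π.ρ (pMat (pUnit p) 0) v := rfl

variable {π} (χ : ℚ_[p]ˣ →* kˣ) (hχ : IsOpen (χ.ker : Set ℚ_[p]ˣ))

lemma eventually_etaS (hχ : IsOpen (χ.ker : Set ℚ_[p]ˣ)) :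
    ∀ᶠ x in nhds (1 : St p), etaS p χ x = 1 := by
  have h1 : ∀ᶠ x in nhds (1 : St p), x.1.1.sgn = 1 :=
    eventually_sgn (continuous_subtype_val.comp continuous_subtype_val) rfl
  have h2 : Continuous fun x : St p => zc p x := continuous_zc.comp continuous_subtype_val
  have h3 : ∀ᶠ z in nhds (1 : ℚ_[p]ˣ), χ z = 1 := hχ.mem_nhds χ.ker.one_mem
  filter_upwards [h1, (h2.tendsto' 1 1 (map_one _)).eventually h3] with x hx hx'
  change χ (zc p x) * iota p k x.1.1.sgn = 1
  rw [hx, hx', map_one, one_mul]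

lemma etaS_mu (ζ : Mu2 p) : etaS p χ (((twist p k).restrict (St p) (mu_mem_St p k)).mu ζ) =
    iota p k ζ := by
  change χ (dB p 1) * iota p k ζ = _
  rw [map_one, map_one, one_mul]

/-- The functor `D ↦ χ|_S ⊠ D ⊠ ι` to genuine `S̃`-equivariant `(φ, Γ)`-modules. -/
def boxSt : PGMod p k ⥤ EqMod ((twist p k).restrict (St p) (mu_mem_St p k)) :=
  boxFunctor _ (twist_St p k) (etaS p χ) (eventually_etaS χ hχ) (etaS_mu χ)

/-- The functor `D ↦ Ind_{S̃}^{Z̃}(χ|_S ⊠ D ⊠ ι)` on étale `(φ, Γ)`-modules. -/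
def indSt : PGMod p k ⥤ EqMod (twist p k) :=
  boxSt χ hχ ⋙ IndFunctor (twist p k) (St p) (mu_mem_St p k) (isOpen_St p)

/-- The value of the extension of the functor `D ↦ Ind_{S̃}^{Z̃}(χ|_S ⊠ D ⊠ ι)` to ind-objects at
the ind-object `D(V)`, the filtered colimit of `(τ^∨[1/X])'` over `τ ∈ M(V)`. -/
def indIndD (V : XFGMod p k) : Ind (EqMod (twist p k)) :=
  Limits.colimit (V.DFunctor ⋙ indSt χ hχ ⋙ Ind.yoneda)

/-- For `τ ∈ M(π)` and a `Z̃`-stable element `τ'` of `M(Ind(π|_{B_S} ⊠ ι))` containing `τ`, the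
statement that `g` corresponds under Frobenius reciprocity to the morphism
`(τ^∨[1/X])' → (τ'^∨[1/X])'` induced by the inclusion. -/
def IsFrobenius (τ : (resP π).MSub) (τ' : (indXFG π).MSub)
    (h : ∀ w ∈ τ.toSub, inclP π w ∈ τ'.1.toSub) (g : (indSt χ hχ).obj τ.D ⟶ τ'.D) : Prop :=
  ∀ x : τ.D.carrier, g.toHom.toLin (IndSpace.delta (D := (boxSt χ hχ).obj τ.D) 1 x) =
    XFGMod.pull ((inclP π).restrict h : τ.mod.carrier →ₗ[k⟦X⟧] τ'.1.mod.carrier) x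

end Induction
end Metaplectic

/-! The squares have finite index in `ℚ_pˣ`, every matrix of `B` is the product of a scalar and a
matrix of `B_S`, and `Z̃ ∩ B̃_S = S̃`. Hence `Z̃/S̃` parametrizes the cosets of `B̃_S` in `B̃`, and
splitting a function according to its support exhibits the induced representation `Π` as the finite
direct sum of the `Z̃`-translates of `incl(π)` (`sum_translates`). On `incl(π)` itself `S̃` acts
through the central character `χ` and `ι` (`boxS_St`). An element of `Z̃` above `z` commutes with
the unipotent matrices of `P`, so it acts `k⟦X⟧`-linearly, and it commutes with `F` and `Γ` up to
the signs `χ_z(p)` and `χ_z(γ)`. These are the signs in the definition of the induction of `(φ,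
Γ)`-modules. `InductionData` records this situation for a group `Ω` and a subgroup `Δ`: an inclusion
`i`, a projection `r`, and the decomposition `∑ θ(q) i r θ(q⁻¹) = id`. The passage to ind-objects
uses nothing else about `Π`.

For `τ ∈ M(π)` let `indMSub τ` consist of the `w` with `r(θ(x) w) ∈ τ` for all `x`, which is the sum
of the translates of `i(τ)`. It is the smallest stable element of `M(Π)` containing `i(τ)`
(`indMSub_le`), and these elements are cofinal, because a stable `τ'` is contained in the one
attached to `r(τ')` (`exists_le_indMSub`).

Frobenius reciprocity sends a function `f` on `Ω` to `∑ θ(q) D(incl)(f(q⁻¹))`, the sum being over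
`Ω/Δ`. A morphism out of an induced module is determined by its values on the `δ_{1,d}`, since their
translates span (`EqMod.hom_ext_delta`). This is part 1. As `τ ↦ D(τ)` is covariant and additive for
`k⟦X⟧`-linear maps, the decomposition of `indMSub τ` passes to `D`, so the Frobenius map is an
isomorphism when `τ' = indMSub τ` (`frob_frobInv`, `frobInv_frob`). Naturality in `τ` follows from
the uniqueness in part 1 (`frob_comp`, `map_comp_frob`), and cofinality turns the natural
isomorphism into an isomorphism of ind-objects (`indIso`). That isomorphism is unique because a
morphism out of a colimit is determined on its terms, and every `τ` has an admissible `τ'`, namely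
`indMSub τ`. -/

namespace Metaplectic
open PowerSeries CategoryTheory
-- Frobenius reciprocity for equivariant `(φ, Γ)`-modules.
noncomputable section Reciprocity
set_option linter.unusedSectionVars false
variable {p : ℕ} [Fact p.Prime] {k : Type u} [Field k] [CharP k p]
  {Ω : Type} [Group Ω] [TopologicalSpace Ω] {t : TwistDatum p k Ω}

/-- A morphism of equivariant `(φ, Γ)`-modules with a linear inverse is an isomorphism. -/
def EqMod.isoOfLinear {D E : EqMod t} (f : D ⟶ E)
    (g : E.toPG.carrier →ₗ[LaurentSeries k] D.toPG.carrier)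
    (hgf : ∀ x, g (f.toHom.toLin x) = x) (hfg : ∀ y, f.toHom.toLin (g y) = y) : D ≅ E where
  hom := f
  inv :=
    { toHom :=
      { toLin := g
        map_phi := fun y => by
          -- Writing `y` as `f (g y)` lets the compatibility of `f` be used, after which `g` cancels
          -- `f`; the same works for `Γ` and `Ω`. So only linearity of an inverse ever has to be
          -- checked.
          conv_lhs => rw [← hfg y]
          rw [← f.toHom.map_phi, hgf]
        map_gam := fun γ y => by
          conv_lhs => rw [← hfg y]
          rw [← f.toHom.map_gam, hgf] }
      map_theta := fun a y => by
        conv_lhs => rw [← hfg y]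
        rw [← f.map_theta, hgf] }
  hom_inv_id := EqMod.Hom.ext (PGMod.Hom.ext (LinearMap.ext hgf))
  inv_hom_id := EqMod.Hom.ext (PGMod.Hom.ext (LinearMap.ext hfg))

variable [IsTopologicalGroup Ω] {Δ : Subgroup Ω} [Δ.FiniteIndex] {hmu : ∀ ζ, t.mu ζ ∈ Δ}
  {D : EqMod (t.restrict Δ hmu)} {E : EqMod t}
  {f : D.toPG.carrier →ₗ[LaurentSeries k] E.toPG.carrier}

namespace IndSpace

variable (f) in
/-- The term of index `y` of the map given by Frobenius reciprocity. -/
def recipTerm (y : Ω) : IndSpace D →ₗ[LaurentSeries k] E.toPG.carrier where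
  toFun F := E.theta y (f (F.1 y⁻¹))
  map_add' F F' := by
    change E.theta y (f (F.1 y⁻¹ + F'.1 y⁻¹)) = _
    rw [map_add, map_add]
  map_smul' a F := by
    change E.theta y (f (a • F.1 y⁻¹)) = _
    rw [map_smul, map_smul]; rfl

lemma recipTerm_apply (y : Ω) (F : IndSpace D) : recipTerm f y F = E.theta y (f (F.1 y⁻¹)) := rfl

/-- Since `F((y h)⁻¹) = θ(h⁻¹) F(y⁻¹)` and `f` is `Δ`-equivariant, the factors `θ(h)` and `θ(h⁻¹)`
cancel. The term thus depends only on the left coset of `y`, and the sum over arbitrary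
representatives is canonical. -/
lemma recipTerm_mul (hθ : ∀ (h : Δ) x, f (D.theta h x) = E.theta h (f x)) (y : Ω) (h : Δ)
    (F : IndSpace D) : recipTerm f (y * h) F = recipTerm f y F := by
  have h1 : F.1 (y * h)⁻¹ = D.theta h⁻¹ (F.1 y⁻¹) := by
    rw [← F.2, mul_inv_rev]; rfl
  rw [recipTerm_apply, recipTerm_apply, h1, hθ, ← Module.End.mul_apply, ← map_mul]
  congr 2
  simp

lemma recipTerm_congr (hθ : ∀ (h : Δ) x, f (D.theta h x) = E.theta h (f x)) {y z : Ω}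
    (h : (y : Ω ⧸ Δ) = z) (F : IndSpace D) : recipTerm f y F = recipTerm f z F := by
  have := recipTerm_mul hθ y ⟨_, QuotientGroup.eq.1 h⟩ F
  rwa [mul_inv_cancel_left, eq_comm] at this

/-- Right translation by `a` evaluates `F` at `y⁻¹ a = (a⁻¹ y)⁻¹`, and `θ(y) = θ(a) θ(a⁻¹ y)`. So
`a` permutes the terms of the reciprocity sum; no equivariance of `f` enters. -/
lemma recipTerm_theta (a y : Ω) (F : IndSpace D) :
    recipTerm f y (theta a F) = E.theta a (recipTerm f (a⁻¹ * y) F) := by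
  rw [recipTerm_apply, recipTerm_apply, ← Module.End.mul_apply, ← map_mul, mul_inv_cancel_left,
    mul_inv_rev, inv_inv]
  rfl

/-- Two twists cancel: `χ_{y⁻¹}(p)` from the definition of `φ` on the induced space at `y⁻¹`, and
`χ_y(p)` from moving `θ(y)` past `φ` on `E`. Each single term is therefore already `φ`-equivariant.
For `Γ` the argument is the same, with `γ` in place of `p`. -/
lemma recipTerm_phi (hφ : ∀ x, f (D.toPG.phi x) = E.toPG.phi (f x)) (y : Ω) (F : IndSpace D) :
    recipTerm f y (phi F) = E.toPG.phi (recipTerm f y F) := by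
  change E.theta y (f (t.cst y⁻¹ _ • D.toPG.phi (F.1 y⁻¹))) = _
  rw [map_smul, map_smul, hφ, E.theta_phi, smul_smul, t.cst_inv, one_smul]; rfl

lemma recipTerm_gam (hγ : ∀ γ x, f (D.toPG.gam γ x) = E.toPG.gam γ (f x)) (γ : ℤ_[p]ˣ) (y : Ω)
    (F : IndSpace D) : recipTerm f y (gam γ F) = E.toPG.gam γ (recipTerm f y F) := by
  change E.theta y (f (t.cst y⁻¹ _ • D.toPG.gam γ (F.1 y⁻¹))) = _
  rw [map_smul, map_smul, hγ, E.theta_gam, smul_smul, t.cst_inv, one_smul]; rfl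

/-- The induced space is generated over `Ω` by the functions supported on `Δ`; this is what makes
reciprocity morphisms unique. -/
lemma delta_eq_theta (g : Ω) (x : D.toPG.carrier) : delta g x = theta g⁻¹ (delta 1 x) := by
  refine IndSpace.ext fun g' => ?_
  change (delta g x).1 g' = (delta 1 x).1 (g' * g⁻¹)
  by_cases h : g' * g⁻¹ ∈ Δ
  · rw [delta_pos h, delta_pos (by simpa using h)]
    congr 2
    simp
  · rw [delta_neg h, delta_neg (by simpa using h)]

end IndSpace

variable [Fintype (Ω ⧸ Δ)]

variable (f) in
/-- The linear map given by Frobenius reciprocity. -/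
def IndSpace.recip : IndSpace D →ₗ[LaurentSeries k] E.toPG.carrier :=
  -- Inverting representatives of the left cosets gives representatives `q.out⁻¹` of the right
  -- cosets, which determine `F`. For a general linear `f` the sum depends on the representatives;
  -- equivariance is imposed only in `EqMod.recip`.
  ∑ q : Ω ⧸ Δ, recipTerm f q.out

lemma IndSpace.recip_apply (F : IndSpace D) :
    recip f F = ∑ q : Ω ⧸ Δ, recipTerm f q.out F := LinearMap.sum_apply _ _ _

/-- The morphism from the induction of `D` to `E` given by Frobenius reciprocity. -/
def EqMod.recip (hΔ : IsOpen (Δ : Set Ω)) (f : D.toPG.carrier →ₗ[LaurentSeries k] E.toPG.carrier)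
    (hφ : ∀ x, f (D.toPG.phi x) = E.toPG.phi (f x))
    (hγ : ∀ γ x, f (D.toPG.gam γ x) = E.toPG.gam γ (f x))
    (hθ : ∀ (h : Δ) x, f (D.theta h x) = E.theta h (f x)) : IndObj D hΔ ⟶ E where
  toHom :=
    { toLin := IndSpace.recip f
      map_phi := fun F => by
        refine (IndSpace.recip_apply _).trans (.trans ?_ (congrArg _ (IndSpace.recip_apply F)).symm)
        rw [map_sum]
        exact Finset.sum_congr rfl fun q _ => IndSpace.recipTerm_phi hφ _ F
      map_gam := fun γ F => by
        refine (IndSpace.recip_apply _).trans (.trans ?_ (congrArg _ (IndSpace.recip_apply F)).symm)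
        rw [map_sum]
        exact Finset.sum_congr rfl fun q _ => IndSpace.recipTerm_gam hγ γ _ F }
  map_theta a F := by
    refine (IndSpace.recip_apply _).trans (.trans ?_ (congrArg _ (IndSpace.recip_apply F)).symm)
    -- Left multiplication by `a` permutes the cosets, so the term of index `a q` on the left is
    -- matched with the term of index `q` on the right.
    rw [map_sum, ← Equiv.sum_comp (MulAction.toPerm a : Equiv.Perm (Ω ⧸ Δ))]
    refine Finset.sum_congr rfl fun q _ => ?_
    refine (IndSpace.recipTerm_theta a _ F).trans (congrArg _ ?_)
    -- The elements `a⁻¹ * (a • q).out` and `q.out` need not be equal, but they represent the same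
    -- coset.
    refine IndSpace.recipTerm_congr hθ ?_ F
    rw [QuotientGroup.out_eq', MulAction.toPerm_apply]
    change a⁻¹ • (((a • q).out : Ω) : Ω ⧸ Δ) = q
    rw [QuotientGroup.out_eq', inv_smul_smul]

variable {hΔ : IsOpen (Δ : Set Ω)} {hφ : ∀ x, f (D.toPG.phi x) = E.toPG.phi (f x)}
    {hγ : ∀ γ x, f (D.toPG.gam γ x) = E.toPG.gam γ (f x)}
    {hθ : ∀ (h : Δ) x, f (D.theta h x) = E.theta h (f x)}

lemma EqMod.recip_apply (F : IndSpace D) : (EqMod.recip hΔ f hφ hγ hθ).toHom.toLin F =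
    ∑ q : Ω ⧸ Δ, E.theta q.out (f (F.1 q.out⁻¹)) := IndSpace.recip_apply F

/-- `δ_{1,x}` vanishes at `q.out⁻¹` unless `q` is the trivial coset, so a single term of the sum
survives. -/
lemma EqMod.recip_delta (x : D.toPG.carrier) :
    (EqMod.recip hΔ f hφ hγ hθ).toHom.toLin (IndSpace.delta 1 x) = f x := by
  rw [EqMod.recip_apply, Finset.sum_eq_single (QuotientGroup.mk 1)]
  -- The chosen representative of the trivial coset may be any element of `Δ`; independence of
  -- representatives allows replacing it by `1`.
  · refine (IndSpace.recipTerm_congr hθ (QuotientGroup.out_eq' _) (IndSpace.delta 1 x)).trans ?_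
    rw [IndSpace.recipTerm_apply, map_one, Module.End.one_apply, inv_one,
      IndSpace.delta_pos (by simp), show (⟨(1 : Ω) * 1⁻¹, _⟩ : Δ) = 1 from Subtype.ext (by simp),
      map_one, Module.End.one_apply]
  · intro q _ hq
    rw [IndSpace.delta_neg, map_zero, map_zero]
    rw [inv_one, mul_one, inv_mem_iff]
    intro h
    refine hq ?_
    rw [← QuotientGroup.out_eq' q, QuotientGroup.eq]
    simpa using h
  · intro h; exact absurd (Finset.mem_univ _) h

/-- A morphism from an induced module is determined by its restriction to the functions supported
on the subgroup. -/
lemma EqMod.hom_ext_delta {hΔ : IsOpen (Δ : Set Ω)} {g g' : IndObj D hΔ ⟶ E}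
    (h : ∀ x, g.toHom.toLin (IndSpace.delta 1 x) = g'.toHom.toLin (IndSpace.delta 1 x)) :
    g = g' := by
  refine EqMod.Hom.ext (PGMod.Hom.ext (LinearMap.ext fun F => ?_))
  have h1 : ∀ (r : Ω) (x : D.toPG.carrier),
      g.toHom.toLin (IndSpace.delta r x) = g'.toHom.toLin (IndSpace.delta r x) := fun r x => by
    rw [IndSpace.delta_eq_theta]
    exact (g.map_theta _ _).trans ((congrArg _ (h x)).trans (g'.map_theta _ _).symm)
  -- By finite index every `F` is a finite sum of functions `δ_{r,x}`, and on those `h1` gives the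
  -- agreement.
  have h2 := IndSpace.sum_delta (D := D) F
  refine (congrArg g.toHom.toLin h2).trans (.trans ?_ (congrArg g'.toHom.toLin h2).symm)
  refine (map_sum g.toHom.toLin _ _).trans (.trans ?_ (map_sum g'.toHom.toLin _ _).symm)
  exact Finset.sum_congr rfl fun q _ => h1 _ _

end Reciprocity
end Metaplectic

namespace Metaplectic
open PowerSeries CategoryTheory
-- Induced `k⟦X⟧[F, Γ]`-modules and their submodules `indMSub τ`.
noncomputable section InducedModule
set_option linter.unusedSectionVars false
variable {p : ℕ} [Fact p.Prime] {k : Type u} [Field k] [CharP k p]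

section
variable {M M' : Type u} [AddCommGroup M] [Module k M] [Module k⟦X⟧ M] [IsScalarTower k k⟦X⟧ M]
  [AddCommGroup M'] [Module k M'] [Module k⟦X⟧ M'] [IsScalarTower k k⟦X⟧ M']

/-- If a finite family of linear maps `M → M'` is jointly injective and `M'[X]` is finite
dimensional, then `M[X]` is finite dimensional. -/
lemma finite_torsion_of_injective {ι : Type} [Finite ι] (j : ι → M →ₗ[k⟦X⟧] M')
    (hj : ∀ w w', (∀ i, j i w = j i w') → w = w')
    (hfin : Module.Finite k (Submodule.torsionBy k⟦X⟧ M' X)) :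
    Module.Finite k (Submodule.torsionBy k⟦X⟧ M X) := by
  have hmem (i : ι) : ∀ w ∈ Submodule.torsionBy k⟦X⟧ M X,
      j i w ∈ Submodule.torsionBy k⟦X⟧ M' X := fun w hw => by
    rw [Submodule.mem_torsionBy_iff] at *
    rw [← map_smul, hw, map_zero]
  refine Module.Finite.of_injective (LinearMap.pi fun i : ι =>
    ((j i).restrict (hmem i)).restrictScalars k) fun w w' h => Subtype.ext (hj _ _ fun i => ?_)
  exact congrArg Subtype.val (congrFun h i)

end

namespace XFGMod

section pull
variable {T T' : XFGMod p k}

/-- A functional on `T'` is additive, so its pullback is additive in `j`. Together with `pull_sum`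
and `pull_C_smul` this makes `D` additive on all `k⟦X⟧`-linear maps, whether or not they commute
with `F` and `Γ`. Direct sum decompositions can therefore be transported to `D`. -/
lemma pull_add (j₁ j₂ : T.carrier →ₗ[k⟦X⟧] T'.carrier) (u : T.DSpace) :
    pull (j₁ + j₂) u = pull j₁ u + pull j₂ u := by
  refine LinearMap.ext fun f => ?_
  change u (PDual.map (j₁ + j₂) f) = u (PDual.map j₁ f) + u (PDual.map j₂ f)
  rw [← map_add]
  exact congrArg u (PDual.ext fun w => map_add (PDual.lin f) _ _)

lemma pull_zero (u : T.DSpace) : pull (0 : T.carrier →ₗ[k⟦X⟧] T'.carrier) u = 0 := by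
  have := pull_add (0 : T.carrier →ₗ[k⟦X⟧] T'.carrier) 0 u
  rwa [add_zero, left_eq_add] at this

lemma pull_sum {ι : Type} (s : Finset ι) (j : ι → T.carrier →ₗ[k⟦X⟧] T'.carrier) (u : T.DSpace) :
    pull (∑ i ∈ s, j i) u = ∑ i ∈ s, pull (j i) u := by
  classical
  induction s using Finset.induction_on with
  | empty => rw [Finset.sum_empty, Finset.sum_empty, pull_zero]
  | insert a s ha ih => rw [Finset.sum_insert ha, Finset.sum_insert ha, pull_add, ih]

/-- Used for the constants `η(h)` by which `Δ` acts on the image of `i` and through which `r` is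
equivariant. -/
lemma pull_C_smul (c : k) (j : T.carrier →ₗ[k⟦X⟧] T'.carrier) (u : T.DSpace) :
    pull ((C c : k⟦X⟧) • j) u = constK k c • pull j u := by
  refine LinearMap.ext fun f => ?_
  change u (PDual.map ((C c : k⟦X⟧) • j) f) = constK k c * u (PDual.map j f)
  rw [← map_C_smul]
  exact congrArg u (PDual.ext fun w => congrArg f (map_smul j _ _).symm)

end pull

section map
variable {V W : XFGMod p k}

/-- The image of an element of `M(V)` under an equivariant map. -/
def MSub.map (j : V.carrier →ₗ[k⟦X⟧] W.carrier) (hF : ∀ v, j (V.F v) = W.F (j v))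
    (hγ : ∀ γ v, j (V.gam γ v) = W.gam γ (j v)) (τ : V.MSub) : W.MSub where
  toSub := τ.toSub.map j
  stable := ⟨by
    rintro _ ⟨w, hw, rfl⟩
    exact ⟨_, τ.stable.1 w hw, hF w⟩, by
    rintro γ _ ⟨w, hw, rfl⟩
    exact ⟨_, τ.stable.2 γ w hw, hγ γ w⟩⟩
  fg := by
    obtain ⟨s, hs, hτ⟩ := τ.fg
    refine ⟨j '' s, hs.image j, ⟨⟨?_, ?_⟩, ?_⟩, fun U hU => ?_⟩
    · rintro _ ⟨w, hw, rfl⟩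
      exact ⟨_, τ.stable.1 w hw, hF w⟩
    · rintro γ _ ⟨w, hw, rfl⟩
      exact ⟨_, τ.stable.2 γ w hw, hγ γ w⟩
    · exact Set.image_mono hτ.1.2
    -- The preimage of `U` is stable and contains the generators `s` of `τ`, hence contains `τ`. So
    -- the image of `τ` is generated by the image of `s`.
    · refine Submodule.map_le_iff_le_comap.2 (hτ.2 ⟨⟨fun w hw => ?_, fun γ w hw => ?_⟩,
        fun w hw => hU.2 ⟨w, hw, rfl⟩⟩)
      · rw [Submodule.mem_comap, hF]; exact hU.1.1 _ hw
      · rw [Submodule.mem_comap, hγ]; exact hU.1.2 _ _ hw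
  fin := by
    -- Torsion of a quotient is not a quotient of the torsion, so finiteness is checked on duals.
    -- The dual of the image embeds into the dual of `τ`, which is finitely generated over the
    -- noetherian ring `k⟦X⟧`.
    have h1 : Module.Finite k⟦X⟧ (PDual k τ.toSub) := PDual.finite τ.mod.torsion τ.fin
    refine PDual.finite_torsion (Module.Finite.of_injective (PDual.map (k := k)
      (j.submoduleMap τ.toSub)) fun f g hfg => PDual.ext fun w => ?_)
    obtain ⟨v, rfl⟩ := j.submoduleMap_surjective τ.toSub w
    exact DFunLike.congr_fun hfg v

end map
end XFGMod

variable {Ω : Type} [Group Ω] [TopologicalSpace Ω] {t : TwistDatum p k Ω}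

/-- The structure of an induction on an equivariant `k⟦X⟧[F, Γ]`-module `W`: it is the direct sum
of the translates of the image of `V` under `i`, on which `Δ` acts through a character `η`. -/
structure InductionData (V : XFGMod p k) (W : EqXFG t) (Δ : Subgroup Ω) [Fintype (Ω ⧸ Δ)]
    (η : Δ →* kˣ) where
  i : V.carrier →ₗ[k⟦X⟧] W.toXFG.carrier
  r : W.toXFG.carrier →ₗ[k⟦X⟧] V.carrier
  i_F : ∀ v, i (V.F v) = W.toXFG.F (i v)
  i_gam : ∀ γ v, i (V.gam γ v) = W.toXFG.gam γ (i v)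
  r_F : ∀ w, r (W.toXFG.F w) = V.F (r w)
  r_gam : ∀ γ w, r (W.toXFG.gam γ w) = V.gam γ (r w)
  theta_i : ∀ (h : Δ) v, W.theta h (i v) = (C (η h : k) : k⟦X⟧) • i v
  r_i : ∀ v, r (i v) = v
  -- With `r_i` this says that `r` is the projection to the summand `i(V)`, killing the other
  -- translates; it yields the directness of the sum, while `sum` below says that the translates
  -- exhaust `W`.
  r_theta_i : ∀ x ∉ Δ, ∀ v, r (W.theta x (i v)) = 0
  r_theta : ∀ (h : Δ) w, r (W.theta h w) = (C (η h : k) : k⟦X⟧) • r w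
  sum : ∀ w, ∑ q : Ω ⧸ Δ, W.theta q.out (i (r (W.theta q.out⁻¹ w))) = w

namespace InductionData
variable {V : XFGMod p k} {W : EqXFG t} {Δ : Subgroup Ω} [Fintype (Ω ⧸ Δ)] {η : Δ →* kˣ}
  (d : InductionData V W Δ η)

/-- The components of `i v` are scalar multiples of `v` or zero, according to whether `x` lies in
`Δ`. This places `i(τ)` inside `indSub τ`. -/
lemma r_theta_i_mem (τ : V.MSub) (x : Ω) {v : V.carrier} (hv : v ∈ τ.toSub) :
    d.r (W.theta x (d.i v)) ∈ τ.toSub := by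
  by_cases hx : x ∈ Δ
  · rw [d.r_theta ⟨x, hx⟩, d.r_i]
    exact Submodule.smul_mem _ _ hv
  · rw [d.r_theta_i x hx]
    exact Submodule.zero_mem _

/-- The sum of the translates of `τ`. -/
def indSub (τ : V.MSub) : Submodule k⟦X⟧ W.toXFG.carrier :=
  -- If `W` is a space of functions and `r` is evaluation at `1`, this condition says that all
  -- values on `Ω` lie in `τ`. In this form stability under `Ω` and monotonicity in `τ` are
  -- immediate. That the result is the sum of the translates follows from `i_mem_indSub`,
  -- `theta_mem_indSub` and `indSub_le`.
  ⨅ x : Ω, τ.toSub.comap (d.r ∘ₗ W.theta x)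

lemma mem_indSub {τ : V.MSub} {w : W.toXFG.carrier} :
    w ∈ d.indSub τ ↔ ∀ x, d.r (W.theta x w) ∈ τ.toSub := by
  rw [indSub, Submodule.mem_iInf]; rfl

/-- Moving `θ(x)` past `F` or `γ` costs only the scalar `χ_x(p)` or `χ_x(γ)`, which does not affect
membership in a submodule. -/
lemma isStable_indSub (τ : V.MSub) : W.toXFG.IsStable (d.indSub τ) := by
  refine ⟨fun w hw => d.mem_indSub.2 fun x => ?_, fun γ w hw => d.mem_indSub.2 fun x => ?_⟩
  · rw [W.theta_F, map_smul, d.r_F]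
    exact Submodule.smul_mem _ _ (τ.stable.1 _ (d.mem_indSub.1 hw x))
  · rw [W.theta_gam, map_smul, d.r_gam]
    exact Submodule.smul_mem _ _ (τ.stable.2 _ _ (d.mem_indSub.1 hw x))

lemma theta_mem_indSub {τ : V.MSub} (g : Ω) {w : W.toXFG.carrier} (hw : w ∈ d.indSub τ) :
    W.theta g w ∈ d.indSub τ := d.mem_indSub.2 fun x => by
  rw [← Module.End.mul_apply, ← map_mul]
  exact d.mem_indSub.1 hw _

lemma i_mem_indSub {τ : V.MSub} {v : V.carrier} (hv : v ∈ τ.toSub) : d.i v ∈ d.indSub τ :=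
  d.mem_indSub.2 fun x => d.r_theta_i_mem τ x hv

/-- The decomposition `sum` writes an element of `indSub τ` through the translates, by coset
representatives, of elements of `i(τ)`; hence it suffices to test these finitely many translates of
`τ`. -/
lemma indSub_le {τ : V.MSub} {U : Submodule k⟦X⟧ W.toXFG.carrier}
    (h : ∀ (q : Ω ⧸ Δ), ∀ v ∈ τ.toSub, W.theta q.out (d.i v) ∈ U) : d.indSub τ ≤ U := by
  intro w hw
  rw [← d.sum w]
  exact Submodule.sum_mem _ fun q _ => h q _ (d.mem_indSub.1 hw _)

/-- If `s` generates `τ`, the translates of `i(s)` by coset representatives generate `indSub τ`, and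
there are finitely many of them because `Ω/Δ` is finite. -/
lemma fg_indSub (τ : V.MSub) : ∃ s : Set W.toXFG.carrier, s.Finite ∧
    IsLeast {U | W.toXFG.IsStable U ∧ s ⊆ U} (d.indSub τ) := by
  obtain ⟨s, hs, hτ⟩ := τ.fg
  refine ⟨⋃ q : Ω ⧸ Δ, (fun v => W.theta q.out (d.i v)) '' s,
    Set.finite_iUnion fun q => hs.image _, ⟨d.isStable_indSub τ, ?_⟩, fun U hU => ?_⟩
  · refine Set.iUnion_subset fun q => ?_
    rintro _ ⟨v, hv, rfl⟩
    exact d.theta_mem_indSub _ (d.i_mem_indSub (hτ.1.2 hv))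
  · refine d.indSub_le fun q v hv => ?_
    -- The map `θ(q) i` is equivariant only up to scalars, but this is enough for the preimage of a
    -- stable submodule to be stable. As the preimage contains `s`, it contains `τ`.
    have h1 : V.IsStable (U.comap (W.theta q.out ∘ₗ d.i)) := by
      refine ⟨fun w hw => ?_, fun γ w hw => ?_⟩
      · change W.theta q.out (d.i (V.F w)) ∈ U
        rw [d.i_F, W.theta_F]
        exact Submodule.smul_mem _ _ (hU.1.1 _ hw)
      · change W.theta q.out (d.i (V.gam γ w)) ∈ U
        rw [d.i_gam, W.theta_gam]
        exact Submodule.smul_mem _ _ (hU.1.2 _ _ hw)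
    exact hτ.2 ⟨h1, fun v hv => hU.2 (Set.mem_iUnion.2 ⟨q, v, hv, rfl⟩)⟩ hv

/-- By `sum`, an element is determined by its finitely many components `r(θ(q⁻¹) w)`, all of which
lie in `τ`. -/
lemma finite_torsion_indSub (τ : V.MSub) :
    Module.Finite k (Submodule.torsionBy k⟦X⟧ (d.indSub τ) X) := by
  refine finite_torsion_of_injective (fun q : Ω ⧸ Δ =>
    (d.r ∘ₗ W.theta q.out⁻¹).restrict fun w hw => d.mem_indSub.1 hw _) (fun w w' h =>
      Subtype.ext ?_) τ.fin
  rw [← d.sum w.1, ← d.sum w'.1]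
  refine Finset.sum_congr rfl fun q _ => ?_
  have h1 : d.r (W.theta q.out⁻¹ w.1) = d.r (W.theta q.out⁻¹ w'.1) := congrArg Subtype.val (h q)
  rw [h1]

/-- The sum of the translates of `τ`, as an `Ω`-stable element of `M(W)`. -/
def indMSub (τ : V.MSub) : W.MSub :=
  ⟨⟨d.indSub τ, d.isStable_indSub τ, d.fg_indSub τ, d.finite_torsion_indSub τ⟩,
    fun g _ hw => d.theta_mem_indSub g hw⟩

lemma indMSub_mono : Monotone d.indMSub := fun _ _ h _ hw =>
  d.mem_indSub.2 fun x => h (d.mem_indSub.1 hw x)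

/-- A stable `τ'` containing `i(τ)` contains all its translates. So every Frobenius morphism from
`Ind(η ⊠ D(τ))` to `D(τ')` factors through the universal one, with target `D(indMSub τ)`. -/
lemma indMSub_le {τ : V.MSub} {τ' : W.MSub} (h : ∀ w ∈ τ.toSub, d.i w ∈ τ'.1.toSub) :
    d.indMSub τ ≤ τ' := d.indSub_le fun _ v hv => τ'.2 _ _ (h v hv)

/-- Take `τ = r(τ')`: since `τ'` is `Ω`-stable, all components `r(θ(x) w)` of its elements lie
there. This is the cofinality on which the comparison of ind-objects rests. -/
lemma exists_le_indMSub (τ' : W.MSub) : ∃ τ, τ' ≤ d.indMSub τ :=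
  ⟨τ'.1.map d.r d.r_F d.r_gam, fun _ hw => d.mem_indSub.2 fun x => ⟨_, τ'.2 x _ hw, rfl⟩⟩

lemma final_functor : d.indMSub_mono.functor.Final :=
  d.indMSub_mono.final_functor_iff.2 d.exists_le_indMSub

end InductionData
end InducedModule
end Metaplectic

namespace Metaplectic
open PowerSeries CategoryTheory
-- The isomorphism `Ind(η ⊠ D(τ)) ≅ D(indMSub τ)` and its passage to the colimit.
noncomputable section InducedIndObject
set_option linter.unusedSectionVars false
variable {p : ℕ} [Fact p.Prime] {k : Type u} [Field k] [CharP k p]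
  {Ω : Type} [Group Ω] [TopologicalSpace Ω] [IsTopologicalGroup Ω] {t : TwistDatum p k Ω}
  {V : XFGMod p k} {W : EqXFG t} {Δ : Subgroup Ω} [Δ.FiniteIndex] [Fintype (Ω ⧸ Δ)]
  {hmu : ∀ ζ, t.mu ζ ∈ Δ} (hΔ : IsOpen (Δ : Set Ω))
  (htriv : ∀ g, (t.restrict Δ hmu).char g = 1) {η : Δ →* kˣ}
  (hη : ∀ᶠ g in nhds (1 : Δ), η g = 1)
  (hημ : ∀ ζ, η ((t.restrict Δ hmu).mu ζ) = iota p k ζ)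

/-- The functor `D ↦ Ind_Δ^Ω(η ⊠ D)`. -/
abbrev boxInd : PGMod p k ⥤ EqMod t :=
  boxFunctor (t.restrict Δ hmu) htriv η hη hημ ⋙ IndFunctor t Δ hmu hΔ

lemma IndSpace.map_delta {D E : EqMod (t.restrict Δ hmu)} (j : D ⟶ E) (g : Ω)
    (x : D.toPG.carrier) : IndSpace.map D j (delta g x) = delta g (j.toHom.toLin x) := by
  refine IndSpace.ext fun g' => ?_
  change j.toHom.toLin ((delta g x).1 g') = _
  by_cases h : g' * g⁻¹ ∈ Δ
  · rw [delta_pos h, delta_pos h, j.map_theta]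
  · rw [delta_neg h, delta_neg h, map_zero]

lemma EqXFG.MSub.act_mul (τ' : W.MSub) (g g' : Ω) :
    τ'.act (g * g') = τ'.act g ∘ₗ τ'.act g' :=
  LinearMap.ext fun w => Subtype.ext (LinearMap.congr_fun (map_mul W.theta g g') w.1)

namespace InductionData
variable (d : InductionData V W Δ η)

/-- The inclusion `τ → τ'` for `τ ∈ M(V)` and `τ' ∈ M(W)` containing the image of `τ`. -/
abbrev incl {τ : V.MSub} {τ' : W.MSub} (h : ∀ w ∈ τ.toSub, d.i w ∈ τ'.1.toSub) :
    τ.mod.carrier →ₗ[k⟦X⟧] τ'.1.mod.carrier := d.i.restrict h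

variable {τ : V.MSub} {τ' : W.MSub} (h : ∀ w ∈ τ.toSub, d.i w ∈ τ'.1.toSub)

/-- This is the `Δ`-equivariance required by reciprocity: `Δ` acts on `i(τ)` by the scalars `η`, and
`D` carries scalars to scalars. -/
lemma theta_pull (g : Δ) (u : τ.mod.DSpace) :
    XFGMod.pull (τ'.act g) (XFGMod.pull (d.incl h) u) =
      constK k (η g) • XFGMod.pull (d.incl h) u := by
  rw [← XFGMod.pull_C_smul]
  have h1 : τ'.act g ∘ₗ d.incl h = (C (η g : k) : k⟦X⟧) • d.incl h :=
    LinearMap.ext fun w => Subtype.ext (d.theta_i g w.1)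
  rw [← h1]; rfl

/-- The morphism `Ind(η ⊠ D(τ)) → D(τ')` that corresponds to the inclusion under Frobenius
reciprocity. -/
def frob : (boxInd hΔ htriv hη hημ).obj τ.D ⟶ τ'.D :=
  EqMod.recip (D := boxObj (t.restrict Δ hmu) htriv η hη hημ τ.D) (E := τ'.D) hΔ
    (XFGMod.pull (d.incl h))
    -- The twisting constant is `1`, because `i` commutes with `F` on the nose; likewise for `Γ`
    -- below.
    (fun x => (XFGMod.pull_phi (j := d.incl h) 1
      (fun w => by rw [map_one, one_smul]; exact Subtype.ext (d.i_F w.1)) x).trans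
        (by rw [map_one, one_smul]; rfl))
    (fun γ x => (XFGMod.pull_gam (j := d.incl h) 1 γ
      (fun w => by rw [map_one, one_smul]; exact Subtype.ext (d.i_gam γ w.1)) x).trans
        (by rw [map_one, one_smul]; rfl))
    (fun g x => ((XFGMod.pull (d.incl h)).map_smul _ _).trans (d.theta_pull h g x).symm)

lemma frob_delta (x : τ.D.carrier) : (d.frob hΔ htriv hη hημ h).toHom.toLin
    (IndSpace.delta (D := (boxFunctor (t.restrict Δ hmu) htriv η hη hημ).obj τ.D) 1 x) =
      XFGMod.pull (d.incl h) x :=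
  EqMod.recip_delta (D := boxObj (t.restrict Δ hmu) htriv η hη hημ τ.D) (E := τ'.D) x

/-- The uniqueness half of reciprocity. Compatibility of the Frobenius morphisms with the transition
maps is reduced to their values on `δ_{1,x}` by this. -/
lemma eq_frob {g : (boxInd hΔ htriv hη hημ).obj τ.D ⟶ τ'.D} (hg : ∀ x : τ.D.carrier, g.toHom.toLin
    (IndSpace.delta (D := (boxFunctor (t.restrict Δ hmu) htriv η hη hημ).obj τ.D) 1 x) =
      XFGMod.pull (d.incl h) x) : g = d.frob hΔ htriv hη hημ h :=
  EqMod.hom_ext_delta (D := boxObj (t.restrict Δ hmu) htriv η hη hημ τ.D) (E := τ'.D) (hΔ := hΔ)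
    fun x => by
      have h1 := d.frob_delta hΔ htriv hη hημ h x
      exact (hg x).trans h1.symm

/-- The projection from the sum of the translates of `τ` to `τ`. -/
def projMod (τ : V.MSub) : (d.indMSub τ).1.mod.carrier →ₗ[k⟦X⟧] τ.mod.carrier :=
  d.r.restrict fun w hw => by
    have := d.mem_indSub.1 hw 1
    rwa [map_one] at this

/-- The linear inverse of the morphism given by Frobenius reciprocity from `Ind(η ⊠ D(τ))` to
`D(τ')`, for the sum `τ'` of the translates of `τ`. -/
def frobInv (τ : V.MSub) : (d.indMSub τ).D.toPG.carrier →ₗ[LaurentSeries k]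
    IndSpace (boxObj (t.restrict Δ hmu) htriv η hη hημ τ.D) where
  -- The value at `x` is obtained by applying `D` to the component map `w ↦ r(θ(x) w)`. The
  -- transformation rule under `Δ` is `r_theta`.
  toFun u := ⟨fun x => XFGMod.pull (d.projMod τ ∘ₗ (d.indMSub τ).act x) u, fun g x => by
    have h1 : d.projMod τ ∘ₗ (d.indMSub τ).act (g * x) =
        (C (η g : k) : k⟦X⟧) • d.projMod τ ∘ₗ (d.indMSub τ).act x := by
      rw [EqXFG.MSub.act_mul]
      exact LinearMap.ext fun w => Subtype.ext (d.r_theta g (W.theta x w.1))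
    refine Eq.trans ?_ (XFGMod.pull_C_smul (T := (d.indMSub τ).1.mod) _ _ u)
    exact congrArg (fun j => XFGMod.pull j u) h1⟩
  map_add' u v := IndSpace.ext fun x =>
    map_add (XFGMod.pull (d.projMod τ ∘ₗ (d.indMSub τ).act x)) u v
  map_smul' a u := IndSpace.ext fun x =>
    map_smul (XFGMod.pull (d.projMod τ ∘ₗ (d.indMSub τ).act x)) a u

lemma incl_mem_indMSub (τ : V.MSub) : ∀ w ∈ τ.toSub, d.i w ∈ (d.indMSub τ).1.toSub :=
  fun _ hw => d.i_mem_indSub hw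

/-- This is the image under `D` of the decomposition `∑ θ(q) i r θ(q⁻¹) = id`. -/
lemma frob_frobInv (τ : V.MSub) (u : (d.indMSub τ).D.toPG.carrier) :
    (d.frob hΔ htriv hη hημ (d.incl_mem_indMSub τ)).toHom.toLin (d.frobInv htriv hη hημ τ u) =
      u := by
  refine (EqMod.recip_apply _).trans ?_
  let j (q : Ω ⧸ Δ) := (d.indMSub τ).act q.out ∘ₗ d.incl (d.incl_mem_indMSub τ) ∘ₗ
    d.projMod τ ∘ₗ (d.indMSub τ).act q.out⁻¹
  refine (XFGMod.pull_sum Finset.univ j u).symm.trans (XFGMod.pull_eq_self (fun w => ?_) u)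
  refine Subtype.ext (Eq.trans ?_ (d.sum w.1))
  rw [LinearMap.sum_apply]
  exact map_sum (d.indMSub τ).1.toSub.subtype _ _

lemma pull_proj_of_mem (τ : V.MSub) (g : Δ) (u : τ.mod.DSpace) :
    XFGMod.pull (d.projMod τ ∘ₗ (d.indMSub τ).act g ∘ₗ d.incl (d.incl_mem_indMSub τ)) u =
      constK k (η g) • u :=
  XFGMod.pull_smul _ (fun w : τ.toSub => Subtype.ext
    ((d.r_theta g (d.i w.1)).trans (congrArg ((C (η g : k) : k⟦X⟧) • ·) (d.r_i w.1)))) u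

/-- With `pull_proj_of_mem` this computes the matrix entries `r θ(x) i` on `D(τ)`: zero off `Δ`, the
scalar `η` on `Δ`. -/
lemma pull_proj_of_notMem (τ : V.MSub) {x : Ω} (hx : x ∉ Δ) (u : τ.mod.DSpace) :
    XFGMod.pull (d.projMod τ ∘ₗ (d.indMSub τ).act x ∘ₗ d.incl (d.incl_mem_indMSub τ)) u = 0 := by
  rw [show d.projMod τ ∘ₗ (d.indMSub τ).act x ∘ₗ d.incl (d.incl_mem_indMSub τ) = 0 from
    LinearMap.ext fun w => Subtype.ext (d.r_theta_i x hx w.1), XFGMod.pull_zero]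

/-- The value at `x` is `∑ D(r θ(x q) i)(F(q⁻¹))`. Only the coset `q` of `x⁻¹` contributes, and
there `F` transforms by `η(x q)`. -/
lemma frobInv_frob (τ : V.MSub) (F : IndSpace (boxObj (t.restrict Δ hmu) htriv η hη hημ τ.D)) :
    d.frobInv htriv hη hημ τ
      ((d.frob hΔ htriv hη hημ (d.incl_mem_indMSub τ)).toHom.toLin F) = F := by
  refine IndSpace.ext fun x => ?_
  refine (congrArg (XFGMod.pull (d.projMod τ ∘ₗ (d.indMSub τ).act x))
    (EqMod.recip_apply F)).trans ((map_sum _ _ _).trans ?_)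
  have h1 : ∀ q : Ω ⧸ Δ, XFGMod.pull (d.projMod τ ∘ₗ (d.indMSub τ).act x)
      ((d.indMSub τ).theta q.out
        (XFGMod.pull (d.incl (d.incl_mem_indMSub τ)) (F.1 q.out⁻¹))) =
      XFGMod.pull (d.projMod τ ∘ₗ (d.indMSub τ).act (x * q.out) ∘ₗ
        d.incl (d.incl_mem_indMSub τ)) (F.1 q.out⁻¹) := fun q => by
    rw [EqXFG.MSub.act_mul]
    rfl
  have h2 : ∀ q : Ω ⧸ Δ, x * q.out ∈ Δ ↔ QuotientGroup.mk x⁻¹ = q := fun q => by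
    conv_rhs => rw [← QuotientGroup.out_eq' q]
    rw [QuotientGroup.eq, inv_inv]
  refine (Finset.sum_eq_single (QuotientGroup.mk x⁻¹) (fun q _ hq => (h1 q).trans
    (d.pull_proj_of_notMem τ (fun h => hq ((h2 q).1 h).symm) _))
    (fun h => absurd (Finset.mem_univ _) h)).trans ((h1 _).trans ?_)
  -- The surviving term is `η(x q) F(q⁻¹)`, which is `F(x q q⁻¹) = F(x)` by the transformation rule
  -- of `F`.
  refine (d.pull_proj_of_mem τ ⟨_, (h2 _).2 rfl⟩ _).trans ((F.2 ⟨_, (h2 _).2 rfl⟩ _).symm.trans ?_)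
  exact congrArg F.1 (mul_inv_cancel_right _ _)

/-- The isomorphism from `Ind(η ⊠ D(τ))` to `D(τ')`, for the sum `τ'` of the translates of `τ`. -/
def frobIso (τ : V.MSub) : (boxInd hΔ htriv hη hημ).obj τ.D ≅ (d.indMSub τ).D :=
  EqMod.isoOfLinear (d.frob hΔ htriv hη hημ (d.incl_mem_indMSub τ)) (d.frobInv htriv hη hημ τ)
    (d.frobInv_frob hΔ htriv hη hημ τ) (d.frob_frobInv hΔ htriv hη hημ τ)

/-- Both sides send `δ_{1,x}` to the image of `x` under the inclusion of `τ` into `τ''`, so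
uniqueness applies. The next lemma is the counterpart for a change of `τ`. -/
lemma frob_comp {τ' τ'' : W.MSub} (h : ∀ w ∈ τ.toSub, d.i w ∈ τ'.1.toSub) (hle : τ' ≤ τ'') :
    d.frob hΔ htriv hη hημ h ≫ W.DFunctor.map (homOfLE hle) =
      d.frob hΔ htriv hη hημ fun w hw => hle (h w hw) :=
  d.eq_frob hΔ htriv hη hημ _ fun x =>
    congrArg (XFGMod.pull (XFGMod.MSub.incl hle)) (d.frob_delta hΔ htriv hη hημ h x)

lemma map_comp_frob {τ₀ τ : V.MSub} (hle : τ₀ ≤ τ) (h : ∀ w ∈ τ.toSub, d.i w ∈ τ'.1.toSub) :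
    (boxInd hΔ htriv hη hημ).map (V.DFunctor.map (homOfLE hle)) ≫ d.frob hΔ htriv hη hημ h =
      d.frob hΔ htriv hη hημ fun w hw => h w (hle hw) :=
  d.eq_frob hΔ htriv hη hημ _ fun x => by
    have h1 : IndSpace.map _ ((boxFunctor (t.restrict Δ hmu) htriv η hη hημ).map
        (V.DFunctor.map (homOfLE hle))) (IndSpace.delta (D :=
          (boxFunctor (t.restrict Δ hmu) htriv η hη hημ).obj τ₀.D) 1 x) =
        IndSpace.delta (D := (boxFunctor (t.restrict Δ hmu) htriv η hη hημ).obj τ.D) 1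
          (XFGMod.pull (XFGMod.MSub.incl hle) x) :=
      IndSpace.map_delta _ _ _
    exact (congrArg _ h1).trans (d.frob_delta hΔ htriv hη hημ h _)

/-- The isomorphisms `Ind(η ⊠ D(τ)) ≅ D(τ')`, for the sums `τ'` of the translates of `τ`, are
natural in `τ`. -/
def frobNatIso : V.DFunctor ⋙ boxInd hΔ htriv hη hημ ≅ d.indMSub_mono.functor ⋙ W.DFunctor :=
  -- For `τ₀ ≤ τ` both paths around the naturality square are the Frobenius morphism from `Ind(η ⊠
  -- D(τ₀))` to `D(indMSub τ)`.
  NatIso.ofComponents (d.frobIso hΔ htriv hη hημ) fun f =>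
    (d.map_comp_frob hΔ htriv hη hημ (leOfHom f) _).trans
      (d.frob_comp hΔ htriv hη hημ _ (d.indMSub_mono (leOfHom f))).symm

/-- The isomorphism from the induction of the ind-object `D(V)` to the ind-object `D(W)`. -/
def indIso : Limits.colimit (V.DFunctor ⋙ boxInd hΔ htriv hη hημ ⋙ Ind.yoneda) ≅ indDEq W :=
  have := d.final_functor
  -- The natural isomorphism identifies the source with the colimit over the modules `indMSub τ`
  -- alone; finality then extends the index set to all stable submodules.
  Limits.HasColimit.isoOfNatIso
    (Functor.isoWhiskerRight (d.frobNatIso hΔ htriv hη hημ) Ind.yoneda) ≪≫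
    Functor.Final.colimitIso d.indMSub_mono.functor (W.DFunctor ⋙ Ind.yoneda)

lemma ι_indIso_hom (τ : V.MSub) :
    Limits.colimit.ι (V.DFunctor ⋙ boxInd hΔ htriv hη hημ ⋙ Ind.yoneda) τ ≫
      (d.indIso hΔ htriv hη hημ).hom =
        Ind.yoneda.map (d.frob hΔ htriv hη hημ (d.incl_mem_indMSub τ)) ≫
          Limits.colimit.ι (W.DFunctor ⋙ Ind.yoneda) (d.indMSub τ) := by
  have := d.final_functor
  refine (Limits.HasColimit.isoOfNatIso_ι_hom_assoc (Functor.isoWhiskerRight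
    (d.frobNatIso hΔ htriv hη hημ) Ind.yoneda) _ _).trans ?_
  exact congrArg _ (Functor.Final.ι_colimitIso_hom d.indMSub_mono.functor
    (W.DFunctor ⋙ Ind.yoneda) τ)

/-- As `indMSub τ ≤ τ'`, the canonical morphism from `D(indMSub τ)` to the colimit factors through
`D(τ')`. By `frob_comp` the first part of this factorization turns the Frobenius morphism to
`D(indMSub τ)` into the one to `D(τ')`. -/
lemma ι_indIso_hom_of_mem :
    Limits.colimit.ι (V.DFunctor ⋙ boxInd hΔ htriv hη hημ ⋙ Ind.yoneda) τ ≫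
      (d.indIso hΔ htriv hη hημ).hom =
        Ind.yoneda.map (d.frob hΔ htriv hη hημ h) ≫
          Limits.colimit.ι (W.DFunctor ⋙ Ind.yoneda) τ' := by
  refine (d.ι_indIso_hom hΔ htriv hη hημ τ).trans ?_
  have h1 := d.frob_comp hΔ htriv hη hημ (d.incl_mem_indMSub τ) (d.indMSub_le h)
  have h2 := Limits.colimit.w (W.DFunctor ⋙ Ind.yoneda) (homOfLE (d.indMSub_le h))
  refine (congrArg _ h2.symm).trans ((Category.assoc _ _ _).symm.trans ?_)
  exact congrArg (· ≫ Limits.colimit.ι (W.DFunctor ⋙ Ind.yoneda) τ')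
    ((Ind.yoneda.map_comp _ _).symm.trans (congrArg Ind.yoneda.map h1))

end InductionData
end InducedIndObject
end Metaplectic

namespace Metaplectic
open PowerSeries CategoryTheory
-- The induction from `B̃_S` to `B̃` as an instance of `InductionData`.
noncomputable section InductionBorel
set_option linter.unusedSectionVars false
variable {p : ℕ} [Fact p.Prime] [Fact (p ≠ 2)] {k : Type u} [Field k] [CharP k p]
  (π : SmRep k (Borel p))

/-- Evaluation at `1` on the induction of `π|_{B_S} ⊠ ι`. -/
def evalOne : (indB π).V →ₗ[k] π.V where
  toFun f := f.1 1
  map_add' _ _ := rfl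
  map_smul' _ _ := rfl

/-- At the point `1`, right translation by an element of `B̃_S` agrees with left translation, which
the induced functions turn into the action on `π`. -/
lemma evalOne_of_mem (g : BSt p) (f : (indB π).V) :
    evalOne π ((indB π).ρ g f) = (boxS π).ρ g (evalOne π f) := by
  change f.1 (1 * g) = (boxS π).ρ g (f.1 1)
  rw [one_mul, ← f.2.1, mul_one]

lemma evalOne_secP (g : Mirab p) (f : (indB π).V) :
    evalOne π ((indB π).ρ (secP p g) f) = π.ρ g (evalOne π f) :=
  (evalOne_of_mem π ⟨_, secP_mem g⟩ f).trans (boxS_secP π g _)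

/-- Evaluation at `1` as a `k⟦X⟧`-linear map. -/
def evalP : (XFGMod.ofRep (indB π)).carrier →ₗ[k⟦X⟧] (resP π).carrier :=
  SmRep.homXFG (σ := (indB π).res (secP p) (continuous_secP p))
    (τ := π.res (Mirab p).subtype continuous_subtype_val) (evalOne π)
    fun b v => evalOne_secP π (pMat 1 b) v

/-- On `B̃_S` the function `incl(f(z))` reproduces `f` on the coset of `z`; this recovers `f` from
its values at coset representatives. -/
lemma indIncl_apply_of_mem {g : Btilde p} (h : g ∈ BSt p) (f : (indB π).V) (z : Btilde p) :
    ((boxS π).indIncl (isOpen_BSt p) (f.1 z)).1 g = f.1 (g * z) :=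
  (SmRep.extFun_pos (σ := boxS π) h _).trans (f.2.1 ⟨g, h⟩ z).symm

lemma indIncl_apply_of_notMem {g : Btilde p} (h : g ∉ BSt p) (v : π.V) :
    ((boxS π).indIncl (isOpen_BSt p) v).1 g = 0 :=
  SmRep.extFun_neg (σ := boxS π) h _

/-- An element of `Z̃` above a given scalar. -/
lemma exists_zc (z : ℚ_[p]ˣ) : ∃ x : Zt p, zc p x = z :=
  ⟨⟨⟨scalarB p z, 1⟩, z, rfl⟩, dB_scalarB z⟩

/-- The term of index `q` is the restriction of `f` to the coset `B̃_S q⁻¹`. These cosets partition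
`B̃` because the lower right entry maps `Z̃` onto `ℚ_pˣ` and membership in `B̃_S` depends only on
the square class of that entry. -/
lemma sum_translates [Fintype (Zt p ⧸ St p)] (f : (indB π).V) :
    ∑ q : Zt p ⧸ St p, (indB π).ρ q.out.1 ((boxS π).indIncl (isOpen_BSt p)
      (evalOne π ((indB π).ρ (q.out⁻¹ : Zt p) f))) = f := by
  refine Subtype.ext (funext fun g => ?_)
  -- Evaluation at `g` is additive, so the identity can be tested pointwise.
  have h0 : ∀ F : Zt p ⧸ St p → (indB π).V, (∑ q, F q : (indB π).V).1 g = ∑ q, (F q).1 g :=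
    fun F => by
      refine Eq.trans ?_ (Finset.sum_apply g Finset.univ fun q => (F q).1)
      exact congrFun (map_sum (boxS π).indSub.subtype F Finset.univ) g
  refine (h0 _).trans ?_
  -- `x` lies above the scalar matrix with the same lower right entry as `g`. Hence `g` and `x` are
  -- in the same coset of `B̃_S`, and `g q ∈ B̃_S` can be decided inside `Z̃`.
  obtain ⟨x, hx⟩ := exists_zc (dB p g.base)
  have h1 : ∀ q : Zt p ⧸ St p, g * q.out.1 ∈ BSt p ↔ QuotientGroup.mk x⁻¹ = q := fun q => by
    conv_rhs => rw [← QuotientGroup.out_eq' q]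
    rw [QuotientGroup.eq, inv_inv]
    change dB p (g.base * q.out.1.base) ∈ Subgroup.square ℚ_[p]ˣ ↔
      zc p (x * q.out) ∈ Subgroup.square ℚ_[p]ˣ
    rw [map_mul, map_mul, hx]
    rfl
  -- For any other `q` the point `g q` lies outside `B̃_S`, where the included function vanishes.
  refine (Finset.sum_eq_single (QuotientGroup.mk x⁻¹) (fun q _ hq =>
    indIncl_apply_of_notMem π (fun h => hq ((h1 q).1 h).symm) _)
    (fun h => absurd (Finset.mem_univ _) h)).trans ?_
  refine (indIncl_apply_of_mem π ((h1 _).2 rfl) f _).trans (congrArg f.1 ?_)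
  rw [one_mul]
  exact mul_inv_cancel_right _ _

variable {π} {χ : ℚ_[p]ˣ →* kˣ}

/-- Elements of `S̃` lie above scalar matrices, on which `π` is given by its central character,
while `μ₂` contributes `ι`. The product of the two scalars is the character used in the induction of
`D(π)`. -/
lemma boxS_St
    (hπ : ∀ (z : ℚ_[p]ˣ) (v : π.V), π.ρ (scalarB p z) v = (χ z : k) • v) (h : St p) (v : π.V) : (boxS π).ρ ⟨h.1.1, h.2⟩ v = (etaS p χ h : k) • v := by
  change (iota p k h.1.1.sgn : k) • π.ρ h.1.1.base v =
    ((χ (zc p h) * iota p k h.1.1.sgn : kˣ) : k) • v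
  rw [base_Zt, hπ, smul_smul, Units.val_mul, mul_comm]

/-- The structure of an induction on the representation induced from `π|_{B_S} ⊠ ι`. -/
def inductionData [Fintype (Zt p ⧸ St p)]
    (hπ : ∀ (z : ℚ_[p]ˣ) (v : π.V), π.ρ (scalarB p z) v = (χ z : k) • v) :
    InductionData (resP π) (indXFG π) (St p) (etaS p χ) where
  i := inclP π
  r := evalP π
  i_F v := indIncl_secP π _ v
  i_gam _ v := indIncl_secP π _ v
  r_F f := evalOne_secP π _ f
  r_gam _ f := evalOne_secP π _ f
  theta_i h v := by
    refine ((SmRep.indIncl_map (σ := boxS π) (isOpen_BSt p) ⟨h.1.1, h.2⟩ v).symm.trans ?_).trans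
      (C_smul_XFG (XFGMod.ofRep (indB π)) _ _).symm
    exact (congrArg ((boxS π).indIncl (isOpen_BSt p)) (boxS_St hπ h v)).trans
      (map_smul ((boxS π).indIncl (isOpen_BSt p)) (etaS p χ h : k) v)
  r_i v := by
    refine (SmRep.extFun_pos (σ := boxS π) (one_mem (BSt p)) v).trans ?_
    exact LinearMap.congr_fun (map_one (boxS π).ρ) v
  -- Evaluating the translate by `x` at `1` evaluates `incl(v)` at `x`. An element of `Z̃` is in
  -- `S̃` exactly when it is in `B̃_S`, both conditions being that its lower right entry is a
  -- square.
  r_theta_i x hx v := indIncl_apply_of_notMem π (by rwa [one_mul]) v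
  r_theta h f := ((evalOne_of_mem π ⟨h.1.1, h.2⟩ f).trans (boxS_St hπ h _)).trans
    (C_smul_XFG (resP π) _ _).symm
  sum f := sum_translates π f

end InductionBorel
end Metaplectic

/-! ### The proposition. -/

open Metaplectic CategoryTheory in
theorem mainTheorem6 (p : ℕ) [Fact p.Prime] [Fact (p ≠ 2)] (k : Type u) [Field k] [Finite k]
    [CharP k p] (π : SmRep k (Borel p)) (χ : ℚ_[p]ˣ →* kˣ) (hχ : IsOpen (χ.ker : Set ℚ_[p]ˣ))
    (hπ : ∀ (z : ℚ_[p]ˣ) (v : π.V), π.ρ (scalarB p z) v = (χ z : k) • v) :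
    (∀ (τ : (resP π).MSub) (τ' : (indXFG π).MSub)
      (h : ∀ w ∈ τ.toSub, inclP π w ∈ τ'.1.toSub), ∃! g, IsFrobenius χ hχ τ τ' h g) ∧
    ∃! Φ : metaD (indB π) (genuine_indB π) ≅ indIndD χ hχ (resP π),
      ∀ (τ : (resP π).MSub) (τ' : (indXFG π).MSub)
        (h : ∀ w ∈ τ.toSub, inclP π w ∈ τ'.1.toSub)
        (g : (indSt χ hχ).obj τ.D ⟶ τ'.D), IsFrobenius χ hχ τ τ' h g →
          Limits.colimit.ι ((resP π).DFunctor ⋙ indSt χ hχ ⋙ Ind.yoneda) τ ≫ Φ.inv =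
            Ind.yoneda.map g ≫ Limits.colimit.ι ((indXFG π).DFunctor ⋙ Ind.yoneda) τ' := by
  have := (St p).fintypeQuotientOfFiniteIndex
  let d := inductionData hπ
  -- Any morphism corresponding to the inclusion is the constructed one. This gives uniqueness in
  -- part 1, and in part 2 it reduces an arbitrary `g` to `frob`.
  have heq : ∀ {τ : (resP π).MSub} {τ' : (indXFG π).MSub}
      (h : ∀ w ∈ τ.toSub, inclP π w ∈ τ'.1.toSub) {g : (indSt χ hχ).obj τ.D ⟶ τ'.D},
      IsFrobenius χ hχ τ τ' h g → g = d.frob (isOpen_St p) (twist_St p k)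
        (eventually_etaS χ hχ) (etaS_mu χ) h := fun h _ hg =>
    d.eq_frob (isOpen_St p) (twist_St p k) (eventually_etaS χ hχ) (etaS_mu χ) h hg
  refine ⟨fun τ τ' h => ⟨_, d.frob_delta (isOpen_St p) (twist_St p k) (eventually_etaS χ hχ)
    (etaS_mu χ) h, fun g hg => heq h hg⟩,
    (d.indIso (isOpen_St p) (twist_St p k) (eventually_etaS χ hχ) (etaS_mu χ)).symm,
    fun τ τ' h g hg => ?_, fun Φ hΦ => ?_⟩
  · rw [heq h hg]
    exact d.ι_indIso_hom_of_mem (isOpen_St p) (twist_St p k) (eventually_etaS χ hχ) (etaS_mu χ) h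
  -- An isomorphism is determined by its inverse, and this inverse by its restrictions to the terms
  -- of the colimit. The condition for the single choice `τ' = indMSub τ` already fixes the
  -- restriction to the term of index `τ`.
  · refine Iso.ext_inv (Limits.colimit.hom_ext fun τ => ?_)
    exact (hΦ τ _ (d.incl_mem_indMSub τ) _ (d.frob_delta (isOpen_St p) (twist_St p k)
      (eventually_etaS χ hχ) (etaS_mu χ) _)).trans
      (d.ι_indIso_hom (isOpen_St p) (twist_St p k) (eventually_etaS χ hχ) (etaS_mu χ) τ).symm
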